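/- Let $G$ be a finite graph, $D\subseteq V(G)$ a set of vertices (the defense) and $A\subseteq V(G)$ a set of vertices (the attack). A vertex $v\in V(G)\setminus A$ survives if $G-A$ contains a path from $v$ to some vertex of $D$; all other vertices of $G$ (including those of $A$) are disabled. The problem CP(Fixed Defense, Pure Attack) is: given $G$, $D$ and positive integers $\ell$ and $\alpha$, is there an attack $A$ with $|A|\le\ell$ that disables at least $\alpha$ vertices? Theorem. There is an algorithm that, given a graph $G$ with $n$ vertices, a tree decomposition $(T,\mathcal B)$ of $G$ of width $\mathsf{tw}$ whose tree $T$ has $N$ nodes, a defense $D$, and positive integers $\ell$ and $\alpha$, decides CP(Fixed Defense, Pure Attack) in time $$O\bigl(9^{\mathsf{tw}}\cdot \mathsf{tw}_+^2\cdot \ell^2\cdot n+\mathsf{tw}_+^2\cdot N\bigr),\qquad \mathsf{tw}_+=\max\{\mathsf{tw},1\}.$$ In particular, for $\mathsf{tw}\ge 1$ and $N=O(n)$ the time is $O(9^{\mathsf{tw}}\cdot \mathsf{tw}^2\cdot \ell^2\cdot n)$. Here the algorithm is a single program, independent of the input, for a word RAM with unit-cost operations and words of $O(\log B)$ bits, where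 $B$ is the sum of $\ell+\alpha+2$ and the displayed expression. The graph $G$ and the (unrooted) tree $T$ are given by adjacency lists, and $D$ and the bags by lists of vertices, all in arbitrary order. The constants hidden in the $O$-notation are absolute. (For the graph without vertices, $\mathsf{tw}$ is read as $0$.) -/

import Mathlib

namespace ControllerGame

/-! ## The game -/

section Game

variable {V : Type*}

/-- Under defense `D` and attack `A`, the vertex `v` survives: `v` is not attacked and the graph
`G - A` contains a path from `v` to some vertex of `D`. -/
def Survives (G : SimpleGraph V) (D A : Finset V) (v : V) : Prop :=
  ∃ (hv : v ∉ A) (d : V) (hd : d ∉ A), d ∈ D ∧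
    (G.induce {x | x ∉ A}).Reachable ⟨v, hv⟩ ⟨d, hd⟩

open Classical in
/-- The payoff of the attacker: the number of disabled (that is, not surviving) vertices. -/
noncomputable def attackerPayoff [Fintype V] (G : SimpleGraph V) (D A : Finset V) : ℕ :=
  (Finset.univ.filter fun v => ¬ Survives G D A v).card

/-- The question of CP(Fixed Defense, Pure Attack): is there an attack on at most `ℓ` vertices
whose payoff for the attacker is at least `α`? -/
def FixedDefensePureAttack [Fintype V] (G : SimpleGraph V) (D : Finset V) (ℓ α : ℕ) : Prop :=
  ∃ A : Finset V, A.card ≤ ℓ ∧ α ≤ attackerPayoff G D A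

/-- `(T, bag)` is a tree decomposition of `G`. -/
structure IsTreeDecomposition {ι : Type*} (G : SimpleGraph V) (T : SimpleGraph ι)
    (bag : ι → Finset V) : Prop where
  isTree : T.IsTree
  vertex_mem : ∀ v, ∃ t, v ∈ bag t
  edge_mem : ∀ u v, G.Adj u v → ∃ t, u ∈ bag t ∧ v ∈ bag t
  connected : ∀ v, (T.induce {t | v ∈ bag t}).Connected

/-- The width of a tree decomposition: the largest size of a bag, minus one
(and `0` if all bags are empty, which happens only for the graph without vertices). -/
def width {ι : Type*} [Fintype ι] (bag : ι → Finset V) : ℕ :=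
  (Finset.univ.sup fun t => (bag t).card) - 1

end Game

/-! ## The machine: a word RAM, programmed in structured form

The machine has registers and zero-initialised arrays, both holding natural numbers below a word
limit `W` (that is, words of about `log₂ W` bits). A program is a fixed finite text, and so it
uses only finitely many registers and arrays. Every arithmetic operation, comparison, memory
access, assignment and test costs one step. An operation whose result is not below `W` is not
possible: the program then has no run. -/

/-- The binary operations on words. `lt` and `eq` give `1` for true and `0` for false. -/
inductive Op
  | add | sub | mul | div | mod | lt | eq

/-- The result of an operation (before the comparison with the word limit); subtraction is
truncated at `0`. -/
def Op.apply : Op → ℕ → ℕ → ℕ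
  | .add, x, y => x + y
  | .sub, x, y => x - y
  | .mul, x, y => x * y
  | .div, x, y => x / y
  | .mod, x, y => x % y
  | .lt, x, y => if x < y then 1 else 0
  | .eq, x, y => if x = y then 1 else 0

/-- A memory state: the contents of the registers, and of every cell of every array. -/
structure State where
  reg : ℕ → ℕ
  arr : ℕ → ℕ → ℕ

/-- Expressions: a constant, a register, a cell of an array (at a computed index), or an
operation. -/
inductive Expr
  | const (k : ℕ)
  | reg (x : ℕ)
  | cell (a : ℕ) (index : Expr)
  | op (o : Op) (e₁ e₂ : Expr)

/-- The value of an expression. -/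
def Expr.eval (s : State) : Expr → ℕ
  | .const k => k
  | .reg x => s.reg x
  | .cell a e => s.arr a (e.eval s)
  | .op o e₁ e₂ => o.apply (e₁.eval s) (e₂.eval s)

/-- The number of steps that the evaluation of an expression takes. -/
def Expr.cost : Expr → ℕ
  | .const _ => 1
  | .reg _ => 1
  | .cell _ e => e.cost + 1
  | .op _ e₁ e₂ => e₁.cost + e₂.cost + 1

/-- All values that occur in the evaluation of an expression are words. -/
def Expr.Fits (W : ℕ) (s : State) : Expr → Prop
  | .const k => k < W
  | .reg x => s.reg x < W
  | .cell a e => e.Fits W s ∧ s.arr a (e.eval s) < W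
  | .op o e₁ e₂ => e₁.Fits W s ∧ e₂.Fits W s ∧ o.apply (e₁.eval s) (e₂.eval s) < W

/-- Programs. -/
inductive Program
  | skip
  /-- `x := e` -/
  | assign (x : ℕ) (e : Expr)
  /-- `a[e₁] := e₂` -/
  | store (a : ℕ) (e₁ e₂ : Expr)
  | seq (p q : Program)
  /-- `if e ≠ 0 then p else q` -/
  | branch (e : Expr) (p q : Program)
  /-- `while e ≠ 0 do p` -/
  | loop (e : Expr) (p : Program)

/-- `Run W p s s' k`: with word limit `W`, the program `p`, started in state `s`, halts in state
`s'` after exactly `k` steps. -/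
inductive Run (W : ℕ) : Program → State → State → ℕ → Prop
  | skip (s : State) : Run W .skip s s 1
  | assign (s : State) (x : ℕ) (e : Expr) (he : e.Fits W s) :
      Run W (.assign x e) s ⟨Function.update s.reg x (e.eval s), s.arr⟩ (e.cost + 1)
  | store (s : State) (a : ℕ) (e₁ e₂ : Expr) (h₁ : e₁.Fits W s) (h₂ : e₂.Fits W s) :
      Run W (.store a e₁ e₂) s
        ⟨s.reg, Function.update s.arr a (Function.update (s.arr a) (e₁.eval s) (e₂.eval s))⟩
        (e₁.cost + e₂.cost + 1)
  | seq (p q : Program) (s s' s'' : State) (k k' : ℕ) (hp : Run W p s s' k)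
      (hq : Run W q s' s'' k') : Run W (.seq p q) s s'' (k + k')
  | branch_true (e : Expr) (p q : Program) (s s' : State) (k : ℕ) (he : e.Fits W s)
      (hne : e.eval s ≠ 0) (hp : Run W p s s' k) :
      Run W (.branch e p q) s s' (e.cost + 1 + k)
  | branch_false (e : Expr) (p q : Program) (s s' : State) (k : ℕ) (he : e.Fits W s)
      (h0 : e.eval s = 0) (hq : Run W q s s' k) :
      Run W (.branch e p q) s s' (e.cost + 1 + k)
  | loop_done (e : Expr) (p : Program) (s : State) (he : e.Fits W s) (h0 : e.eval s = 0) :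
      Run W (.loop e p) s s (e.cost + 1)
  | loop_again (e : Expr) (p : Program) (s s' s'' : State) (k k' : ℕ) (he : e.Fits W s)
      (hne : e.eval s ≠ 0) (hp : Run W p s s' k) (hl : Run W (.loop e p) s' s'' k') :
      Run W (.loop e p) s s'' (e.cost + 1 + k + k')

/-- The initial state for an input that consists of finitely many arrays: they are stored in the
arrays `0, 1, 2, …`; all registers and all other cells are `0`. -/
def State.init (input : List (List ℕ)) : State :=
  ⟨fun _ => 0, fun a i => (input.getD a []).getD i 0⟩

/-! ## The encoding of the input -/

/-- The list `L` lists the elements of `S`, each exactly once, in an arbitrary order. -/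
def Lists {n : ℕ} (L : List ℕ) (S : Set (Fin n)) : Prop :=
  L.Nodup ∧ ∀ x, x ∈ L ↔ ∃ v ∈ S, (v : ℕ) = x

/-- `L` is the sequence of lists of the sets `F 0, …, F (m - 1)`. -/
def ListsFamily {m n : ℕ} (L : List (List ℕ)) (F : Fin m → Set (Fin n)) : Prop :=
  L.length = m ∧ ∀ i : Fin m, Lists (L.getD i []) (F i)

/-- The positions at which the members of `L` start in the concatenation of `L`, followed by the
length of the concatenation. -/
def offsets (L : List (List ℕ)) : List ℕ :=
  (L.map List.length).scanl (· + ·) 0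

/-- The input arrays: `n`, the number `N` of nodes, `ℓ`, `α` and the size of the defense; the list
of the defense; the adjacency lists of the graph; the adjacency lists of the tree; the lists of the
bags. A sequence of lists is stored as its concatenation, preceded by the array of offsets. -/
def inputArrays (n N ℓ α : ℕ) (defense : List ℕ) (adjG adjT bags : List (List ℕ)) :
    List (List ℕ) :=
  [[n, N, ℓ, α, defense.length], defense, offsets adjG, adjG.flatten, offsets adjT, adjT.flatten,
    offsets bags, bags.flatten]

/-- `9^tw · tw² · ℓ² · n + tw² · N`, with `tw` read as `1` in the factors `tw²` if it is `0`. -/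
def timeBound (tw ℓ n N : ℕ) : ℕ :=
  9 ^ tw * (max tw 1) ^ 2 * ℓ ^ 2 * n + (max tw 1) ^ 2 * N

end ControllerGame

/-!
The theorem is proved by dynamic programming over the tree decomposition, on tables with a row for
each of the `3 ^ (tw + 1)` colourings of a bag and a column for each number of attacks.

*The problem as a minimisation.* Colour a vertex `0` if it is attacked, `1` if it is disabled but
not attacked, and `2` if it survives. A colouring is consistent with some attack if no vertex of
the defense has colour `1` and no edge joins the colours `1` and `2`. The true surviving set has
these properties. Conversely, in a consistent colouring every vertex that survives the attack on
the vertices of colour `0` has colour `2`, so that counting colour `2` can only overestimate the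
survivors. An attack with payoff at least `α` therefore exists if and only if the minimum number of
vertices of colour `2`, over consistent colourings with at most `ℓ` vertices of colour `0`, is at
most `n - α`. Violations are not forbidden but penalised by `n + 1`, so that all costs are natural
numbers; the budget of attacks is distributed over the vertices, and a vertex of colour `0` without
a share of the budget is penalised in the same way (`initCosts`,
`Numbering.fixedDefensePureAttack_iff`).

*Elimination of the vertices.* The nodes of the tree are ordered by a search
(`exec_progSearch`), and the vertices are numbered `1, …, n` by the first bag in which they occur
(`exec_progNumber`). Let `B i` consist of the numbers up to `i` in the first bag with the vertex
`i`. Since the bags with a given vertex are connected, and a tree has no edges apart from those to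
the parents in the search, every earlier neighbour of `i` is in `B i` (`mem_first_bag`), and
`B i` without `i` is contained in `B p`, where `p` is its largest member below `i` (`Numbering`,
`Numbering.mem_parentOf`). If `i` is the only member, `p` is a dummy vertex `0` without costs of its
own. The cost function of `i` depends only on the colours in `B i`. In
decreasing order the vertices are eliminated: the minimum over the colour of `i`, in min-plus
convolution over the budget, is added to the cost function of `p`. What remains is the optimum as a
function of the budget (`eliminated_le_iff`). There is one elimination for each vertex rather than
for each node of the tree, and the convolution takes `O(ℓ²)` steps for each of the `3 ^ (tw + 1)`
colourings. For `tw ≥ 1` this gives `O(3 ^ tw · tw · ℓ² · n)` steps, within the bound; the numbering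
takes `O(tw² · N)` steps. The adjacency lists are scanned once for each colouring, and their
total length is `O(tw · n)`, since every vertex has at most `tw` earlier neighbours
(`Numbering.sum_length_le`).

*The program.* Programs are verified with a small logic: `Exec W p s k Q` says that `p` halts
within `k` steps in a state with property `Q`. Programs without loops are handled by a
verification condition (`Exec.of_vc`), loops by the rules `Exec.forUp_amortized`, `Exec.forUp_sum`
and `Exec.forUp`, and what a program does not write to is unchanged (`Exec.frame`). If `α > n`, the
program rejects at once, before it builds any tables; this includes the graph without vertices.
-/

namespace ControllerGame

/-! ### A program logic for the word RAM -/

/-- The state `s` with `v` written to register `x`. -/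
def State.set (s : State) (x v : ℕ) : State := ⟨Function.update s.reg x v, s.arr⟩

/-- The state `s` with `v` written to cell `i` of array `a`. -/
def State.put (s : State) (a i v : ℕ) : State :=
  ⟨s.reg, Function.update s.arr a (Function.update (s.arr a) i v)⟩

@[simp] theorem State.set_reg (s : State) (x v y : ℕ) :
    (s.set x v).reg y = if y = x then v else s.reg y := by
  simp [State.set, Function.update_apply]

@[simp] theorem State.set_arr (s : State) (x v : ℕ) : (s.set x v).arr = s.arr := rfl

@[simp] theorem State.put_reg (s : State) (a i v : ℕ) : (s.put a i v).reg = s.reg := rfl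

@[simp] theorem State.put_arr (s : State) (a i v b : ℕ) :
    (s.put a i v).arr b = if b = a then Function.update (s.arr a) i v else s.arr b := by
  by_cases h : b = a
  · subst h; simp [State.put]
  · simp [State.put, h]

instance : Add Expr := ⟨.op .add⟩
instance : Sub Expr := ⟨.op .sub⟩
instance : Mul Expr := ⟨.op .mul⟩
instance : Div Expr := ⟨.op .div⟩
instance : Mod Expr := ⟨.op .mod⟩
instance (k : ℕ) : OfNat Expr k := ⟨.const k⟩

/-- The comparison `e₁ < e₂`, as an expression. -/
abbrev Expr.lt (e₁ e₂ : Expr) : Expr := .op .lt e₁ e₂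

/-- The test `e₁ = e₂`, as an expression. -/
abbrev Expr.eq (e₁ e₂ : Expr) : Expr := .op .eq e₁ e₂

section ExprLemmas

variable (s : State) (W : ℕ) (a b : Expr) (k x : ℕ)

@[simp] theorem Expr.eval_add : (a + b).eval s = a.eval s + b.eval s := rfl
@[simp] theorem Expr.eval_sub : (a - b).eval s = a.eval s - b.eval s := rfl
@[simp] theorem Expr.eval_mul : (a * b).eval s = a.eval s * b.eval s := rfl
@[simp] theorem Expr.eval_div : (a / b).eval s = a.eval s / b.eval s := rfl
@[simp] theorem Expr.eval_mod : (a % b).eval s = a.eval s % b.eval s := rfl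
@[simp] theorem Expr.eval_lt :
    (Expr.op .lt a b).eval s = if a.eval s < b.eval s then 1 else 0 := rfl
@[simp] theorem Expr.eval_eq :
    (Expr.op .eq a b).eval s = if a.eval s = b.eval s then 1 else 0 := rfl
@[simp] theorem Expr.eval_ofNat : (ofNat(k) : Expr).eval s = k := rfl
@[simp] theorem Expr.eval_reg : (Expr.reg x).eval s = s.reg x := rfl
@[simp] theorem Expr.eval_cell : (Expr.cell x a).eval s = s.arr x (a.eval s) := rfl

@[simp] theorem Expr.fits_add : (a + b).Fits W s ↔
    a.Fits W s ∧ b.Fits W s ∧ a.eval s + b.eval s < W := Iff.rfl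
@[simp] theorem Expr.fits_sub : (a - b).Fits W s ↔
    a.Fits W s ∧ b.Fits W s ∧ a.eval s - b.eval s < W := Iff.rfl
@[simp] theorem Expr.fits_mul : (a * b).Fits W s ↔
    a.Fits W s ∧ b.Fits W s ∧ a.eval s * b.eval s < W := Iff.rfl
@[simp] theorem Expr.fits_div : (a / b).Fits W s ↔
    a.Fits W s ∧ b.Fits W s ∧ a.eval s / b.eval s < W := Iff.rfl
@[simp] theorem Expr.fits_mod : (a % b).Fits W s ↔
    a.Fits W s ∧ b.Fits W s ∧ a.eval s % b.eval s < W := Iff.rfl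
@[simp] theorem Expr.fits_lt : (Expr.op .lt a b).Fits W s ↔
    a.Fits W s ∧ b.Fits W s ∧ (if a.eval s < b.eval s then 1 else 0) < W := Iff.rfl
@[simp] theorem Expr.fits_eq : (Expr.op .eq a b).Fits W s ↔
    a.Fits W s ∧ b.Fits W s ∧ (if a.eval s = b.eval s then 1 else 0) < W := Iff.rfl
@[simp] theorem Expr.fits_ofNat : (ofNat(k) : Expr).Fits W s ↔ k < W := Iff.rfl
@[simp] theorem Expr.fits_reg : (Expr.reg x).Fits W s ↔ s.reg x < W := Iff.rfl
@[simp] theorem Expr.fits_cell : (Expr.cell x a).Fits W s ↔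
    a.Fits W s ∧ s.arr x (a.eval s) < W := Iff.rfl

end ExprLemmas

/-- A comparison result is a word as soon as `1` is. -/
theorem ite_one_zero_lt {W : ℕ} (hW : 1 < W) (c : Prop) [Decidable c] :
    (if c then 1 else 0) < W := by split <;> omega

/-- With word limit `W`, the program `p`, started in `s`, halts within `k` steps in a state that
satisfies `Q`. -/
def Exec (W : ℕ) (p : Program) (s : State) (k : ℕ) (Q : State → Prop) : Prop :=
  ∃ s' k', Run W p s s' k' ∧ k' ≤ k ∧ Q s'

/-- Whether the program contains an assignment to register `x`. -/
def Program.writesReg : Program → ℕ → Bool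
  | .skip, _ => false
  | .assign y _, x => y == x
  | .store _ _ _, _ => false
  | .seq p q, x => p.writesReg x || q.writesReg x
  | .branch _ p q, x => p.writesReg x || q.writesReg x
  | .loop _ p, x => p.writesReg x

/-- Whether the program contains a store to array `a`. -/
def Program.writesArr : Program → ℕ → Bool
  | .skip, _ => false
  | .assign _ _, _ => false
  | .store b _ _, a => b == a
  | .seq p q, a => p.writesArr a || q.writesArr a
  | .branch _ p q, a => p.writesArr a || q.writesArr a
  | .loop _ p, a => p.writesArr a

/-- `s'` agrees with `s` on all registers and arrays that the program `p` does not write to. -/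
structure Keeps (p : Program) (s s' : State) : Prop where
  reg' : ∀ x, p.writesReg x = false → s'.reg x = s.reg x
  arr' : ∀ a, p.writesArr a = false → s'.arr a = s.arr a

theorem Keeps.reg {p : Program} {s s' : State} (h : Keeps p s s') (x : ℕ)
    (hx : p.writesReg x = false := by rfl) : s'.reg x = s.reg x := h.reg' x hx

theorem Keeps.arr {p : Program} {s s' : State} (h : Keeps p s s') (a : ℕ)
    (ha : p.writesArr a = false := by rfl) : s'.arr a = s.arr a := h.arr' a ha

theorem Keeps.refl (p : Program) (s : State) : Keeps p s s := ⟨fun _ _ => rfl, fun _ _ => rfl⟩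

theorem Keeps.trans {p : Program} {s s' s'' : State} (h : Keeps p s s') (h' : Keeps p s' s'') :
    Keeps p s s'' :=
  ⟨fun x hx => (h'.reg' x hx).trans (h.reg' x hx), fun a ha => (h'.arr' a ha).trans (h.arr' a ha)⟩

theorem Run.keeps {W : ℕ} {p : Program} {s s' : State} {k : ℕ} (h : Run W p s s' k) :
    Keeps p s s' := by
  induction h with
  | skip s => exact Keeps.refl _ _
  | assign s x e he =>
    refine ⟨fun y hy => ?_, fun _ _ => rfl⟩
    have : y ≠ x := by rintro rfl; simp [Program.writesReg] at hy
    simp [this]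
  | store s a e₁ e₂ h₁ h₂ =>
    refine ⟨fun _ _ => rfl, fun b hb => ?_⟩
    have : b ≠ a := by rintro rfl; simp [Program.writesArr] at hb
    simp [this]
  | seq p q s s' s'' k k' hp hq ihp ihq =>
    refine ⟨fun x hx => ?_, fun a ha => ?_⟩
    · simp only [Program.writesReg, Bool.or_eq_false_iff] at hx
      rw [ihq.reg' x hx.2, ihp.reg' x hx.1]
    · simp only [Program.writesArr, Bool.or_eq_false_iff] at ha
      rw [ihq.arr' a ha.2, ihp.arr' a ha.1]
  | branch_true e p q s s' k he hne hp ih =>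
    refine ⟨fun x hx => ?_, fun a ha => ?_⟩
    · simp only [Program.writesReg, Bool.or_eq_false_iff] at hx
      exact ih.reg' x hx.1
    · simp only [Program.writesArr, Bool.or_eq_false_iff] at ha
      exact ih.arr' a ha.1
  | branch_false e p q s s' k he h0 hp ih =>
    refine ⟨fun x hx => ?_, fun a ha => ?_⟩
    · simp only [Program.writesReg, Bool.or_eq_false_iff] at hx
      exact ih.reg' x hx.2
    · simp only [Program.writesArr, Bool.or_eq_false_iff] at ha
      exact ih.arr' a ha.2
  | loop_done e p s he h0 => exact Keeps.refl _ _
  | loop_again e p s s' s'' k k' he hne hp hl ihp ihl =>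
    exact Keeps.trans ⟨ihp.reg', ihp.arr'⟩ ihl

section ExecRules

variable {W : ℕ} {p q : Program} {s : State} {k : ℕ} {Q Q' : State → Prop}

theorem Exec.mono {k' : ℕ} (h : Exec W p s k Q) (hk : k ≤ k') (hQ : ∀ s', Q s' → Q' s') :
    Exec W p s k' Q' := by
  obtain ⟨s', k₁, hr, hk₁, hq⟩ := h
  exact ⟨s', k₁, hr, hk₁.trans hk, hQ _ hq⟩

theorem Exec.le {k' : ℕ} (h : Exec W p s k Q) (hk : k ≤ k') : Exec W p s k' Q :=
  h.mono hk fun _ => id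

/-- The frame rule: what a program does not write to, it does not change. -/
theorem Exec.frame (h : Exec W p s k Q) : Exec W p s k fun s' => Keeps p s s' ∧ Q s' := by
  obtain ⟨s', k₁, hr, hk₁, hq⟩ := h
  exact ⟨s', k₁, hr, hk₁, hr.keeps, hq⟩

theorem Exec.seq {k' : ℕ} (h : Exec W p s k fun s' => Exec W q s' k' Q) :
    Exec W (.seq p q) s (k + k') Q := by
  obtain ⟨s', k₁, hr, hk₁, s'', k₂, hr', hk₂, hq⟩ := h
  exact ⟨s'', _, .seq _ _ _ _ _ _ _ hr hr', by omega, hq⟩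

/-- The verification condition of a program without loops. -/
def Program.vc (W : ℕ) : Program → (State → Prop) → State → Prop
  | .skip, Q, s => Q s
  | .assign x e, Q, s => e.Fits W s ∧ Q (s.set x (e.eval s))
  | .store a e₁ e₂, Q, s => e₁.Fits W s ∧ e₂.Fits W s ∧ Q (s.put a (e₁.eval s) (e₂.eval s))
  | .seq p q, Q, s => p.vc W (q.vc W Q) s
  | .branch e p q, Q, s =>
      e.Fits W s ∧ (e.eval s ≠ 0 → p.vc W Q s) ∧ (e.eval s = 0 → q.vc W Q s)
  | .loop _ _, _, _ => False

/-- An upper bound for the running time of a program without loops. -/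
def Program.bound : Program → ℕ
  | .skip => 1
  | .assign _ e => e.cost + 1
  | .store _ e₁ e₂ => e₁.cost + e₂.cost + 1
  | .seq p q => p.bound + q.bound
  | .branch e p q => e.cost + 1 + (p.bound + q.bound)
  | .loop _ _ => 0

theorem Exec.of_vc (h : p.vc W Q s) : Exec W p s p.bound Q := by
  induction p generalizing s Q with
  | skip => exact ⟨s, _, .skip s, le_rfl, h⟩
  | assign x e => exact ⟨_, _, .assign s x e h.1, le_rfl, h.2⟩
  | store a e₁ e₂ => exact ⟨_, _, .store s a e₁ e₂ h.1 h.2.1, le_rfl, h.2.2⟩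
  | seq p q ihp ihq => exact Exec.seq ((ihp h).mono le_rfl fun _ h' => ihq h')
  | branch e p q ihp ihq =>
    obtain ⟨he, ht, hf⟩ := h
    by_cases h0 : e.eval s = 0
    · obtain ⟨s', k, hr, hk, hq⟩ := ihq (hf h0)
      exact ⟨s', _, .branch_false _ _ _ _ _ _ he h0 hr, by simp only [Program.bound]; omega, hq⟩
    · obtain ⟨s', k, hr, hk, hq⟩ := ihp (ht h0)
      exact ⟨s', _, .branch_true _ _ _ _ _ _ he h0 hr, by simp only [Program.bound]; omega, hq⟩
  | loop e p ih => exact h.elim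

theorem Exec.branch {e : Expr} (he : e.Fits W s) (ht : e.eval s ≠ 0 → Exec W p s k Q)
    (hf : e.eval s = 0 → Exec W q s k Q) : Exec W (.branch e p q) s (e.cost + 1 + k) Q := by
  by_cases h0 : e.eval s = 0
  · obtain ⟨s', k, hr, hk, hq⟩ := hf h0
    exact ⟨s', _, .branch_false _ _ _ _ _ _ he h0 hr, by omega, hq⟩
  · obtain ⟨s', k, hr, hk, hq⟩ := ht h0
    exact ⟨s', _, .branch_true _ _ _ _ _ _ he h0 hr, by omega, hq⟩

/-- The loop `for x := e, e + 1, …, (register h) - 1 do body`. -/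
def Program.forUp (x : ℕ) (e : Expr) (h : ℕ) (body : Program) : Program :=
  .seq (.assign x e) (.loop (.lt (.reg x) (.reg h)) (.seq body (.assign x (.reg x + 1))))

/-- The rule for `for`-loops. The invariant `I j σ` holds before iteration `j`, where `σ` bounds
the number of steps taken so far; so the cost of an iteration may depend on the state. -/
theorem Exec.forUp_amortized {x h : ℕ} {e : Expr} (I : ℕ → ℕ → State → Prop) (lo m : ℕ)
    (hfit : e.Fits W s) (hlo : e.eval s = lo) (hh : s.reg h = lo + m) (hxh : x ≠ h)
    (hbx : p.writesReg x = false) (hbh : p.writesReg h = false) (hW : lo + m < W) (hW1 : 1 < W)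
    (h0 : I 0 0 (s.set x lo))
    (hb : ∀ j σ s', j < m → s'.reg x = lo + j → Keeps (Program.forUp x e h p) s s' → I j σ s' →
      ∃ k', Exec W p s' k' fun s'' => I (j + 1) (σ + k' + 8) (s''.set x (lo + j + 1)))
    (hQ : ∀ σ s', s'.reg x = lo + m → Keeps (Program.forUp x e h p) s s' → I m σ s' →
      e.cost + 5 + σ ≤ k ∧ Q s') :
    Exec W (Program.forUp x e h p) s k Q := by
  set body : Program := .seq p (.assign x (.reg x + 1)) with hbody
  set lp : Program := .loop (.lt (.reg x) (.reg h)) body with hlp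
  have hk0 : Keeps (Program.forUp x e h p) s (s.set x lo) := by
    refine ⟨fun y hy => ?_, fun _ _ => rfl⟩
    have : y ≠ x := by rintro rfl; simp [Program.forUp, Program.writesReg] at hy
    simp [this]
  have key : ∀ d j σ s', j + d = m → s'.reg x = lo + j →
      Keeps (Program.forUp x e h p) s s' → I j σ s' →
      ∃ s'' k', Run W lp s' s'' k' ∧ e.cost + 1 + σ + k' ≤ k ∧ Q s'' := by
    intro d
    induction d with
    | zero =>
      intro j σ s' hj hx hkp hI
      obtain rfl : j = m := by omega
      obtain ⟨hc, hq⟩ := hQ σ s' hx hkp hI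
      have hh' : s'.reg h = lo + j := by
        rw [hkp.reg' h (by simp [Program.forUp, Program.writesReg, hbh, hxh]), hh]
      refine ⟨s', _, .loop_done _ _ _ ?_ ?_, ?_, hq⟩
      · simp [hx, hh', hW]; omega
      · simp [hx, hh']
      · simp only [Expr.cost]; omega
    | succ d ih =>
      intro j σ s' hj hx hkp hI
      have hjm : j < m := by omega
      have hh' : s'.reg h = lo + m := by
        rw [hkp.reg' h (by simp [Program.forUp, Program.writesReg, hbh, hxh]), hh]
      obtain ⟨k', s₁, k₁, hr, hk₁, hI₁⟩ := hb j σ s' hjm hx hkp hI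
      have hs₁x : s₁.reg x = lo + j := by rw [hr.keeps.reg' x hbx, hx]
      have hr₂ : Run W (.assign x (.reg x + 1)) s₁ (s₁.set x (lo + j + 1)) 4 := by
        have hfits : (Expr.reg x + 1).Fits W s₁ := by
          simp only [Expr.fits_add, Expr.fits_reg, Expr.fits_ofNat, Expr.eval_reg,
            Expr.eval_ofNat, hs₁x]
          omega
        have := Run.assign (W := W) s₁ x (.reg x + 1) hfits
        rw [Expr.eval_add, Expr.eval_reg, Expr.eval_ofNat, hs₁x] at this
        exact this
      have hkp' : Keeps (Program.forUp x e h p) s (s₁.set x (lo + j + 1)) := by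
        refine hkp.trans ⟨fun y hy => ?_, fun a ha => ?_⟩
        · simp only [Program.forUp, Program.writesReg, Bool.or_eq_false_iff] at hy
          rw [← (hr.keeps.reg' y hy.2.1)]
          have : y ≠ x := by rintro rfl; simp at hy
          simp [this]
        · simp only [Program.forUp, Program.writesArr, Bool.or_eq_false_iff] at ha
          rw [← (hr.keeps.arr' a ha.2.1)]; rfl
      obtain ⟨s'', k₃, hr₃, hk₃, hq⟩ := ih (j + 1) (σ + k' + 8) _ (by omega)
        (by simp; omega) hkp' hI₁
      refine ⟨s'', _, .loop_again _ _ _ _ _ _ _ ?_ ?_ (.seq _ _ _ _ _ _ _ hr hr₂) hr₃, ?_, hq⟩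
      · simp [hx, hh', hjm]; omega
      · simp [hx, hh', hjm]
      · simp only [Expr.cost]; omega
  obtain ⟨s'', k', hr, hk', hq⟩ := key m 0 0 (s.set x lo) (by omega) (by simp) hk0 h0
  have h1 : Run W (.assign x e) s (s.set x lo) (e.cost + 1) := by
    have := Run.assign (W := W) s x e hfit
    rwa [hlo] at this
  exact ⟨s'', _, .seq _ _ _ _ _ _ _ h1 hr, by omega, hq⟩

/-- The rule for `for`-loops in which iteration `j` takes at most `f j` steps. -/
theorem Exec.forUp_sum {x h : ℕ} {e : Expr} (I : ℕ → State → Prop) (lo m : ℕ) (f : ℕ → ℕ)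
    (hfit : e.Fits W s) (hlo : e.eval s = lo) (hh : s.reg h = lo + m) (hxh : x ≠ h)
    (hbx : p.writesReg x = false) (hbh : p.writesReg h = false) (hW : lo + m < W) (hW1 : 1 < W)
    (h0 : I 0 (s.set x lo))
    (hb : ∀ j s', j < m → s'.reg x = lo + j → Keeps (Program.forUp x e h p) s s' → I j s' →
      Exec W p s' (f j) fun s'' => I (j + 1) (s''.set x (lo + j + 1)))
    (hQ : ∀ s', s'.reg x = lo + m → Keeps (Program.forUp x e h p) s s' → I m s' → Q s') :
    Exec W (Program.forUp x e h p) s (e.cost + 5 + ∑ j ∈ Finset.range m, (f j + 8)) Q := by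
  refine Exec.forUp_amortized (fun j σ s' => I j s' ∧ σ = ∑ i ∈ Finset.range j, (f i + 8)) lo m
    hfit hlo hh hxh hbx hbh hW hW1 ⟨h0, by simp⟩ ?_ ?_
  · rintro j σ s' hj hx hk ⟨hI, rfl⟩
    refine ⟨f j, (hb j s' hj hx hk hI).mono le_rfl fun s'' h'' => ⟨h'', ?_⟩⟩
    rw [Finset.sum_range_succ, add_assoc]
  · rintro σ s' hx hk ⟨hI, rfl⟩
    exact ⟨le_rfl, hQ s' hx hk hI⟩

/-- The rule for `for`-loops in which every iteration takes at most `f` steps. -/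
theorem Exec.forUp {x h : ℕ} {e : Expr} (I : ℕ → State → Prop) (lo m f : ℕ)
    (hfit : e.Fits W s) (hlo : e.eval s = lo) (hh : s.reg h = lo + m) (hxh : x ≠ h)
    (hbx : p.writesReg x = false) (hbh : p.writesReg h = false) (hW : lo + m < W) (hW1 : 1 < W)
    (h0 : I 0 (s.set x lo))
    (hb : ∀ j s', j < m → s'.reg x = lo + j → Keeps (Program.forUp x e h p) s s' → I j s' →
      Exec W p s' f fun s'' => I (j + 1) (s''.set x (lo + j + 1)))
    (hQ : ∀ s', s'.reg x = lo + m → Keeps (Program.forUp x e h p) s s' → I m s' → Q s') :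
    Exec W (Program.forUp x e h p) s (e.cost + 5 + m * (f + 8)) Q := by
  simpa using Exec.forUp_sum I lo m (fun _ => f) hfit hlo hh hxh hbx hbh hW hW1 h0 hb hQ

end ExecRules

/-! ### Eliminating vertices one at a time -/

/-- The minimum of `f 0` and of `f q` for all `q < k`. -/
def runMin (f : ℕ → ℕ) : ℕ → ℕ
  | 0 => f 0
  | k + 1 => min (runMin f k) (f k)

theorem runMin_le {f : ℕ → ℕ} {k q : ℕ} (hq : q < k) : runMin f k ≤ f q := by
  induction k with
  | zero => omega
  | succ k ih =>
    rcases Nat.lt_succ_iff_lt_or_eq.1 hq with h | rfl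
    · exact (min_le_left _ _).trans (ih h)
    · exact min_le_right _ _

theorem runMin_le_zero (f : ℕ → ℕ) (k : ℕ) : runMin f k ≤ f 0 := by
  induction k with
  | zero => exact le_rfl
  | succ k ih => exact (min_le_left _ _).trans ih

theorem exists_runMin (f : ℕ → ℕ) {k : ℕ} (hk : 0 < k) : ∃ q < k, runMin f k = f q := by
  induction k with
  | zero => omega
  | succ k ih =>
    rcases Nat.eq_zero_or_pos k with rfl | hk'
    · exact ⟨0, by omega, by simp [runMin]⟩
    · obtain ⟨q, hq, he⟩ := ih hk'
      rcases min_choice (runMin f k) (f k) with h | h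
      · exact ⟨q, by omega, by rw [runMin, h, he]⟩
      · exact ⟨k, by omega, by rw [runMin, h]⟩

/-- A family of cost functions: `H j c a` is the cost that vertex `j` contributes to the
colouring `c` if it is given the budget `a`. -/
abbrev Costs : Type := ℕ → (ℕ → ℕ) → ℕ → ℕ

/-- `H j` depends only on the colours of the vertices in the list `B j`. -/
def Local (B : ℕ → List ℕ) (H : Costs) : Prop :=
  ∀ j c c', (∀ u ∈ B j, c u = c' u) → H j c = H j c'

/-- Eliminating vertex `i`: its cost function, minimised over its own colour, is added to the
cost function of vertex `p`, where the budget of `p` is split between the two in the best way. The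
argument `q` of the minimum encodes the part `q / 3` of the budget that stays with `p`, and the
colour `q % 3` of `i`. -/
def elimStep (H : Costs) (i p : ℕ) : Costs :=
  Function.update H p fun c a =>
    runMin (fun q => H p c (q / 3) + H i (Function.update c i (q % 3)) (a - q / 3)) (3 * (a + 1))

/-- Some colouring of the vertices below `i` with the colours `0, 1, 2`, and some distribution of
the budget `b` among these vertices, has total cost at most `v`. -/
def Attainable (H : Costs) (i b v : ℕ) : Prop :=
  ∃ c a : ℕ → ℕ, (∀ j, c j < 3) ∧ ∑ j ∈ Finset.range i, a j = b ∧
    ∑ j ∈ Finset.range i, H j c (a j) ≤ v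

theorem sum_range_update {i p : ℕ} (hp : p < i) (f : ℕ → ℕ) (x : ℕ) :
    ∑ j ∈ Finset.range i, Function.update f p x j + f p = ∑ j ∈ Finset.range i, f j + x := by
  have hpm : p ∈ Finset.range i := Finset.mem_range.2 hp
  rw [Finset.sum_update_of_mem hpm, ← Finset.add_sum_erase _ f hpm, Finset.sdiff_singleton_eq_erase]
  ring

theorem attainable_elimStep {B : ℕ → List ℕ} {H : Costs} {i p b v : ℕ} (hH : Local B H)
    (hp : p < i) (hB : ∀ j < i, i ∉ B j) :
    Attainable (elimStep H i p) i b v ↔ Attainable H (i + 1) b v := by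
  have hpm : p ∈ Finset.range i := Finset.mem_range.2 hp
  constructor
  · rintro ⟨c, a, hc, hb, hv⟩
    obtain ⟨q, hq, he⟩ := exists_runMin (fun q => H p c (q / 3) +
      H i (Function.update c i (q % 3)) (a p - q / 3)) (k := 3 * (a p + 1)) (by omega)
    have hqa : q / 3 ≤ a p := by omega
    set c' := Function.update c i (q % 3) with hc'
    have hcc : ∀ j < i, H j c' = H j c := fun j hj => hH j _ _ fun u hu => by
      rw [hc', Function.update_of_ne]
      rintro rfl; exact hB j hj hu
    refine ⟨c', fun j => if j = i then a p - q / 3 else if j = p then q / 3 else a j, ?_, ?_, ?_⟩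
    · intro j
      rw [hc', Function.update_apply]
      split
      · omega
      · exact hc j
    · rw [Finset.sum_range_succ, if_pos rfl]
      have h1 : ∑ j ∈ Finset.range i,
          (if j = i then a p - q / 3 else if j = p then q / 3 else a j) =
          ∑ j ∈ Finset.range i, Function.update a p (q / 3) j := by
        refine Finset.sum_congr rfl fun j hj => ?_
        rw [if_neg (Finset.mem_range.1 hj).ne, Function.update_apply]
      have h2 := sum_range_update hp a (q / 3)
      rw [h1]; omega
    · rw [Finset.sum_range_succ]
      rw [← Finset.add_sum_erase _ _ hpm] at hv ⊢
      beta_reduce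
      rw [if_pos rfl, if_neg hp.ne, if_pos rfl, hcc p hp]
      have h0 : elimStep H i p p c (a p) = H p c (q / 3) + H i c' (a p - q / 3) := by
        rw [elimStep, Function.update_self, he]
      have h1 : ∑ j ∈ (Finset.range i).erase p, H j c'
          (if j = i then a p - q / 3 else if j = p then q / 3 else a j) =
          ∑ j ∈ (Finset.range i).erase p, elimStep H i p j c (a j) := by
        refine Finset.sum_congr rfl fun j hj => ?_
        rw [Finset.mem_erase, Finset.mem_range] at hj
        rw [if_neg hj.2.ne, if_neg hj.1, hcc j hj.2, elimStep, Function.update_of_ne hj.1]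
      rw [h1]; omega
  · rintro ⟨c, a, hc, hb, hv⟩
    refine ⟨c, Function.update a p (a p + a i), hc, ?_, ?_⟩
    · have h2 := sum_range_update hp a (a p + a i)
      rw [Finset.sum_range_succ] at hb
      omega
    · rw [Finset.sum_range_succ] at hv
      rw [← Finset.add_sum_erase _ _ hpm] at hv ⊢
      rw [Function.update_self]
      have h1 : ∑ j ∈ (Finset.range i).erase p,
          elimStep H i p j c (Function.update a p (a p + a i) j) =
          ∑ j ∈ (Finset.range i).erase p, H j c (a j) := by
        refine Finset.sum_congr rfl fun j hj => ?_
        rw [Finset.mem_erase, Finset.mem_range] at hj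
        rw [elimStep, Function.update_of_ne hj.1, Function.update_of_ne hj.1]
      have h2 : elimStep H i p p c (a p + a i) ≤ H p c (a p) + H i c (a i) := by
        rw [elimStep, Function.update_self]
        have hci := hc i
        refine (runMin_le (q := 3 * a p + c i) (by omega)).trans (le_of_eq ?_)
        have e1 : (3 * a p + c i) / 3 = a p := by omega
        have e2 : (3 * a p + c i) % 3 = c i := by omega
        rw [e1, e2, Function.update_eq_self, Nat.add_sub_cancel_left]
      rw [h1]; omega

theorem Local.elimStep {B : ℕ → List ℕ} {H : Costs} {i p : ℕ} (hH : Local B H)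
    (hB : ∀ u ∈ B i, u ≠ i → u ∈ B p) : Local B (elimStep H i p) := by
  intro j c c' hcc
  rw [ControllerGame.elimStep]
  by_cases hj : j = p
  · subst hj
    simp only [Function.update_self]
    have h1 := hH j c c' hcc
    have h2 : ∀ z, H i (Function.update c i z) = H i (Function.update c' i z) := fun z =>
      hH i _ _ fun u hu => by
        by_cases hui : u = i
        · simp [hui]
        · simp [hui, hcc u (hB u hu hui)]
    simp only [h1, h2]
  · simp only [Function.update_of_ne hj]
    exact hH j c c' hcc

/-- The costs of the vertices below `i` add up to at most `K`, whatever the colouring and the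
budgets. -/
def BoundedBy (H : Costs) (i K : ℕ) : Prop :=
  ∃ β : ℕ → ℕ, (∀ j c a, H j c a ≤ β j) ∧ ∑ j ∈ Finset.range i, β j ≤ K

theorem BoundedBy.elimStep {H : Costs} {i p K : ℕ} (hp : p < i) (h : BoundedBy H (i + 1) K) :
    BoundedBy (elimStep H i p) i K := by
  obtain ⟨β, hβ, hK⟩ := h
  refine ⟨Function.update β p (β p + β i), fun j c a => ?_, ?_⟩
  · rw [ControllerGame.elimStep]
    by_cases hj : j = p
    · subst hj
      simp only [Function.update_self]
      exact (runMin_le_zero _ _).trans (Nat.add_le_add (hβ _ _ _) (hβ _ _ _))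
    · simp only [Function.update_of_ne hj]
      exact hβ j c a
  · rw [Finset.sum_range_succ] at hK
    have := sum_range_update hp β (β p + β i)
    omega

theorem BoundedBy.add_le {H : Costs} {i K p : ℕ} (hp : p < i) (h : BoundedBy H (i + 1) K)
    (c c' : ℕ → ℕ) (a a' : ℕ) : H p c a + H i c' a' ≤ K := by
  obtain ⟨β, hβ, hK⟩ := h
  have h1 := hβ p c a
  have h2 := hβ i c' a'
  have h3 := Finset.single_le_sum (f := β) (fun _ _ => Nat.zero_le _) (Finset.mem_range.2 hp)
  rw [Finset.sum_range_succ] at hK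
  omega

theorem BoundedBy.le {H : Costs} {i K p : ℕ} (hp : p < i) (h : BoundedBy H i K)
    (c : ℕ → ℕ) (a : ℕ) : H p c a ≤ K := by
  obtain ⟨β, hβ, hK⟩ := h
  exact ((hβ p c a).trans (Finset.single_le_sum (f := β) (fun _ _ => Nat.zero_le _)
    (Finset.mem_range.2 hp))).trans hK

/-- The cost functions that remain after the vertices above `i` are eliminated, in decreasing
order; `p j` is the vertex that receives the costs of `j`, and `n` is the largest vertex. -/
def eliminated (H : Costs) (p : ℕ → ℕ) (n : ℕ) : ℕ → Costs
  | 0 => H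
  | d + 1 => elimStep (eliminated H p n d) (n - d) (p (n - d))

section Eliminated

variable {B : ℕ → List ℕ} {H : Costs} {p : ℕ → ℕ} {n : ℕ}

theorem Local.eliminated (hH : Local B H)
    (hB : ∀ i, 1 ≤ i → i ≤ n → ∀ u ∈ B i, u ≠ i → u ∈ B (p i)) {d : ℕ} (hd : d ≤ n) :
    Local B (eliminated H p n d) := by
  induction d with
  | zero => exact hH
  | succ d ih => exact (ih (by omega)).elimStep (hB _ (by omega) (by omega))

theorem BoundedBy.eliminated {K : ℕ} (hH : BoundedBy H (n + 1) K)
    (hp : ∀ i, 1 ≤ i → i ≤ n → p i < i) {d : ℕ} (hd : d ≤ n) :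
    BoundedBy (eliminated H p n d) (n + 1 - d) K := by
  induction d with
  | zero => exact hH
  | succ d ih =>
    have h := ih (by omega)
    rw [show n + 1 - d = (n - d) + 1 by omega] at h
    rw [show n + 1 - (d + 1) = n - d by omega]
    exact h.elimStep (hp _ (by omega) (by omega))

theorem attainable_eliminated (hH : Local B H)
    (hB : ∀ i, 1 ≤ i → i ≤ n → ∀ u ∈ B i, u ≠ i → u ∈ B (p i))
    (hp : ∀ i, 1 ≤ i → i ≤ n → p i < i) (hle : ∀ i, ∀ u ∈ B i, u ≤ i) {b v d : ℕ} (hd : d ≤ n) :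
    Attainable (ControllerGame.eliminated H p n d) (n + 1 - d) b v ↔ Attainable H (n + 1) b v := by
  induction d with
  | zero => exact Iff.rfl
  | succ d ih =>
    rw [← ih (by omega), show n + 1 - d = (n - d) + 1 by omega,
      show n + 1 - (d + 1) = n - d by omega]
    exact attainable_elimStep (hH.eliminated hB (by omega)) (hp _ (by omega) (by omega))
      fun j hj hmem => by have := hle j _ hmem; omega

/-- If the vertex `0` has an empty list, then eliminating all other vertices leaves a single number
for each budget: the smallest attainable cost. -/
theorem eliminated_le_iff (hH : Local B H)
    (hB : ∀ i, 1 ≤ i → i ≤ n → ∀ u ∈ B i, u ≠ i → u ∈ B (p i))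
    (hp : ∀ i, 1 ≤ i → i ≤ n → p i < i) (hle : ∀ i, ∀ u ∈ B i, u ≤ i) (hB0 : B 0 = [])
    (c : ℕ → ℕ) (b v : ℕ) :
    ControllerGame.eliminated H p n n 0 c b ≤ v ↔ Attainable H (n + 1) b v := by
  rw [← attainable_eliminated hH hB hp hle le_rfl, Nat.add_sub_cancel_left]
  constructor
  · intro h
    refine ⟨fun _ => 0, fun _ => b, by simp, by simp, ?_⟩
    rw [Finset.sum_range_one, hH.eliminated hB le_rfl 0 _ c (by simp [hB0])]
    exact h
  · rintro ⟨c', a, -, ha, hv⟩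
    rw [Finset.sum_range_one] at ha hv
    rw [hH.eliminated hB le_rfl 0 c c' (by simp [hB0]), ← ha]
    exact hv

end Eliminated

/-! ### The game as a minimum cost colouring problem -/

section Survival

variable {V : Type*} {G : SimpleGraph V} {D A : Finset V} {v w : V}

theorem Survives.notMem (h : Survives G D A v) : v ∉ A := h.1

theorem survives_of_mem (hD : v ∈ D) (hA : v ∉ A) : Survives G D A v :=
  ⟨hA, v, hA, hD, .refl _⟩

theorem Survives.of_adj (h : Survives G D A v) (hvw : G.Adj v w) (hw : w ∉ A) :
    Survives G D A w := by
  obtain ⟨hv, d, hd, hdD, hr⟩ := h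
  refine ⟨hw, d, hd, hdD, SimpleGraph.Reachable.trans ?_ hr⟩
  exact SimpleGraph.Adj.reachable (by simpa using hvw.symm)

/-- A property that is inherited by unattacked neighbours and that no vertex of `D` has fails for
all surviving vertices. -/
theorem Survives.not_of_closed {P : V → Prop} (hP : ∀ v w, P v → G.Adj v w → w ∉ A → P w)
    (hD : ∀ d ∈ D, ¬ P d) (h : Survives G D A v) : ¬ P v := by
  obtain ⟨hv, d, hd, hdD, ⟨p⟩⟩ := h
  intro hPv
  have key : ∀ x y : {x | x ∉ A}, (G.induce {x | x ∉ A}).Walk x y → P x → P y := by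
    intro x y p
    induction p with
    | nil => exact id
    | @cons _ y _ hadj _ ih => exact fun hx => ih (hP _ _ hx (by simpa using hadj) y.2)
  exact hD d hdD (key _ _ p hPv)

end Survival

/-- A numbering `1, …, n` of the vertices `0, …, n - 1`, with inverse `vert`, that is a reversed
elimination order: the list `B i` contains `i` and some smaller numbers, among them those of all
adjacent vertices with smaller numbers, and the numbers in `B i` that are smaller than `p ∈ B i`
belong to `B p`. -/
structure Numbering (n M : ℕ) (adj : ℕ → List ℕ) (num vert : ℕ → ℕ) (B : ℕ → List ℕ) : Prop where
  num_mem : ∀ v < n, 1 ≤ num v ∧ num v ≤ n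
  vert_num : ∀ v < n, vert (num v) = v
  vert_lt : ∀ i, 1 ≤ i → i ≤ n → vert i < n
  num_vert : ∀ i, 1 ≤ i → i ≤ n → num (vert i) = i
  mem_self : ∀ i, 1 ≤ i → i ≤ n → i ∈ B i
  nodup : ∀ i, (B i).Nodup
  length_le : ∀ i, (B i).length ≤ M
  mem_range : ∀ i, ∀ u ∈ B i, 1 ≤ u ∧ u ≤ i
  adj_mem : ∀ v < n, ∀ w ∈ adj v, num w < num v → num w ∈ B (num v)
  mem_of_mem : ∀ i, ∀ u ∈ B i, ∀ p ∈ B i, u < p → p < i → u ∈ B p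

theorem Numbering.eq_nil_zero {n M : ℕ} {adj : ℕ → List ℕ} {num vert : ℕ → ℕ} {B : ℕ → List ℕ}
    (h : Numbering n M adj num vert B) : B 0 = [] :=
  List.eq_nil_iff_forall_not_mem.2 fun u hu => by have := h.mem_range 0 u hu; omega

/-- The penalty `n + 1` if the neighbour `w` of the vertex number `i` has a smaller number, and one
of the two vertices has colour `1` and the other has colour `2`. -/
def edgePenalty (n : ℕ) (num c : ℕ → ℕ) (i w : ℕ) : ℕ :=
  if num w < i ∧ c (num w) * c i = 2 then n + 1 else 0

/-- The cost of the colour of vertex number `i`, for a colouring of the vertices as attacked (`0`),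
disabled but not attacked (`1`), and surviving (`2`): it is `1` for a surviving vertex, plus a
penalty `n + 1` for each violation: a vertex of the defense (where `dfl` is `1`) with
colour `1`, an edge between the colours `1` and `2`, and an attacked vertex without budget. -/
def initCosts (n : ℕ) (adj : ℕ → List ℕ) (num vert dfl : ℕ → ℕ) : Costs := fun i c a =>
  if i = 0 ∨ n < i then 0 else
    (if c i = 2 then 1 else 0) + (n + 1) * (dfl (vert i) * (if c i = 1 then 1 else 0)) +
      ((adj (vert i)).map (edgePenalty n num c i)).sum + (n + 1) * (if a + c i = 0 then 1 else 0)

section Game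

variable {n M : ℕ} {adj : ℕ → List ℕ} {num vert dfl : ℕ → ℕ} {B : ℕ → List ℕ}

theorem Numbering.local_initCosts (h : Numbering n M adj num vert B) :
    Local B (initCosts n adj num vert dfl) := by
  intro i c c' hcc
  funext a
  unfold initCosts
  split
  · rfl
  · rename_i hi
    push Not at hi
    have hi1 : 1 ≤ i := by omega
    have hci : c i = c' i := hcc i (h.mem_self i hi1 hi.2)
    have hmap : (adj (vert i)).map (edgePenalty n num c i) =
        (adj (vert i)).map (edgePenalty n num c' i) := by
      refine List.map_congr_left fun w hw => ?_
      unfold edgePenalty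
      by_cases hwi : num w < i
      · have := h.adj_mem _ (h.vert_lt i hi1 hi.2) w hw
        rw [h.num_vert i hi1 hi.2] at this
        rw [hci, hcc _ (this hwi)]
      · simp [hwi]
    rw [hmap, hci]

theorem initCosts_le (hdfl : ∀ v < n, dfl v ≤ 1) (hvert : ∀ i, 1 ≤ i → i ≤ n → vert i < n)
    (hlen : ∀ v < n, (adj v).length ≤ n) (i : ℕ) (c : ℕ → ℕ) (a : ℕ) :
    initCosts n adj num vert dfl i c a ≤ (n + 1) * (n + 3) := by
  unfold initCosts
  split
  · exact Nat.zero_le _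
  · rename_i hi
    push Not at hi
    have hv := hvert i (by omega) hi.2
    have h1 : dfl (vert i) * (if c i = 1 then 1 else 0) ≤ 1 := by
      have := hdfl _ hv
      split <;> omega
    have h2 : ((adj (vert i)).map (edgePenalty n num c i)).sum ≤ n * (n + 1) := by
      refine (List.sum_le_card_nsmul _ (n + 1) ?_).trans ?_
      · intro x hx
        obtain ⟨w, -, rfl⟩ := List.mem_map.1 hx
        unfold edgePenalty
        split <;> omega
      · rw [List.length_map, smul_eq_mul]
        exact Nat.mul_le_mul_right _ (hlen _ hv)
    have h3 : (if c i = 2 then 1 else 0) ≤ 1 := by split <;> omega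
    have h4 : (if a + c i = 0 then 1 else 0) ≤ 1 := by split <;> omega
    nlinarith

theorem boundedBy_initCosts (hdfl : ∀ v < n, dfl v ≤ 1)
    (hvert : ∀ i, 1 ≤ i → i ≤ n → vert i < n) (hlen : ∀ v < n, (adj v).length ≤ n) :
    BoundedBy (initCosts n adj num vert dfl) (n + 1) ((n + 1) * ((n + 1) * (n + 3))) :=
  ⟨fun _ => (n + 1) * (n + 3), initCosts_le hdfl hvert hlen, by simp⟩

theorem Numbering.sum_range (h : Numbering n M adj num vert B) (f : ℕ → ℕ) :
    ∑ j ∈ Finset.range (n + 1), f j = f 0 + ∑ v : Fin n, f (num v) := by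
  rw [Finset.sum_range_succ', add_comm]
  congr 1
  symm
  refine Finset.sum_bij (fun v _ => num v - 1) ?_ ?_ ?_ ?_
  · intro v _
    have := h.num_mem v v.2
    simp only [Finset.mem_range]; omega
  · intro v _ w _ hvw
    have h1 := h.num_mem v v.2
    have h2 := h.num_mem w w.2
    have h3 : num v = num w := by beta_reduce at hvw; omega
    ext
    rw [← h.vert_num v v.2, h3, h.vert_num w w.2]
  · intro j hj
    rw [Finset.mem_range] at hj
    refine ⟨⟨vert (j + 1), h.vert_lt _ (by omega) (by omega)⟩, Finset.mem_univ _, ?_⟩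
    simp [h.num_vert (j + 1) (by omega) (by omega)]
  · intro v _
    have := h.num_mem v v.2
    rw [Nat.sub_add_cancel this.1]

variable {G : SimpleGraph (Fin n)} {D : Finset (Fin n)} {ℓ α : ℕ}

theorem Numbering.initCosts_num (h : Numbering n M adj num vert B) (v : Fin n) (c : ℕ → ℕ)
    (a : ℕ) : initCosts n adj num vert dfl (num v) c a =
      (if c (num v) = 2 then 1 else 0) +
      (n + 1) * (dfl v * (if c (num v) = 1 then 1 else 0)) +
      ((adj v).map (edgePenalty n num c (num v))).sum +
      (n + 1) * (if a + c (num v) = 0 then 1 else 0) := by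
  have := h.num_mem v v.2
  rw [initCosts, if_neg (by omega), h.vert_num v v.2]

open Classical in
theorem attackerPayoff_add (A : Finset (Fin n)) :
    (Finset.univ.filter fun v => Survives G D A v).card + attackerPayoff G D A = n := by
  rw [attackerPayoff, Finset.card_filter_add_card_filter_not]
  simp

open Classical in
/-- The colouring given by an attack has no violation, and its cost is the number of surviving
vertices. -/
theorem Numbering.attainable_of_attack (h : Numbering n M adj num vert B)
    (hadj : ∀ v : Fin n, Lists (adj v) (G.neighborSet v))
    (hdfl : ∀ v : Fin n, dfl v = if v ∈ D then 1 else 0) {A : Finset (Fin n)} (hA : A.card ≤ ℓ)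
    (hα : α ≤ attackerPayoff G D A) :
    Attainable (initCosts n adj num vert dfl) (n + 1) ℓ (n - α) := by
  set col : Fin n → ℕ := fun v => if v ∈ A then 0 else if Survives G D A v then 2 else 1
    with hcol
  set c : ℕ → ℕ := fun i => if hi : vert i < n then col ⟨vert i, hi⟩ else 0 with hc
  have hcn : ∀ v : Fin n, c (num v) = col v := fun v => by
    have : vert (num v) = v := h.vert_num v v.2
    simp [hc, this]
  have hcol3 : ∀ v, col v < 3 := fun v => by
    simp only [hcol]; split_ifs <;> omega
  have hnum0 : ∀ v : Fin n, num v ≠ 0 := fun v => by have := h.num_mem v v.2; omega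
  refine ⟨c, fun i => if i = 0 then ℓ - A.card else if c i = 0 then 1 else 0, ?_, ?_, ?_⟩
  · intro j
    simp only [hc]
    split
    · exact hcol3 _
    · omega
  · rw [h.sum_range, if_pos rfl]
    have h1 : ∀ v : Fin n, (if num v = 0 then ℓ - A.card else if c (num v) = 0 then 1 else 0) =
        if v ∈ A then 1 else 0 := fun v => by
      rw [if_neg (hnum0 v), hcn]
      simp only [hcol]
      by_cases hv : v ∈ A
      · simp [hv]
      · simp only [hv, if_false]; split_ifs <;> simp_all
    rw [Finset.sum_congr rfl fun v _ => h1 v]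
    simp only [Finset.sum_ite_mem, Finset.univ_inter, Finset.sum_const, smul_eq_mul, mul_one]
    omega
  · rw [h.sum_range]
    have h0 : ∀ a, initCosts n adj num vert dfl 0 c a = 0 := fun a => by simp [initCosts]
    have h1 : ∀ v : Fin n, initCosts n adj num vert dfl (num v) c
        (if num v = 0 then ℓ - A.card else if c (num v) = 0 then 1 else 0) =
        if Survives G D A v then 1 else 0 := fun v => by
      rw [h.initCosts_num, if_neg (hnum0 v), hcn]
      have e1 : (if col v = 2 then 1 else 0) = if Survives G D A v then 1 else 0 := by
        simp only [hcol]
        by_cases hv : v ∈ A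
        · have : ¬ Survives G D A v := fun hs => hs.notMem hv
          simp [hv, this]
        · simp only [hv, if_false]; split_ifs <;> simp_all
      have e2 : dfl v * (if col v = 1 then 1 else 0) = 0 := by
        rw [hdfl]
        by_cases hD : v ∈ D
        · simp only [hcol]
          by_cases hv : v ∈ A
          · simp [hv]
          · simp [hv, survives_of_mem (G := G) hD hv]
        · simp [hD]
      have e3 : ((adj v).map (edgePenalty n num c (num v))).sum = 0 := by
        rw [List.sum_eq_zero_iff_forall_eq_nat]
        intro x hx
        obtain ⟨w, hw, rfl⟩ := List.mem_map.1 hx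
        obtain ⟨w, hvw, rfl⟩ := ((hadj v).2 w).1 hw
        have hvw : G.Adj v w := hvw
        rw [edgePenalty, if_neg]
        rintro ⟨-, h2⟩
        rw [hcn, hcn] at h2
        simp only [hcol] at h2
        by_cases hv : v ∈ A
        · simp [hv] at h2
        by_cases hw : w ∈ A
        · simp [hw] at h2
        have : Survives G D A v ↔ Survives G D A w :=
          ⟨fun hs => hs.of_adj hvw hw, fun hs => hs.of_adj hvw.symm hv⟩
        simp only [hv, hw, if_false, this] at h2
        split_ifs at h2 <;> omega
      have e4 : (if (if col v = 0 then 1 else 0) + col v = 0 then 1 else 0) = 0 := by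
        split_ifs <;> omega
      rw [e1, e2, e3, e4]; simp
    rw [h0, Finset.sum_congr rfl fun v _ => h1 v, Finset.sum_boole, zero_add, Nat.cast_id]
    have := attackerPayoff_add (G := G) (D := D) A
    omega

open Classical in
/-- A colouring of cost at most `n` has no violation; its colour `0` is an attack that leaves only
vertices of colour `2` alive. -/
theorem Numbering.attack_of_attainable (h : Numbering n M adj num vert B)
    (hadj : ∀ v : Fin n, Lists (adj v) (G.neighborSet v))
    (hdfl : ∀ v : Fin n, dfl v = if v ∈ D then 1 else 0) (hαn : α ≤ n)
    (hat : Attainable (initCosts n adj num vert dfl) (n + 1) ℓ (n - α)) :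
    FixedDefensePureAttack G D ℓ α := by
  obtain ⟨c, a, hc, ha, hv⟩ := hat
  rw [h.sum_range] at ha hv
  have hle : ∀ v : Fin n, initCosts n adj num vert dfl (num v) c (a (num v)) < n + 1 := fun v => by
    have := Finset.single_le_sum
      (f := fun v : Fin n => initCosts n adj num vert dfl (num v) c (a (num v)))
      (fun _ _ => Nat.zero_le _) (Finset.mem_univ v)
    beta_reduce at this
    omega
  have hcost := fun v => h.initCosts_num (dfl := dfl) v c (a (num v))
  have pen : ∀ x y : ℕ, (n + 1) * x ≤ y → y < n + 1 → x = 0 := fun x y h1 h2 => by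
    rcases Nat.eq_zero_or_pos x with h0 | h0
    · exact h0
    · nlinarith
  have hD : ∀ v ∈ D, c (num v) ≠ 1 := fun v hvD h1 => by
    have := pen (dfl v * (if c (num v) = 1 then 1 else 0)) _ (by rw [hcost]; omega) (hle v)
    simp [hdfl, hvD, h1] at this
  have hbud : ∀ v : Fin n, c (num v) = 0 → 1 ≤ a (num v) := fun v h0 => by
    have := pen (if a (num v) + c (num v) = 0 then 1 else 0) _ (by rw [hcost]; omega) (hle v)
    by_contra hlt
    rw [if_pos (by omega)] at this
    omega
  have hedge' : ∀ v w : Fin n, G.Adj v w → num w < num v → c (num w) * c (num v) ≠ 2 := by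
    intro v w hvw hlt h2
    have h1 : edgePenalty n num c (num v) w ≤ ((adj v).map (edgePenalty n num c (num v))).sum :=
      List.single_le_sum (fun _ _ => Nat.zero_le _) _
        (List.mem_map_of_mem (((hadj v).2 w).2 ⟨w, hvw, rfl⟩))
    rw [edgePenalty, if_pos ⟨hlt, h2⟩] at h1
    have h3 := hle v
    rw [hcost] at h3
    omega
  have hedge : ∀ v w : Fin n, G.Adj v w → c (num w) * c (num v) ≠ 2 := by
    intro v w hvw
    rcases lt_trichotomy (num w) (num v) with hlt | heq | hlt
    · exact hedge' v w hvw hlt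
    · have : v = w := by
        ext
        rw [← h.vert_num v v.2, ← heq, h.vert_num w w.2]
      exact (hvw.ne this).elim
    · rw [mul_comm]
      exact hedge' w v hvw.symm hlt
  set A : Finset (Fin n) := Finset.univ.filter fun v => c (num v) = 0 with hA
  have hmemA : ∀ v, v ∈ A ↔ c (num v) = 0 := fun v => by simp [hA]
  refine ⟨A, ?_, ?_⟩
  · rw [hA, Finset.card_filter]
    refine (Finset.sum_le_sum (g := fun v : Fin n => a (num v)) fun v _ => ?_).trans (by omega)
    split
    · exact hbud v (by assumption)
    · exact Nat.zero_le _
  · have hsurv : ∀ v, Survives G D A v → c (num v) = 2 := by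
      intro v hs
      have hn1 : ¬ c (num v) = 1 := by
        refine Survives.not_of_closed (P := fun v : Fin n => c (num v) = 1) ?_ hD hs
        intro v w h1 hvw hw
        have h2 := hedge v w hvw
        have h3 := hc (num w)
        rw [hmemA] at hw
        rw [h1] at h2
        omega
      have h3 := hc (num v)
      have h0 := hs.notMem
      rw [hmemA] at h0
      omega
    have h1 : (Finset.univ.filter fun v => Survives G D A v).card ≤ n - α := by
      rw [Finset.card_filter]
      refine (Finset.sum_le_sum (g := fun v : Fin n =>
        initCosts n adj num vert dfl (num v) c (a (num v))) fun v _ => ?_).trans (by omega)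
      split
      · rename_i hs
        rw [hcost, if_pos (hsurv v hs)]
        omega
      · exact Nat.zero_le _
    have := attackerPayoff_add (G := G) (D := D) A
    omega

theorem Numbering.fixedDefensePureAttack_iff (h : Numbering n M adj num vert B)
    (hadj : ∀ v : Fin n, Lists (adj v) (G.neighborSet v))
    (hdfl : ∀ v : Fin n, dfl v = if v ∈ D then 1 else 0) (hαn : α ≤ n) :
    FixedDefensePureAttack G D ℓ α ↔
      Attainable (initCosts n adj num vert dfl) (n + 1) ℓ (n - α) :=
  ⟨fun ⟨_, hA, hα⟩ => h.attainable_of_attack hadj hdfl hA hα,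
    h.attack_of_attainable hadj hdfl hαn⟩

end Game

/-! ### Search orders of a tree -/

section SearchOrder

variable {N : ℕ} {T : SimpleGraph (Fin N)} {q par : Fin N → Fin N}

/-- If each node of a tree except the first is adjacent to an earlier one, then all edges are of
this form, since a tree has one edge less than it has nodes. -/
theorem eq_parent_of_adj (hT : T.IsTree) (hq : Function.Injective q)
    (hlt : ∀ k, 0 < k.val → par k < k) (hadj : ∀ k, 0 < k.val → T.Adj (q (par k)) (q k))
    {a b : Fin N} (hab : a < b) (h : T.Adj (q a) (q b)) : a = par b := by
  classical
  let f : {k : Fin N // 0 < k.val} → T.edgeSet := fun k =>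
    ⟨s(q (par k), q k), hadj k k.2⟩
  have hf : Function.Injective f := by
    intro k k' hkk
    have h1 : s(q (par k), q k) = s(q (par k'), q k') := congrArg Subtype.val hkk
    rw [Sym2.eq_iff] at h1
    rcases h1 with ⟨-, h1⟩ | ⟨h1, h2⟩
    · exact Subtype.ext (hq h1)
    · have e1 := hq h1
      have e2 := hq h2
      have l1 := hlt k k.2
      have l2 := hlt k' k'.2
      rw [e1] at l1
      rw [← e2] at l2
      exact absurd l1 l2.asymm
  have hcard : Fintype.card {k : Fin N // 0 < k.val} = Fintype.card T.edgeSet := by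
    have h1 := hT.card_edgeFinset
    rw [Fintype.card_fin, SimpleGraph.edgeFinset_card] at h1
    have hN : 0 < N := by omega
    have h2 : Fintype.card {k : Fin N // 0 < k.val} + 1 = N := by
      have h3 := Fintype.card_subtype_compl (fun k : Fin N => k = ⟨0, hN⟩)
      rw [Fintype.card_subtype_eq, Fintype.card_fin] at h3
      have h4 : Fintype.card {k : Fin N // 0 < k.val} =
          Fintype.card {k : Fin N // ¬ k = ⟨0, hN⟩} :=
        Fintype.card_congr (Equiv.subtypeEquivRight fun k => by rw [Fin.ext_iff]; simp; omega)
      omega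
    omega
  obtain ⟨k, hk⟩ := ((Fintype.bijective_iff_injective_and_card f).2 ⟨hf, hcard⟩).2
    ⟨s(q a, q b), h⟩
  have h1 : s(q (par k), q k) = s(q a, q b) := congrArg Subtype.val hk
  rw [Sym2.eq_iff] at h1
  rcases h1 with ⟨h1, h2⟩ | ⟨h1, h2⟩
  · rw [← hq h1, ← hq h2]
  · have l1 := hlt k k.2
    rw [hq h1, hq h2] at l1
    exact absurd l1 hab.asymm

/-- A connected set of nodes contains, with every node that is not its first one, the parent of
this node. -/
theorem parent_mem_of_connected (hT : T.IsTree) (hq : Function.Bijective q)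
    (hlt : ∀ k, 0 < k.val → par k < k) (hadj : ∀ k, 0 < k.val → T.Adj (q (par k)) (q k))
    {S : Set (Fin N)} (hS : (T.induce S).Connected) {k k' : Fin N} (hk : q k ∈ S)
    (hk' : q k' ∈ S) (hkk : k' < k) : q (par k) ∈ S := by
  by_contra hpar
  -- Otherwise `S` cannot leave the set of descendants of `k`.
  let R : Fin N → Fin N → Prop := fun a b => 0 < b.val ∧ par b = a
  have hle : ∀ a, Relation.ReflTransGen R k a → k ≤ a := by
    intro a ha
    induction ha with
    | refl => exact le_rfl
    | tail _ hbc ih => exact ih.trans (by rw [← hbc.2]; exact (hlt _ hbc.1).le)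
  have key : ∀ x y : S, (T.induce S).Walk x y → ∀ a, q a = x → Relation.ReflTransGen R k a →
      ∃ b, q b = y ∧ Relation.ReflTransGen R k b := by
    intro x y p
    induction p with
    | nil => exact fun a ha hr => ⟨a, ha, hr⟩
    | @cons x y z hxy _ ih =>
      intro a ha hr
      obtain ⟨b, hb⟩ := hq.2 y
      have hab : T.Adj (q a) (q b) := by rw [ha, hb]; simpa using hxy
      refine ih b hb ?_
      rcases lt_trichotomy a b with h | h | h
      · exact hr.tail ⟨by omega, (eq_parent_of_adj hT hq.1 hlt hadj h hab).symm⟩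
      · rw [h] at hab; exact (hab.ne rfl).elim
      · have hba := eq_parent_of_adj hT hq.1 hlt hadj h hab.symm
        rcases Relation.ReflTransGen.cases_tail hr with he | ⟨c, hc, hc'⟩
        · exact (hpar (by rw [← he, ← hba, hb]; exact y.2)).elim
        · rw [hba, hc'.2]; exact hc
  obtain ⟨p⟩ := hS.preconnected ⟨q k, hk⟩ ⟨q k', hk'⟩
  obtain ⟨b, hb, hr⟩ := key _ _ p k rfl .refl
  have := hle b hr
  rw [hq.1 hb] at this
  exact absurd hkk this.not_gt

/-- If two vertices have a common bag, then the one that occurs first also belongs to the first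
bag of the other. -/
theorem mem_first_bag {n : ℕ} {G : SimpleGraph (Fin n)} {bag : Fin N → Finset (Fin n)}
    (hTD : IsTreeDecomposition G T bag) (hq : Function.Bijective q)
    (hadj : ∀ k, 0 < k.val → ∃ m < k, T.Adj (q m) (q k)) {v w : Fin n} {k m : Fin N}
    (hk : v ∈ bag (q k)) (hk' : ∀ j < k, v ∉ bag (q j)) (hm : w ∈ bag (q m)) (hmk : m ≤ k)
    {t : Fin N} (hvt : v ∈ bag t) (hwt : w ∈ bag t) : w ∈ bag (q k) := by
  choose! par hlt hadj using hadj
  obtain ⟨a, rfl⟩ := hq.2 t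
  induction a using WellFoundedLT.induction with
  | ind a ih =>
    rcases lt_trichotomy a k with h | rfl | h
    · exact (hk' a h hvt).elim
    · exact hwt
    · have hS : ∀ (u : Fin n) (j : Fin N), u ∈ bag (q j) → j < a → u ∈ bag (q a) →
          u ∈ bag (q (par a)) := fun u j hu hj hua =>
        parent_mem_of_connected hTD.isTree hq hlt hadj (hTD.connected u) hua hu hj
      have h0 : 0 < a.val := by omega
      exact ih (par a) (hlt a h0) (hS v k hk h hvt) (hS w m hm (hmk.trans_lt h) hwt)

end SearchOrder

/-! ### Counting edges -/

theorem Lists.length_eq {n : ℕ} {L : List ℕ} {S : Finset (Fin n)} (h : Lists L (S : Set (Fin n))) :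
    L.length = S.card := by
  rw [← List.toFinset_card_of_nodup h.1, ← Finset.card_map Fin.valEmbedding]
  congr 1
  ext x
  rw [List.mem_toFinset, h.2]
  simp

theorem Lists.lt {n : ℕ} {L : List ℕ} {S : Set (Fin n)} (h : Lists L S) {x : ℕ} (hx : x ∈ L) :
    x < n := by
  obtain ⟨v, -, rfl⟩ := (h.2 x).1 hx
  exact v.2

open Classical in
theorem Lists.length_eq_degree {n : ℕ} {G : SimpleGraph (Fin n)} {L : List ℕ} {v : Fin n}
    (h : Lists L (G.neighborSet v)) : L.length = G.degree v := by
  rw [← SimpleGraph.card_neighborFinset_eq_degree]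
  exact Lists.length_eq (by simpa using h)

/-- The adjacency lists of a tree have less than twice as many entries as there are nodes. -/
theorem sum_length_tree_le {N : ℕ} {T : SimpleGraph (Fin N)} {adj : ℕ → List ℕ} (hT : T.IsTree)
    (hadj : ∀ t : Fin N, Lists (adj t) (T.neighborSet t)) :
    ∑ t : Fin N, (adj t).length ≤ 2 * N := by
  classical
  rw [Finset.sum_congr rfl fun t _ => (hadj t).length_eq_degree]
  have h1 := T.sum_degrees_eq_twice_card_edges
  have h2 := hT.card_edgeFinset
  rw [Fintype.card_fin] at h2
  have h3 : ∑ t : Fin N, T.degree t = 2 * T.edgeFinset.card := by convert h1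
  omega

open Classical in
/-- A graph with a numbering in which `B i` has at most `M` members has at most `M * n` edges. -/
theorem Numbering.sum_length_le {n M : ℕ} {adj : ℕ → List ℕ} {num vert : ℕ → ℕ} {B : ℕ → List ℕ}
    (h : Numbering n M adj num vert B) {G : SimpleGraph (Fin n)}
    (hadj : ∀ v : Fin n, Lists (adj v) (G.neighborSet v)) :
    ∑ v : Fin n, (adj v).length ≤ 2 * M * n := by
  have hinj : ∀ v w : Fin n, num v = num w → v = w := fun v w hvw => by
    ext; rw [← h.vert_num v v.2, hvw, h.vert_num w w.2]
  have h1 : ∀ v : Fin n, (adj v).length =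
      ∑ w : Fin n, (if G.Adj v w ∧ num w < num v then 1 else 0) +
      ∑ w : Fin n, (if G.Adj v w ∧ num v < num w then 1 else 0) := fun v => by
    rw [(hadj v).length_eq_degree, ← SimpleGraph.card_neighborFinset_eq_degree,
      SimpleGraph.neighborFinset_eq_filter, Finset.card_filter, ← Finset.sum_add_distrib]
    refine Finset.sum_congr rfl fun w _ => ?_
    by_cases hvw : G.Adj v w
    · have : num v ≠ num w := fun he => hvw.ne (hinj v w he)
      rcases this.lt_or_gt with hlt | hlt
      · simp [hvw, hlt, hlt.asymm]
      · simp [hvw, hlt, hlt.asymm]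
    · simp [hvw]
  have h2 : ∑ v : Fin n, ∑ w : Fin n, (if G.Adj v w ∧ num v < num w then 1 else 0) =
      ∑ v : Fin n, ∑ w : Fin n, (if G.Adj v w ∧ num w < num v then 1 else 0) := by
    rw [Finset.sum_comm]
    simp only [G.adj_comm]
  have h3 : ∀ v : Fin n, ∑ w : Fin n, (if G.Adj v w ∧ num w < num v then 1 else 0) ≤ M :=
    fun v => by
      rw [Finset.sum_boole, Nat.cast_id]
      refine le_trans ?_ ((List.toFinset_card_le (B (num v))).trans (h.length_le _))
      refine Finset.card_le_card_of_injOn (fun w => num w) ?_ fun w _ w' _ hw => hinj _ _ hw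
      intro w hw
      simp only [Finset.coe_filter, Finset.mem_univ, true_and, Set.mem_ofPred_eq] at hw
      exact List.mem_toFinset.2 (h.adj_mem v v.2 w (((hadj v).2 _).2 ⟨w, hw.1, rfl⟩) hw.2)
  rw [Finset.sum_congr rfl fun v _ => h1 v, Finset.sum_add_distrib, h2]
  have h4 := Finset.sum_le_sum fun v (_ : v ∈ Finset.univ) => h3 v
  rw [Finset.sum_const, Finset.card_univ, Fintype.card_fin, smul_eq_mul] at h4
  nlinarith

/-! ### Reading the input -/

infixr:60 "⨟" => Program.seq

/-- The lists `L 0, …, L (m - 1)` are stored one after another in `flat`, and `off t` is the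
position at which `L t` starts. -/
structure Stored (off flat : ℕ → ℕ) (L : ℕ → List ℕ) (m : ℕ) : Prop where
  off_succ : ∀ t < m, off (t + 1) = off t + (L t).length
  flat_eq : ∀ t < m, ∀ j (hj : j < (L t).length), flat (off t + j) = (L t)[j]

theorem mem_take_succ {β : Type*} {L : List β} {j : ℕ} (hj : j < L.length) {v : β} :
    v ∈ L.take (j + 1) ↔ v ∈ L.take j ∨ v = L[j] := by
  rw [← List.take_append_getElem hj, List.mem_append, List.mem_singleton]

/-- Marks the members of the defense in array `8`. Their number is in register `8`. -/
def progDefense : Program :=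
  .forUp 9 0 8 (.store 8 (.cell 1 (.reg 9)) 1)

theorem exec_progDefense {W : ℕ} {s : State} {L : List ℕ} (hW : 1 < W)
    (hL : ∀ j (hj : j < L.length), s.arr 1 j = L[j]) (h8 : s.reg 8 = L.length)
    (hlt : ∀ x ∈ L, x < W) (hlen : L.length < W) :
    Exec W progDefense s (L.length * 12 + 6) fun s' =>
      ∀ v, s'.arr 8 v = if v ∈ L then 1 else s.arr 8 v := by
  refine Exec.le (Exec.forUp
    (fun j s' => ∀ v, s'.arr 8 v = if v ∈ L.take j then 1 else s.arr 8 v) 0 L.length 4 ?_ rfl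
    (by simp [h8]) (by decide) rfl rfl (by omega) hW (by simp) ?_ ?_) (by simp [Expr.cost]; omega)
  · simp; omega
  · intro j s' hj hx hk hI
    have ha : s'.arr 1 = s.arr 1 := hk.arr 1
    rw [zero_add] at hx
    refine Exec.of_vc ?_
    have h1 := hlt L[j] (List.getElem_mem hj)
    simp only [Program.vc, Expr.fits_cell, Expr.fits_reg, Expr.eval_reg, hx, ha, hL j hj,
      Expr.fits_ofNat, Expr.eval_cell, Expr.eval_ofNat, State.set_arr, State.put_arr, if_true]
    refine ⟨⟨by omega, h1⟩, hW, fun v => ?_⟩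
    rw [Function.update_apply, hI v]
    simp only [mem_take_succ hj]
    by_cases hv : v = L[j]
    · simp [hv]
    · simp [hv]
  · intro s' _ _ hI v
    rw [hI v, List.take_length]

/-- Computes the largest size of a bag in register `6`. -/
def progBagSize : Program :=
  .assign 6 0 ⨟ .forUp 9 0 2
    (.assign 10 (.cell 6 (.reg 9 + 1) - .cell 6 (.reg 9)) ⨟
      .branch (.lt (.reg 6) (.reg 10)) (.assign 6 (.reg 10)) .skip)

theorem exec_progBagSize {W N : ℕ} {s : State} {LB : ℕ → List ℕ} (hW : 1 < W)
    (hB : Stored (s.arr 6) (s.arr 7) LB N) (h2 : s.reg 2 = N) (hN : N + 1 < W)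
    (hoff : ∀ t ≤ N, s.arr 6 t < W) :
    Exec W progBagSize s (N * 26 + 8) fun s' =>
      s'.reg 6 = (Finset.range N).sup fun t => (LB t).length := by
  refine Exec.le (Exec.seq (Exec.of_vc ?_)) (?_ : 2 + (N * 26 + 6) ≤ _)
  swap
  · omega
  refine ⟨by simp; omega, ?_⟩
  refine Exec.le (Exec.forUp (fun j s' => s'.reg 6 = (Finset.range j).sup fun t => (LB t).length)
    0 N 18 ?_ rfl (by simp [h2]) (by decide) rfl rfl (by omega) hW (by simp) ?_ ?_)
    (by simp [Expr.cost]; omega)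
  · simp; omega
  · intro j s' hj hx hk hI
    have ha : s'.arr 6 = s.arr 6 := hk.arr 6
    rw [zero_add] at hx
    refine Exec.le (Exec.of_vc ?_) (by decide)
    have h1 := hoff j (by omega)
    have h3 := hoff (j + 1) (by omega)
    have h4 := hB.off_succ j hj
    have h5 : s.arr 6 (j + 1) - s.arr 6 j = (LB j).length := by omega
    have h6 : (Finset.range j).sup (fun t => (LB t).length) < W := by
      rw [Finset.sup_lt_iff (by simp; omega)]
      intro t ht
      rw [Finset.mem_range] at ht
      have := hoff (t + 1) (by omega)
      rw [hB.off_succ t (by omega)] at this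
      omega
    have h7 := ite_one_zero_lt hW ((Finset.range j).sup (fun t => (LB t).length) < (LB j).length)
    rw [Finset.range_add_one, Finset.sup_insert]
    simp [Program.vc, hx, ha, hI, h5, -Finset.lt_sup_iff, -Finset.sup_lt_iff]
    exact ⟨by omega, ⟨by omega, by omega, h7⟩, fun h => ⟨by omega, fun b hb =>
      (Finset.le_sup (f := fun t => (LB t).length) (Finset.mem_range.2 hb)).trans h.le⟩⟩
  · intro s' _ _ hI
    exact hI

/-- Computes `3 ^ M` in register `7`, where `M` is in register `6`. -/
def progPow : Program :=
  .assign 7 1 ⨟ .forUp 9 0 6 (.assign 7 (.reg 7 * 3))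

theorem exec_progPow {W M : ℕ} {s : State} (h6 : s.reg 6 = M) (hM : M < W) (hP : 3 ^ M < W)
    (h3 : 3 < W) :
    Exec W progPow s (M * 12 + 8) fun s' => s'.reg 7 = 3 ^ M := by
  refine Exec.le (Exec.seq (Exec.of_vc ?_)) (?_ : 2 + (M * 12 + 6) ≤ _)
  swap
  · omega
  refine ⟨by simp; omega, ?_⟩
  refine Exec.le (Exec.forUp (fun j s' => s'.reg 7 = 3 ^ j) 0 M 4 ?_ rfl (by simp [h6]) (by decide)
    rfl rfl (by omega) (by omega) (by simp) ?_ ?_) (by simp [Expr.cost]; omega)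
  · simp; omega
  · intro j s' hj hx hk hI
    refine Exec.of_vc ?_
    have h1 : 3 ^ j * 3 ≤ 3 ^ M := by rw [← pow_succ]; exact Nat.pow_le_pow_right (by omega) hj
    simp [Program.vc, hI, pow_succ]
    have : 0 < 3 ^ j := by positivity
    omega
  · intro s' _ _ hI
    exact hI

/-- Copies the parameters of the input to registers: `n`, `N`, `ℓ`, `ℓ + 1`, `α`, and the size of
the defense. -/
def progLoad : Program :=
  .assign 1 (.cell 0 0) ⨟ .assign 2 (.cell 0 1) ⨟ .assign 3 (.cell 0 2) ⨟
    .assign 4 (.reg 3 + 1) ⨟ .assign 5 (.cell 0 3) ⨟ .assign 8 (.cell 0 4)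

theorem exec_progLoad {W : ℕ} {s : State} (h4 : 4 < W) (h : ∀ i, s.arr 0 i < W)
    (hℓ : s.arr 0 2 + 1 < W) :
    Exec W progLoad s 19 fun s' =>
      s'.reg 1 = s.arr 0 0 ∧ s'.reg 2 = s.arr 0 1 ∧ s'.reg 3 = s.arr 0 2 ∧
        s'.reg 4 = s.arr 0 2 + 1 ∧ s'.reg 5 = s.arr 0 3 ∧ s'.reg 8 = s.arr 0 4 := by
  refine Exec.le (Exec.of_vc ?_) (by decide)
  have := h 0; have := h 1; have := h 2; have := h 3; have := h 4
  simp [progLoad, Program.vc]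
  omega

/-! ### Breadth-first search in the tree -/

/-- The first `τ` cells of `Q` are distinct nodes, the nodes marked in `vis`, and each of them
except the first is in the adjacency list of an earlier one. -/
structure IsSearch (N : ℕ) (LT : ℕ → List ℕ) (τ : ℕ) (vis Q : ℕ → ℕ) : Prop where
  pos : 0 < τ
  lt : ∀ j < τ, Q j < N
  inj : ∀ i < τ, ∀ j < τ, Q i = Q j → i = j
  vis_eq_zero : ∀ t < N, vis t = 0 ↔ ∀ j < τ, Q j ≠ t
  vis_le : ∀ t < N, vis t ≤ 1
  parent : ∀ j, 0 < j → j < τ → ∃ m < j, Q j ∈ LT (Q m)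

section IsSearch

variable {N τ h u : ℕ} {LT : ℕ → List ℕ} {vis Q : ℕ → ℕ}

theorem IsSearch.push (hs : IsSearch N LT τ vis Q) (hh : h < τ) (hu : u ∈ LT (Q h)) (huN : u < N)
    (hv : vis u = 0) :
    IsSearch N LT (τ + 1) (Function.update vis u 1) (Function.update Q τ u) := by
  have hQ : ∀ j < τ, Function.update Q τ u j = Q j := fun j hj => by
    rw [Function.update_of_ne hj.ne]
  have hτ : Function.update Q τ u τ = u := Function.update_self _ _ _
  have hnew := (hs.vis_eq_zero u huN).1 hv
  refine ⟨by omega, fun j hj => ?_, fun i hi j hj hij => ?_, fun t ht => ?_, fun t ht => ?_,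
    fun j h0 hj => ?_⟩
  · rcases Nat.lt_succ_iff_lt_or_eq.1 hj with hj | rfl
    · rw [hQ j hj]; exact hs.lt j hj
    · rwa [hτ]
  · rcases Nat.lt_succ_iff_lt_or_eq.1 hi with hi | rfl <;>
      rcases Nat.lt_succ_iff_lt_or_eq.1 hj with hj | rfl
    · rw [hQ i hi, hQ j hj] at hij; exact hs.inj i hi j hj hij
    · rw [hQ i hi, hτ] at hij; exact (hnew i hi hij).elim
    · rw [hQ j hj, hτ] at hij; exact (hnew j hj hij.symm).elim
    · rfl
  · rw [Function.update_apply]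
    split
    · rename_i htu
      refine ⟨fun h1 => absurd h1 one_ne_zero, fun h1 => (h1 τ (by omega) (hτ.trans htu.symm)).elim⟩
    · rename_i htu
      rw [hs.vis_eq_zero t ht]
      refine ⟨fun h1 j hj => ?_, fun h1 j hj => ?_⟩
      · rcases Nat.lt_succ_iff_lt_or_eq.1 hj with hj | rfl
        · rw [hQ j hj]; exact h1 j hj
        · rw [hτ]; exact fun he => htu he.symm
      · rw [← hQ j hj]; exact h1 j (by omega)
  · rw [Function.update_apply]
    split
    · exact le_rfl
    · exact hs.vis_le t ht
  · rcases Nat.lt_succ_iff_lt_or_eq.1 hj with hj | rfl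
    · obtain ⟨m, hm, hmem⟩ := hs.parent j h0 hj
      exact ⟨m, hm, by rwa [hQ j hj, hQ m (by omega)]⟩
    · exact ⟨h, hh, by rwa [hτ, hQ h hh]⟩

theorem IsSearch.le (hs : IsSearch N LT τ vis Q) : τ ≤ N := by
  have := Finset.card_le_card_of_injOn (s := Finset.range τ) (t := Finset.range N) Q
    (fun j hj => by simpa using hs.lt j (by simpa using hj))
    (fun i hi j hj hij => hs.inj i (by simpa using hi) j (by simpa using hj) hij)
  simpa using this

/-- As long as not all nodes have been processed, there is a node waiting in the queue. -/
theorem IsSearch.lt_of_closed (hs : IsSearch N LT τ vis Q) {T : SimpleGraph (Fin N)}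
    (hT : T.Connected) (hLT : ∀ t : Fin N, Lists (LT t) (T.neighborSet t))
    (hcl : ∀ m < h, ∀ u ∈ LT (Q m), ∃ j < τ, Q j = u) (hhN : h < N) : h < τ := by
  by_contra hlt
  push Not at hlt
  have hclosed : ∀ x y : Fin N, T.Walk x y → (∃ j < τ, Q j = x) → ∃ j < τ, Q j = y := by
    intro x y p
    induction p with
    | nil => exact id
    | @cons x y z hxy _ ih =>
      rintro ⟨j, hj, hjx⟩
      refine ih (hcl j (by omega) y ?_)
      rw [hjx]
      exact ((hLT x).2 _).2 ⟨y, hxy, rfl⟩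
  have hall : ∀ t : Fin N, ∃ j < τ, Q j = t := fun t => by
    obtain ⟨p⟩ := hT.preconnected ⟨Q 0, hs.lt 0 hs.pos⟩ t
    exact hclosed _ _ p ⟨0, hs.pos, rfl⟩
  choose f hf hfQ using hall
  have := Finset.card_le_card_of_injOn (s := Finset.univ) (t := Finset.range τ) f
    (fun t _ => by simpa using hf t) (fun t _ t' _ htt => by
      ext; rw [← hfQ t, ← hfQ t', htt])
  simp at this
  omega

end IsSearch

/-- Puts the unmarked nodes of the adjacency list of node `t` (register `13`) into the queue
(array `10`, with its length in register `12`), and marks them (in array `9`). -/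
def progScan : Program :=
  .forUp 15 (.cell 4 (.reg 13)) 14
    (.assign 16 (.cell 5 (.reg 15)) ⨟
      .branch (.cell 9 (.reg 16)) .skip
        (.store 9 (.reg 16) 1 ⨟ .store 10 (.reg 12) (.reg 16) ⨟ .assign 12 (.reg 12 + 1)))

/-- Lists the nodes of the tree in array `10`, in the order of a breadth-first search from
node `0`. -/
def progSearch : Program :=
  .store 9 0 1 ⨟ .store 10 0 0 ⨟ .assign 12 1 ⨟
    .forUp 11 0 2
      (.assign 13 (.cell 10 (.reg 11)) ⨟ .assign 14 (.cell 4 (.reg 13 + 1)) ⨟ progScan)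

section Exec

variable {W N : ℕ} {LT : ℕ → List ℕ}

theorem exec_progScan {s : State} {τ h : ℕ} (hW : 1 < W) (hN : N + 1 < W)
    (hst : Stored (s.arr 4) (s.arr 5) LT N) (hoff : ∀ t ≤ N, s.arr 4 t < W)
    (hlt : ∀ t < N, ∀ u ∈ LT t, u < N)
    (hs : IsSearch N LT τ (s.arr 9) (s.arr 10)) (hh : h < τ) (h12 : s.reg 12 = τ)
    (h13 : s.reg 13 = s.arr 10 h) (h14 : s.reg 14 = s.arr 4 (s.arr 10 h + 1)) :
    Exec W progScan s ((LT (s.arr 10 h)).length * 26 + 7) fun s' =>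
      ∃ τ', τ ≤ τ' ∧ s'.reg 12 = τ' ∧ IsSearch N LT τ' (s'.arr 9) (s'.arr 10) ∧
        (∀ j < τ, s'.arr 10 j = s.arr 10 j) ∧
        ∀ u ∈ LT (s.arr 10 h), ∃ j < τ', s'.arr 10 j = u := by
  set t := s.arr 10 h with ht
  have htN : t < N := hs.lt h hh
  have hsucc := hst.off_succ t htN
  have hoff1 := hoff (t + 1) (by omega)
  have hoff0 := hoff t (by omega)
  refine Exec.le (Exec.forUp (fun e s' => ∃ τ', τ ≤ τ' ∧ s'.reg 12 = τ' ∧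
      IsSearch N LT τ' (s'.arr 9) (s'.arr 10) ∧ (∀ j < τ, s'.arr 10 j = s.arr 10 j) ∧
      ∀ u ∈ (LT t).take e, ∃ j < τ', s'.arr 10 j = u) (s.arr 4 t) (LT t).length 18 ?_ ?_ ?_
    (by decide) rfl rfl (by omega) hW ?_ ?_ ?_) (by simp [Expr.cost]; omega)
  · simp [h13]; omega
  · simp [h13]
  · rw [h14, hsucc]
  · exact ⟨τ, le_rfl, by simp [h12], by simpa using hs, by simp, by simp⟩
  · rintro e s' he hx hk ⟨τ', hττ, h12', hs', hold, hdone⟩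
    have h5 : s'.arr 5 = s.arr 5 := hk.arr 5
    set u := (LT t)[e] with hu
    have huN : u < N := hlt t htN u (List.getElem_mem he)
    have hcell : s.arr 5 (s.arr 4 t + e) = u := hst.flat_eq t htN e he
    have hvis := hs'.vis_le u huN
    have hle := hs'.le
    refine Exec.le (Exec.of_vc ?_) (by decide)
    simp only [Program.vc, Expr.fits_cell, Expr.fits_reg, Expr.eval_reg, hx, h5, Expr.eval_cell,
      hcell, State.set_arr, State.set_reg, if_true, Expr.fits_ofNat, Expr.eval_ofNat,
      State.put_arr, State.put_reg, Expr.fits_add, Expr.eval_add]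
    refine ⟨⟨by omega, by omega⟩, ⟨by omega, by omega⟩, ?_, ?_⟩
    · intro hne
      refine ⟨τ', hττ, by simpa using h12', by simpa using hs', hold, fun w hw => ?_⟩
      rcases (mem_take_succ he).1 hw with hw | rfl
      · exact hdone w hw
      · have := mt (hs'.vis_eq_zero u huN).2 hne
        push Not at this
        exact this
    · intro h0
      have hmem : u ∈ LT (s'.arr 10 h) := by rw [hold h hh]; exact List.getElem_mem he
      have hp := hs'.push (lt_of_lt_of_le hh hττ) hmem huN h0
      have hple := hp.le
      simp [h12']
      refine ⟨by omega, hW, by omega, by omega, by omega, by omega, hp, ?_, ?_⟩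
      · intro j hj
        rw [Function.update_of_ne (by omega)]
        exact hold j hj
      · intro w hw
        rcases (mem_take_succ he).1 hw with hw | rfl
        · obtain ⟨j, hj, hjw⟩ := hdone w hw
          exact ⟨j, by omega, by rw [Function.update_of_ne (by omega)]; exact hjw⟩
        · exact ⟨τ', by omega, Function.update_self _ _ _⟩
  · rintro s' _ _ ⟨τ', h1, h2, h3, h4, h5⟩
    exact ⟨τ', h1, h2, h3, h4, by simpa using h5⟩

theorem sum_range_eq_sum_fin {Q : ℕ → ℕ} (hlt : ∀ j < N, Q j < N)
    (hinj : ∀ i < N, ∀ j < N, Q i = Q j → i = j) (f : ℕ → ℕ) :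
    ∑ i ∈ Finset.range N, f (Q i) = ∑ t : Fin N, f t := by
  rw [← Fin.sum_univ_eq_sum_range (fun i => f (Q i))]
  let g : Fin N → Fin N := fun i => ⟨Q i, hlt i i.2⟩
  have hg : Function.Bijective g := Finite.injective_iff_bijective.1 fun i j hij => by
    ext; exact hinj i i.2 j j.2 (congrArg Fin.val hij)
  exact hg.sum_comp (fun t => f t)

theorem exec_progSearch {s : State} {T : SimpleGraph (Fin N)} (hT : T.IsTree)
    (hLT : ∀ t : Fin N, Lists (LT t) (T.neighborSet t)) (hN : N + 1 < W)
    (hst : Stored (s.arr 4) (s.arr 5) LT N) (hoff : ∀ t ≤ N, s.arr 4 t < W)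
    (h2 : s.reg 2 = N) (h9 : ∀ t, s.arr 9 t = 0) :
    Exec W progSearch s (N * 80 + 16) fun s' =>
      (∀ j < N, s'.arr 10 j < N) ∧ (∀ i < N, ∀ j < N, s'.arr 10 i = s'.arr 10 j → i = j) ∧
        ∀ j, 0 < j → j < N → ∃ m < j, s'.arr 10 j ∈ LT (s'.arr 10 m) := by
  have hN0 : 0 < N := by
    obtain ⟨t⟩ := hT.connected.nonempty
    exact t.pos
  have hlt : ∀ t < N, ∀ u ∈ LT t, u < N := fun t ht u hu => (hLT ⟨t, ht⟩).lt hu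
  refine Exec.le (Exec.seq (Exec.of_vc (p := .store 9 0 1) ?_)) (?_ : 3 + (3 + (2 + (N * 80 + 6))) ≤ _)
  swap
  · omega
  refine ⟨by simp; omega, by simp; omega, Exec.seq (Exec.of_vc (p := .store 10 0 0)
    ⟨by simp; omega, by simp; omega, Exec.seq (Exec.of_vc (p := .assign 12 1)
    ⟨by simp; omega, ?_⟩)⟩)⟩
  set s₁ : State := _
  change Exec W _ s₁ _ _
  have hs0 : IsSearch N LT 1 (s₁.arr 9) (s₁.arr 10) := by
    simp only [s₁, State.set_arr, State.put_arr, Expr.eval_ofNat]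
    refine ⟨by omega, ?_, fun i hi j hj _ => by omega, fun t ht => ?_, fun t ht => ?_,
      fun j h0 hj => by omega⟩
    · simpa using hN0
    · simp only [Nat.lt_one_iff, forall_eq]
      by_cases ht0 : t = 0
      · simp [ht0]
      · simp [ht0, Ne.symm ht0, h9]
    · by_cases ht0 : t = 0
      · simp [ht0]
      · simp [ht0, h9]
  refine Exec.forUp_amortized (fun h σ s' => ∃ τ, s'.reg 12 = τ ∧
      IsSearch N LT τ (s'.arr 9) (s'.arr 10) ∧
      (∀ m < h, ∀ u ∈ LT (s'.arr 10 m), ∃ j < τ, s'.arr 10 j = u) ∧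
      σ ≤ ∑ i ∈ Finset.range h, ((LT (s'.arr 10 i)).length * 26 + 28)) 0 N (by simp; omega) rfl
    (by simp [s₁, h2]) (by decide) rfl rfl (by omega) (by omega) ?_ ?_ ?_
  · exact ⟨1, by simp [s₁], by simpa using hs0, by simp, by simp⟩
  · rintro h σ s' hh hx hk ⟨τ, h12, hs', hcl, hσ⟩
    have hhτ : h < τ := hs'.lt_of_closed hT.connected hLT hcl hh
    have ht := hs'.lt h hhτ
    have h4 : s'.arr 4 = s.arr 4 := (hk.arr 4).trans rfl
    have h5 : s'.arr 5 = s.arr 5 := (hk.arr 5).trans rfl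
    rw [zero_add] at hx
    have o1 := hoff (s'.arr 10 h + 1) (by omega)
    refine ⟨3 + (5 + ((LT (s'.arr 10 h)).length * 26 + 7)), Exec.seq (Exec.of_vc
      ⟨by simp [hx]; omega, Exec.seq (Exec.of_vc ⟨by simp [hx, h4]; omega, ?_⟩)⟩)⟩
    have hs₂ := exec_progScan (W := W) (s := (s'.set 13 (s'.arr 10 h)).set 14
      (s.arr 4 (s'.arr 10 h + 1))) (by omega) hN (by simpa [h4, h5] using hst)
      (by simpa [h4] using hoff) hlt (by simpa using hs') hhτ (by simpa using h12) (by simp)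
      (by simp [h4])
    simp only [Expr.eval_cell, Expr.eval_reg, hx, Expr.eval_add, State.set_reg, if_true,
      Expr.eval_ofNat, State.set_arr, h4]
    refine hs₂.mono (by simp) ?_
    rintro s'' ⟨τ', hττ, h12', hs'', hold, hdone⟩
    simp only [State.set_arr] at hold hdone
    refine ⟨τ', by simpa using h12', by simpa using hs'', ?_, ?_⟩
    · intro m hm u hu
      rw [hold m (by omega)] at hu
      rcases Nat.lt_succ_iff_lt_or_eq.1 hm with hm | rfl
      · obtain ⟨j, hj, hju⟩ := hcl m hm u hu
        exact ⟨j, by omega, by rw [hold j hj, hju]⟩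
      · exact hdone u hu
    · rw [Finset.sum_range_succ, hold h hhτ]
      have : ∑ i ∈ Finset.range h, ((LT (s''.arr 10 i)).length * 26 + 28) =
          ∑ i ∈ Finset.range h, ((LT (s'.arr 10 i)).length * 26 + 28) :=
        Finset.sum_congr rfl fun i hi => by rw [hold i (by rw [Finset.mem_range] at hi; omega)]
      omega
  · rintro σ s' hx hk ⟨τ, h12, hs', hcl, hσ⟩
    have hτ : N ≤ τ := by
      have := hs'.lt_of_closed hT.connected hLT (h := N - 1) (fun m hm => hcl m (by omega))
        (by omega)
      omega
    have hlt' : ∀ j < N, s'.arr 10 j < N := fun j hj => hs'.lt j (by omega)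
    have hinj' : ∀ i < N, ∀ j < N, s'.arr 10 i = s'.arr 10 j → i = j :=
      fun i hi j hj => hs'.inj i (by omega) j (by omega)
    refine ⟨?_, hlt', hinj', fun j h0 hj => hs'.parent j h0 (by omega)⟩
    rw [sum_range_eq_sum_fin hlt' hinj' fun t => (LT t).length * 26 + 28,
      Finset.sum_add_distrib, ← Finset.sum_mul] at hσ
    have := sum_length_tree_le hT hLT
    simp at hσ
    simp [Expr.cost]
    omega

end Exec

/-! ### Numbering the vertices -/

/-- `vert` enumerates the vertices that have a number, and `num` is its inverse, with value `0` for
the vertices without a number. -/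
structure IsPartialEnum (n cnt : ℕ) (num vert : ℕ → ℕ) : Prop where
  num_le : ∀ v < n, num v ≤ cnt
  vert_num : ∀ v < n, num v ≠ 0 → vert (num v) = v
  vert_lt : ∀ i, 1 ≤ i → i ≤ cnt → vert i < n
  num_vert : ∀ i, 1 ≤ i → i ≤ cnt → num (vert i) = i

section PartialEnum

variable {n cnt v : ℕ} {num vert : ℕ → ℕ}

theorem IsPartialEnum.le (h : IsPartialEnum n cnt num vert) : cnt ≤ n := by
  have := Finset.card_le_card_of_injOn (s := Finset.Icc 1 cnt) (t := Finset.range n) vert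
    (fun i hi => by
      rw [Finset.mem_coe, Finset.mem_Icc] at hi
      simpa using h.vert_lt i hi.1 hi.2)
    (fun i hi j hj hij => by
      rw [Finset.mem_coe, Finset.mem_Icc] at hi hj
      rw [← h.num_vert i hi.1 hi.2, hij, h.num_vert j hj.1 hj.2])
  simpa using this

theorem IsPartialEnum.push (h : IsPartialEnum n cnt num vert) (hv : v < n) (h0 : num v = 0) :
    IsPartialEnum n (cnt + 1) (Function.update num v (cnt + 1))
      (Function.update vert (cnt + 1) v) := by
  refine ⟨fun w hw => ?_, fun w hw hne => ?_, fun i h1 hi => ?_, fun i h1 hi => ?_⟩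
  · rw [Function.update_apply]
    split
    · exact le_rfl
    · exact (h.num_le w hw).trans (by omega)
  · by_cases hwv : w = v
    · subst hwv; simp
    · rw [Function.update_of_ne hwv] at hne ⊢
      rw [Function.update_of_ne (by have := h.num_le w hw; omega)]
      exact h.vert_num w hw hne
  · rw [Function.update_apply]
    split
    · exact hv
    · exact h.vert_lt i h1 (by omega)
  · rcases eq_or_ne i (cnt + 1) with rfl | hne
    · simp
    · have hi' : i ≤ cnt := by omega
      rw [Function.update_of_ne hne, Function.update_of_ne]
      · exact h.num_vert i h1 hi'
      · rintro he
        have := h.num_vert i h1 hi'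
        rw [he] at this
        omega

/-- If all vertices have a number, then the numbers are `1, …, n`. -/
theorem IsPartialEnum.eq_of_ne_zero (h : IsPartialEnum n cnt num vert)
    (hne : ∀ v < n, num v ≠ 0) : cnt = n := by
  refine le_antisymm h.le ?_
  have := Finset.card_le_card_of_injOn (s := Finset.range n) (t := Finset.Icc 1 cnt) num
    (fun v hv => by
      rw [Finset.mem_coe, Finset.mem_range] at hv
      have h1 := hne v hv
      have h2 := h.num_le v hv
      rw [Finset.mem_coe, Finset.mem_Icc]
      omega)
    (fun v hv w hw hvw => by
      rw [Finset.mem_coe, Finset.mem_range] at hv hw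
      rw [← h.vert_num v hv (hne v hv), hvw, h.vert_num w hw (hne w hw)])
  simpa using this

end PartialEnum

/-- The list `L` is stored as the `i`-th row of an array `cell` whose rows have size `M`, with its
length in `len i`. -/
def HasRow (M : ℕ) (len cell : ℕ → ℕ) (i : ℕ) (L : List ℕ) : Prop :=
  len i = L.length ∧ ∀ j (hj : j < L.length), cell (i * M + j) = L[j]

/-- The bag at position `k` of the order `Q` is the first one that contains `v`. -/
def IsFirst (LB : ℕ → List ℕ) (Q : ℕ → ℕ) (k v : ℕ) : Prop :=
  v ∈ LB (Q k) ∧ ∀ j < k, v ∉ LB (Q j)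

/-- The numbers `1, …, i` of the vertices in the list `L`. -/
def numbersUpTo (num : ℕ → ℕ) (i : ℕ) (L : List ℕ) : List ℕ :=
  (L.map num).filter fun u => decide (1 ≤ u ∧ u ≤ i)

theorem mem_numbersUpTo {num : ℕ → ℕ} {i u : ℕ} {L : List ℕ} :
    u ∈ numbersUpTo num i L ↔ (∃ w ∈ L, num w = u) ∧ 1 ≤ u ∧ u ≤ i := by
  simp [numbersUpTo]

theorem length_numbersUpTo_le (num : ℕ → ℕ) (i : ℕ) (L : List ℕ) :
    (numbersUpTo num i L).length ≤ L.length := by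
  simpa [numbersUpTo] using List.length_filter_le (fun u => decide (1 ≤ u ∧ u ≤ i)) (L.map num)

theorem numbersUpTo_congr {num num' : ℕ → ℕ} {i : ℕ} {L : List ℕ}
    (h : ∀ w ∈ L, num w = num' w ∨ (num w = 0 ∧ i < num' w)) :
    numbersUpTo num i L = numbersUpTo num' i L := by
  induction L with
  | nil => rfl
  | cons w L ih =>
    have ih := ih fun x hx => h x (List.mem_cons_of_mem _ hx)
    unfold numbersUpTo at ih ⊢
    rw [List.map_cons, List.map_cons, List.filter_cons, List.filter_cons, ih]
    rcases h w List.mem_cons_self with h1 | ⟨h1, h2⟩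
    · rw [h1]
    · rw [if_neg (by simp [h1]), if_neg (by simp; omega)]

/-- The state of the numbering while the bag at position `k` is processed: the vertices with a
number are numbered in the order of their first bags, and the numbers up to `i` in the first bag
of vertex number `i` are stored in row `i`. -/
structure IsPartialNumbering (n M k cnt : ℕ) (LB : ℕ → List ℕ) (Q num vert len cell : ℕ → ℕ) :
    Prop extends IsPartialEnum n cnt num vert where
  first : ∀ i, 1 ≤ i → i ≤ cnt → ∃ m ≤ k, IsFirst LB Q m (vert i) ∧
    HasRow M len cell i (numbersUpTo num i (LB (Q m)))
  mono : ∀ i j, 1 ≤ i → i ≤ j → j ≤ cnt → ∀ m m', IsFirst LB Q m (vert i) →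
    IsFirst LB Q m' (vert j) → m ≤ m'
  len_zero : len 0 = 0

theorem IsFirst.eq {LB : ℕ → List ℕ} {Q : ℕ → ℕ} {k k' v : ℕ} (h : IsFirst LB Q k v)
    (h' : IsFirst LB Q k' v) : k = k' := by
  rcases lt_trichotomy k k' with hlt | heq | hlt
  · exact (h'.2 k hlt h.1).elim
  · exact heq
  · exact (h.2 k' hlt h'.1).elim

section PartialNumbering

variable {n M k cnt v N : ℕ} {LB : ℕ → List ℕ} {Q num vert len cell cell' : ℕ → ℕ}

theorem IsPartialNumbering.succ (h : IsPartialNumbering n M k cnt LB Q num vert len cell) :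
    IsPartialNumbering n M (k + 1) cnt LB Q num vert len cell :=
  ⟨h.toIsPartialEnum, fun i h1 hi =>
    have ⟨m, hm, hm'⟩ := h.first i h1 hi
    ⟨m, by omega, hm'⟩, h.mono, h.len_zero⟩

theorem IsPartialNumbering.push (h : IsPartialNumbering n M k cnt LB Q num vert len cell)
    (hlenM : ∀ t, (LB t).length ≤ M)
    (hv : v < n) (h0 : num v = 0) (hvk : v ∈ LB (Q k)) (hseen : ∀ m < k, ∀ w ∈ LB (Q m), num w ≠ 0)
    (hcell : ∀ x < (cnt + 1) * M, cell' x = cell x)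
    (hnew : ∀ j (hj : j < (numbersUpTo (Function.update num v (cnt + 1)) (cnt + 1)
      (LB (Q k))).length), cell' ((cnt + 1) * M + j) =
        (numbersUpTo (Function.update num v (cnt + 1)) (cnt + 1) (LB (Q k)))[j]) :
    IsPartialNumbering n M k (cnt + 1) LB Q (Function.update num v (cnt + 1))
      (Function.update vert (cnt + 1) v) (Function.update len (cnt + 1)
        (numbersUpTo (Function.update num v (cnt + 1)) (cnt + 1) (LB (Q k))).length) cell' := by
  have hvf : IsFirst LB Q k v := ⟨hvk, fun m hm hmem => hseen m hm v hmem h0⟩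
  have hvert : ∀ i ≤ cnt, Function.update vert (cnt + 1) v i = vert i := fun i hi => by
    rw [Function.update_of_ne (by omega)]
  refine ⟨h.toIsPartialEnum.push hv h0, fun i h1 hi => ?_, fun i j h1 hij hj m m' hm hm' => ?_, ?_⟩
  · rcases eq_or_ne i (cnt + 1) with rfl | hne
    · refine ⟨k, le_rfl, by simpa using hvf, by simp, hnew⟩
    · have hi' : i ≤ cnt := by omega
      obtain ⟨m, hm, hfm, hl, hc⟩ := h.first i h1 hi'
      have hcongr : numbersUpTo num i (LB (Q m)) =
          numbersUpTo (Function.update num v (cnt + 1)) i (LB (Q m)) := by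
        refine numbersUpTo_congr fun w _ => ?_
        by_cases hw : w = v
        · subst hw; right; simp; omega
        · left; rw [Function.update_of_ne hw]
      refine ⟨m, hm, by rwa [hvert i hi'], ?_, ?_⟩
      · rw [Function.update_of_ne hne, ← hcongr, hl]
      · intro j hj
        rw [← hcongr] at hj
        have hjM := hj.trans_le ((length_numbersUpTo_le _ _ _).trans (hlenM _))
        rw [hcell, hc j hj]
        · congr 1
        · have : (i + 1) * M ≤ (cnt + 1) * M := Nat.mul_le_mul_right _ (by omega)
          rw [Nat.add_mul] at this
          omega
  · rcases eq_or_ne j (cnt + 1) with rfl | hne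
    · rw [Function.update_self] at hm'
      rw [hm'.eq hvf]
      rcases eq_or_ne i (cnt + 1) with rfl | hne
      · rw [Function.update_self] at hm
        rw [hm.eq hvf]
      · rw [hvert i (by omega)] at hm
        obtain ⟨m₁, hm₁, hf, -⟩ := h.first i h1 (by omega)
        rw [hm.eq hf]
        exact hm₁
    · rw [hvert i (by omega)] at hm
      rw [hvert j (by omega)] at hm'
      exact h.mono i j h1 hij (by omega) m m' hm hm'
  · rw [Function.update_of_ne (by omega), h.len_zero]

/-- When all bags have been processed, the result is a reversed elimination order. -/
theorem IsPartialNumbering.exists_numbering {G : SimpleGraph (Fin n)} {T : SimpleGraph (Fin N)}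
    {bag : Fin N → Finset (Fin n)} {LT adj : ℕ → List ℕ}
    (h : IsPartialNumbering n M k cnt LB Q num vert len cell)
    (hlenM : ∀ t, (LB t).length ≤ M)
    (hTD : IsTreeDecomposition G T bag)
    (hadj : ∀ v : Fin n, Lists (adj v) (G.neighborSet v))
    (hLT : ∀ t : Fin N, Lists (LT t) (T.neighborSet t))
    (hLB : ∀ t : Fin N, Lists (LB t) (bag t : Set (Fin n)))
    (hQ : ∀ j < N, Q j < N) (hinj : ∀ i < N, ∀ j < N, Q i = Q j → i = j)
    (hpar : ∀ j, 0 < j → j < N → ∃ m < j, Q j ∈ LT (Q m))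
    (hseen : ∀ m < N, ∀ w ∈ LB (Q m), num w ≠ 0) :
    ∃ B : ℕ → List ℕ, Numbering n M adj num vert B ∧ ∀ i ≤ n, HasRow M len cell i (B i) := by
  let q : Fin N → Fin N := fun i => ⟨Q i, hQ i i.2⟩
  have hq : Function.Bijective q := Finite.injective_iff_bijective.1 fun i j hij => by
    ext; exact hinj i i.2 j j.2 (congrArg Fin.val hij)
  have hqadj : ∀ k : Fin N, 0 < k.val → ∃ m < k, T.Adj (q m) (q k) := fun k hk => by
    obtain ⟨m, hm, hmem⟩ := hpar k hk k.2
    have hmN : m < N := hm.trans k.2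
    obtain ⟨u, hu, huQ⟩ := ((hLT (q ⟨m, hmN⟩)).2 _).1 hmem
    refine ⟨⟨m, hmN⟩, hm, ?_⟩
    have : u = q k := Fin.ext huQ
    rwa [← this]
  have hmemB : ∀ (t : Fin N) (v : Fin n), v.val ∈ LB t ↔ v ∈ bag t := fun t v => by
    rw [(hLB t).2]
    constructor
    · rintro ⟨w, hw, he⟩
      rwa [← Fin.ext he]
    · exact fun hv => ⟨v, hv, rfl⟩
  have hne : ∀ v < n, num v ≠ 0 := fun v hv => by
    obtain ⟨t, ht⟩ := hTD.vertex_mem ⟨v, hv⟩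
    obtain ⟨j, rfl⟩ := hq.2 t
    exact hseen j j.2 v ((hmemB (q j) ⟨v, hv⟩).2 ht)
  obtain rfl : cnt = n := h.toIsPartialEnum.eq_of_ne_zero hne
  have hrow : ∀ i, ∃ L, (1 ≤ i → i ≤ cnt → ∃ m < N, IsFirst LB Q m (vert i) ∧
      L = numbersUpTo num i (LB (Q m)) ∧ HasRow M len cell i L) ∧
      (¬ (1 ≤ i ∧ i ≤ cnt) → L = []) := fun i => by
    by_cases hi : 1 ≤ i ∧ i ≤ cnt
    · obtain ⟨m, -, hf, hr⟩ := h.first i hi.1 hi.2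
      have hmN : m < N := by
        obtain ⟨t, ht⟩ := hTD.vertex_mem ⟨vert i, h.vert_lt i hi.1 hi.2⟩
        obtain ⟨j, rfl⟩ := hq.2 t
        by_contra hlt
        exact hf.2 j (by omega) ((hmemB (q j) ⟨vert i, h.vert_lt i hi.1 hi.2⟩).2 ht)
      exact ⟨_, fun _ _ => ⟨m, hmN, hf, rfl, hr⟩, fun h => (h hi).elim⟩
    · exact ⟨[], fun h1 h2 => (hi ⟨h1, h2⟩).elim, fun _ => rfl⟩
  choose B hB hB0 using hrow
  have hBmem : ∀ i, ∀ u ∈ B i, 1 ≤ i ∧ i ≤ cnt := fun i u hu => by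
    by_contra hi
    rw [hB0 i hi] at hu
    cases hu
  -- Vertices with a common bag are related as claimed.
  have key : ∀ (t : Fin N) (x y : Fin cnt), x ∈ bag t → y ∈ bag t → num x ≤ num y →
      num x ∈ B (num y) := by
    intro t x y hx hy hxy
    have hx1 := hne x x.2
    have hy1 := hne y y.2
    have hyn := h.num_le y y.2
    obtain ⟨m, hm, hf, hBe, -⟩ := hB (num y) (by omega) hyn
    obtain ⟨m', hm', hf', -⟩ := hB (num x) (by omega) (by omega)
    have hmm := h.mono _ _ (by omega) hxy hyn m' m hf' hf
    rw [h.vert_num y y.2 hy1] at hf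
    rw [h.vert_num x x.2 hx1] at hf'
    rw [hBe, mem_numbersUpTo]
    refine ⟨⟨x, (hmemB (q ⟨m, hm⟩) x).2 ?_, rfl⟩, by omega, hxy⟩
    exact mem_first_bag hTD hq hqadj (v := y) (w := x) (k := ⟨m, hm⟩) (m := ⟨m', hm'⟩)
      ((hmemB (q ⟨m, hm⟩) y).1 hf.1)
      (fun j hj hmem => hf.2 j hj ((hmemB (q j) y).2 hmem))
      ((hmemB (q ⟨m', hm'⟩) x).1 hf'.1) hmm hy hx
  have hltn : ∀ m < N, ∀ w ∈ LB (Q m), w < cnt := fun m hm w hw => (hLB (q ⟨m, hm⟩)).lt hw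
  refine ⟨B, ⟨?_, ?_, h.vert_lt, h.num_vert, ?_, ?_, ?_, ?_, ?_, ?_⟩, ?_⟩
  · intro v hv
    have := hne v hv
    exact ⟨by omega, h.num_le v hv⟩
  · exact fun v hv => h.vert_num v hv (hne v hv)
  · intro i h1 hi
    obtain ⟨m, hm, hf, hBe, -⟩ := hB i h1 hi
    rw [hBe, mem_numbersUpTo]
    exact ⟨⟨_, hf.1, h.num_vert i h1 hi⟩, h1, le_rfl⟩
  · intro i
    by_cases hi : 1 ≤ i ∧ i ≤ cnt
    · obtain ⟨m, hm, hf, hBe, -⟩ := hB i hi.1 hi.2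
      rw [hBe]
      refine List.Nodup.filter _ (List.Nodup.map_on ?_ (hLB (q ⟨m, hm⟩)).1)
      intro x hx y hy hxy
      have hx := hltn m hm x hx
      have hy := hltn m hm y hy
      rw [← h.vert_num x hx (hne x hx), hxy, h.vert_num y hy (hne y hy)]
    · rw [hB0 i hi]; exact List.nodup_nil
  · intro i
    by_cases hi : 1 ≤ i ∧ i ≤ cnt
    · obtain ⟨m, hm, hf, hBe, -⟩ := hB i hi.1 hi.2
      rw [hBe]
      exact (length_numbersUpTo_le _ _ _).trans (hlenM _)
    · rw [hB0 i hi]; simp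
  · intro i u hu
    obtain ⟨h1, hi⟩ := hBmem i u hu
    obtain ⟨m, hm, hf, hBe, -⟩ := hB i h1 hi
    rw [hBe, mem_numbersUpTo] at hu
    exact hu.2
  · intro v hv w hw hlt
    obtain ⟨w, hvw, rfl⟩ := ((hadj ⟨v, hv⟩).2 w).1 hw
    obtain ⟨t, h1, h2⟩ := hTD.edge_mem _ _ hvw
    exact key t w ⟨v, hv⟩ h2 h1 hlt.le
  · intro i u hu p hp hup hpi
    obtain ⟨h1, hi⟩ := hBmem i u hu
    obtain ⟨m, hm, hf, hBe, -⟩ := hB i h1 hi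
    rw [hBe, mem_numbersUpTo] at hu hp
    obtain ⟨⟨x, hx, rfl⟩, hu⟩ := hu
    obtain ⟨⟨y, hy, rfl⟩, hp⟩ := hp
    exact key (q ⟨m, hm⟩) ⟨x, hltn m hm x hx⟩ ⟨y, hltn m hm y hy⟩
      ((hmemB (q ⟨m, hm⟩) ⟨x, hltn m hm x hx⟩).1 hx)
      ((hmemB (q ⟨m, hm⟩) ⟨y, hltn m hm y hy⟩).1 hy) hup.le
  · intro i hi
    rcases Nat.eq_zero_or_pos i with rfl | h1
    · rw [hB0 0 (by omega)]
      exact ⟨h.len_zero, fun j hj => absurd hj (by simp)⟩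
    · obtain ⟨m, hm, hf, hBe, hr⟩ := hB i h1 hi
      exact hr

end PartialNumbering

/-- Stores the numbers of the vertices in the current bag (between the positions in the registers
`14` and `15`) in the row of array `13` that belongs to the number in register `18`, and the length
of this row in array `14`. -/
def progCollect : Program :=
  .assign 19 0 ⨟
    .forUp 20 (.reg 14) 15
      (.assign 21 (.cell 11 (.cell 7 (.reg 20))) ⨟
        .branch (.reg 21)
          (.store 13 (.reg 18 * .reg 6 + .reg 19) (.reg 21) ⨟ .assign 19 (.reg 19 + 1)) .skip) ⨟
    .store 14 (.reg 18) (.reg 19)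

/-- Gives the next number to the vertex in register `17`, unless it already has one. -/
def progEnter : Program :=
  .assign 17 (.cell 7 (.reg 16)) ⨟
    .branch (.cell 11 (.reg 17)) .skip
      (.assign 18 (.reg 18 + 1) ⨟ .store 11 (.reg 17) (.reg 18) ⨟ .store 12 (.reg 18) (.reg 17) ⨟
        progCollect)

/-- Numbers the vertices in the order in which they occur in the bags, where the bags are taken in
the order of array `10`. The number of a vertex goes to array `11`, the inverse to array `12`. -/
def progNumber : Program :=
  .assign 18 0 ⨟
    .forUp 11 0 2
      (.assign 13 (.cell 10 (.reg 11)) ⨟ .assign 14 (.cell 6 (.reg 13)) ⨟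
        .assign 15 (.cell 6 (.reg 13 + 1)) ⨟ .forUp 16 (.reg 14) 15 progEnter)

section Exec

variable {W n N M : ℕ} {LB : ℕ → List ℕ}

theorem numbersUpTo_take_succ {num : ℕ → ℕ} {i e : ℕ} {L : List ℕ} (he : e < L.length) :
    numbersUpTo num i (L.take (e + 1)) = numbersUpTo num i (L.take e) ++
      if 1 ≤ num L[e] ∧ num L[e] ≤ i then [num L[e]] else [] := by
  rw [← List.take_append_getElem he, numbersUpTo, List.map_append, List.filter_append]
  congr 1
  rw [List.map_singleton, List.filter_singleton]
  simp

theorem exec_progCollect {s : State} {t i : ℕ} (hW : 1 < W) (ht : t < N)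
    (hB : Stored (s.arr 6) (s.arr 7) LB N) (hoff : ∀ t ≤ N, s.arr 6 t < W)
    (hlt : ∀ v ∈ LB t, v < W ∧ s.arr 11 v ≤ i) (hlenM : (LB t).length ≤ M)
    (hM : i * M + M < W) (hi : i < W) (hM' : M + 1 < W) (h6 : s.reg 6 = M)
    (h14 : s.reg 14 = s.arr 6 t)
    (h15 : s.reg 15 = s.arr 6 (t + 1)) (h18 : s.reg 18 = i) :
    Exec W progCollect s (M * 27 + 11) fun s' =>
      (∀ x < i * M, s'.arr 13 x = s.arr 13 x) ∧
      (∀ j (hj : j < (numbersUpTo (s.arr 11) i (LB t)).length),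
        s'.arr 13 (i * M + j) = (numbersUpTo (s.arr 11) i (LB t))[j]) ∧
      s'.arr 14 = Function.update (s.arr 14) i (numbersUpTo (s.arr 11) i (LB t)).length := by
  have hsucc := hB.off_succ t ht
  have hoff1 := hoff (t + 1) (by omega)
  have hoff0 := hoff t (by omega)
  set num := s.arr 11 with hnum
  have hlenle : ∀ e, (numbersUpTo num i ((LB t).take e)).length ≤ M := fun e =>
    (length_numbersUpTo_le _ _ _).trans ((List.length_take_le' _ _).trans hlenM)
  refine Exec.le (Exec.seq (Exec.of_vc (p := .assign 19 0) ⟨by simp; omega, ?_⟩))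
    (?_ : 2 + (((LB t).length * 27 + 6) + 3) ≤ _)
  swap
  · nlinarith
  refine Exec.seq (Exec.le (Exec.forUp (fun e s' => (∀ x < i * M, s'.arr 13 x = s.arr 13 x) ∧
      s'.reg 19 = (numbersUpTo num i ((LB t).take e)).length ∧
      (∀ j (hj : j < (numbersUpTo num i ((LB t).take e)).length),
        s'.arr 13 (i * M + j) = (numbersUpTo num i ((LB t).take e))[j]))
      (s.arr 6 t) (LB t).length 19 ?_ ?_ ?_ (by decide) rfl rfl (by omega) hW ?_ ?_ ?_)
    (by simp [Expr.cost]; omega))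
  · simp [h14]; omega
  · simp [h14]
  · simp [h15, hsucc]
  · refine ⟨by simp, by simp [numbersUpTo], fun j hj => absurd hj (by simp [numbersUpTo])⟩
  · rintro e s' he hx hk ⟨h1, h2, h3⟩
    have h7 : s'.arr 7 = s.arr 7 := (hk.arr 7).trans rfl
    have h11 : s'.arr 11 = num := (hk.arr 11).trans rfl
    have h6' : s'.reg 6 = M := (hk.reg 6).trans (by simp [h6])
    have h18' : s'.reg 18 = i := (hk.reg 18).trans (by simp [h18])
    have hcell := hB.flat_eq t ht e he
    obtain ⟨hvW, hvi⟩ := hlt _ (List.getElem_mem he)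
    have hl1 := hlenle e
    have hl2 := hlenle (e + 1)
    have hstep := numbersUpTo_take_succ (num := num) (i := i) he
    set L := numbersUpTo num i ((LB t).take e) with hL
    set v := (LB t)[e] with hv
    by_cases hnv : num v = 0
    · rw [if_neg (by omega), List.append_nil] at hstep
      simp only [hstep]
      refine Exec.le (Exec.of_vc ?_) (by decide)
      simp [Program.vc, hx, h7, hcell, h11, hnv, h2]
      exact ⟨by omega, by omega, h1, h3⟩
    · rw [if_pos ⟨by omega, hvi⟩] at hstep
      simp only [hstep, List.length_append, List.length_singleton] at hl2 ⊢
      refine Exec.le (Exec.of_vc ?_) (by decide)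
      simp [Program.vc, hx, h7, hcell, h11, hnv, h2, h6', h18']
      refine ⟨by omega, by omega, by omega, by omega, by omega, ?_, ?_⟩
      · intro x hx
        rw [Function.update_of_ne (by omega)]
        exact h1 x hx
      · intro j hj
        rcases Nat.lt_or_eq_of_le hj with hj | rfl
        · rw [Function.update_of_ne (by omega), List.getElem_append_left hj]
          exact h3 j hj
        · simp
  · rintro s' hx hk ⟨h1, h2, h3⟩
    have h14' : s'.arr 14 = s.arr 14 := (hk.arr 14).trans rfl
    have h18' : s'.reg 18 = i := (hk.reg 18).trans (by simp [h18])
    have hl := hlenle (LB t).length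
    rw [List.take_length] at h2 hl
    refine Exec.of_vc ?_
    simp only [List.take_length] at h3
    simp [Program.vc, h18', h2, h14']
    exact ⟨by omega, by omega, h1, h3⟩

theorem exec_progEnter {s : State} {k cnt t : ℕ} {Q : ℕ → ℕ} {e : ℕ} (hW : 1 < W) (ht : t < N)
    (hB : Stored (s.arr 6) (s.arr 7) LB N) (hoff : ∀ t ≤ N, s.arr 6 t < W)
    (hlt : ∀ t < N, ∀ v ∈ LB t, v < n) (hlenM : ∀ t, (LB t).length ≤ M)
    (hn : n + 1 < W) (hM : n * M + M < W) (hM' : M + 1 < W)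
    (h6 : s.reg 6 = M) (h14 : s.reg 14 = s.arr 6 t) (h15 : s.reg 15 = s.arr 6 (t + 1))
    (h16 : s.reg 16 = s.arr 6 t + e) (he : e < (LB t).length) (h18 : s.reg 18 = cnt)
    (hQ : Q k = t) (hs : IsPartialNumbering n M k cnt LB Q (s.arr 11) (s.arr 12) (s.arr 14)
      (s.arr 13)) (hseen : ∀ m < k, ∀ w ∈ LB (Q m), s.arr 11 w ≠ 0) :
    Exec W progEnter s (M * 27 + 30) fun s' => ∃ cnt', s'.reg 18 = cnt' ∧
      IsPartialNumbering n M k cnt' LB Q (s'.arr 11) (s'.arr 12) (s'.arr 14) (s'.arr 13) ∧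
      s'.arr 11 (LB t)[e] ≠ 0 ∧ ∀ w, s.arr 11 w ≠ 0 → s'.arr 11 w ≠ 0 := by
  have hcell := hB.flat_eq t ht e he
  have hsucc := hB.off_succ t ht
  have hoff1 := hoff (t + 1) (by omega)
  have hoff0 := hoff t (by omega)
  set v := (LB t)[e] with hv
  have hvn : v < n := hlt t ht v (List.getElem_mem he)
  have hcn := hs.toIsPartialEnum.le
  have hnumv := hs.num_le v hvn
  refine Exec.le (Exec.seq (k := 3) (Exec.of_vc (p := .assign 17 (.cell 7 (.reg 16)))
    ⟨by simp [h16, hcell]; omega, ?_⟩)) (?_ : 3 + (3 + ((4 + (3 + (3 + (M * 27 + 11))))) ) ≤ _)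
  swap
  · omega
  simp only [Expr.eval_cell, Expr.eval_reg, h16, hcell]
  refine Exec.branch (by simp; omega) ?_ ?_
  · intro hne
    simp at hne
    refine Exec.le (Exec.of_vc (p := .skip) ?_) (by simp [Program.bound]; omega)
    exact ⟨cnt, by simpa using h18, by simpa using hs, by simpa using hne, fun w hw => by simpa using hw⟩
  · intro h0
    simp at h0
    have hpush := hs.toIsPartialEnum.push hvn h0
    have hple := hpush.le
    have hnle : (cnt + 1) * M ≤ n * M := Nat.mul_le_mul_right _ hple
    refine Exec.seq (Exec.of_vc ⟨by simp [h18]; omega, Exec.seq (Exec.of_vc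
      ⟨by simp; omega, by simp [h18]; omega, Exec.seq (Exec.of_vc ⟨by simp [h18]; omega,
        by simp; omega, ?_⟩)⟩)⟩)
    set s₁ : State := _
    change Exec W _ s₁ _ _
    have e11 : s₁.arr 11 = Function.update (s.arr 11) v (cnt + 1) := by simp [s₁, h18]
    have e12 : s₁.arr 12 = Function.update (s.arr 12) (cnt + 1) v := by simp [s₁, h18]
    have e13 : s₁.arr 13 = s.arr 13 := by simp [s₁]
    have e14 : s₁.arr 14 = s.arr 14 := by simp [s₁]
    have e6 : s₁.arr 6 = s.arr 6 := by simp [s₁]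
    have e7 : s₁.arr 7 = s.arr 7 := by simp [s₁]
    refine (Exec.frame (exec_progCollect (s := s₁) (LB := LB) (N := N) (M := M) (t := t)
      (i := cnt + 1) hW ht (by rwa [e6, e7]) (by rwa [e6]) ?_ (hlenM t) (by omega) (by omega) hM'
      (by simp [s₁, h6]) (by simp [s₁, h14]) (by simp [s₁, h15]) (by simp [s₁, h18]))).mono
      le_rfl ?_
    · intro w hw
      have hwn := hlt t ht w hw
      refine ⟨by omega, ?_⟩
      rw [e11]
      exact hpush.num_le w hwn
    · rintro s' ⟨hk, h1, h2, h3⟩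
      have f11 : s'.arr 11 = _ := (hk.arr 11).trans e11
      have f12 : s'.arr 12 = _ := (hk.arr 12).trans e12
      rw [e11] at h2 h3
      refine ⟨cnt + 1, (hk.reg 18).trans (by simp [s₁, h18]), ?_, ?_, ?_⟩
      · rw [f11, f12, h3, e14]
        subst hQ
        refine hs.push hlenM hvn h0 (List.getElem_mem he) hseen ?_ h2
        intro x hx
        rw [h1 x hx, e13]
      · rw [f11]; simp
      · intro w hw
        rw [f11, Function.update_apply]
        split
        · omega
        · exact hw

theorem exec_progNumber {s : State} {G : SimpleGraph (Fin n)} {T : SimpleGraph (Fin N)}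
    {bag : Fin N → Finset (Fin n)} {LT adj : ℕ → List ℕ}
    (hTD : IsTreeDecomposition G T bag)
    (hadj : ∀ v : Fin n, Lists (adj v) (G.neighborSet v))
    (hLT : ∀ t : Fin N, Lists (LT t) (T.neighborSet t))
    (hLB : ∀ t : Fin N, Lists (LB t) (bag t : Set (Fin n)))
    (hlenM : ∀ t, (LB t).length ≤ M)
    (hB : Stored (s.arr 6) (s.arr 7) LB N) (hoff : ∀ t ≤ N, s.arr 6 t < W)
    (hN : N + 1 < W) (hn : n + 1 < W) (hM : n * M + M < W) (hM' : M + 1 < W)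
    (h2 : s.reg 2 = N) (h6 : s.reg 6 = M)
    (hQ : ∀ j < N, s.arr 10 j < N)
    (hinj : ∀ i < N, ∀ j < N, s.arr 10 i = s.arr 10 j → i = j)
    (hpar : ∀ j, 0 < j → j < N → ∃ m < j, s.arr 10 j ∈ LT (s.arr 10 m))
    (h11 : ∀ v, s.arr 11 v = 0) (h14 : s.arr 14 0 = 0) :
    Exec W progNumber s (N * (M * (M * 27 + 38) + 25) + 8) fun s' =>
      ∃ B, Numbering n M adj (s'.arr 11) (s'.arr 12) B ∧
        ∀ i ≤ n, HasRow M (s'.arr 14) (s'.arr 13) i (B i) := by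
  have hlt : ∀ t < N, ∀ v ∈ LB t, v < n := fun t ht v hv => (hLB ⟨t, ht⟩).lt hv
  refine Exec.le (Exec.seq (Exec.of_vc (p := .assign 18 0) ⟨by simp; omega, ?_⟩))
    (?_ : 2 + (N * (M * (M * 27 + 38) + 25) + 6) ≤ _)
  swap
  · omega
  refine Exec.le (Exec.forUp (fun k s' => ∃ cnt, s'.reg 18 = cnt ∧
      IsPartialNumbering n M k cnt LB (s.arr 10) (s'.arr 11) (s'.arr 12) (s'.arr 14) (s'.arr 13) ∧
      ∀ m < k, ∀ w ∈ LB (s.arr 10 m), s'.arr 11 w ≠ 0) 0 N (M * (M * 27 + 38) + 17)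
      (by simp; omega) rfl (by simp [h2]) (by decide) rfl rfl (by omega) (by omega) ?_ ?_ ?_)
      (by simp [Expr.cost, add_assoc]; omega)
  · refine ⟨0, by simp, ⟨⟨?_, ?_, ?_, ?_⟩, ?_, ?_, ?_⟩, ?_⟩
    · simp [h11]
    · simp [h11]
    · intro i h1 h0; omega
    · intro i h1 h0; omega
    · intro i h1 h0; omega
    · intro i j h1 hij h0; omega
    · simp [h14]
    · intro m hm; omega
  · rintro k s' hkN hx hk ⟨cnt, h18, hs, hseen⟩
    have a6 : s'.arr 6 = s.arr 6 := (hk.arr 6).trans rfl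
    have a7 : s'.arr 7 = s.arr 7 := (hk.arr 7).trans rfl
    have a10 : s'.arr 10 = s.arr 10 := (hk.arr 10).trans rfl
    have r6 : s'.reg 6 = M := (hk.reg 6).trans (by simp [h6])
    rw [zero_add] at hx
    set t := s.arr 10 k with ht
    have htN : t < N := hQ k hkN
    have hsucc := hB.off_succ t htN
    have hoff1 := hoff (t + 1) (by omega)
    have hoff0 := hoff t (by omega)
    refine Exec.le (Exec.seq (Exec.of_vc ⟨by simp [hx, a10]; omega, Exec.seq (Exec.of_vc
      ⟨by simp [hx, a10, a6, ← ht]; omega, Exec.seq (Exec.of_vc ⟨by simp [hx, a10, a6, ← ht]; omega, ?_⟩)⟩)⟩))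
      (?_ : 3 + (3 + (5 + (M * (M * 27 + 38) + 6))) ≤ _)
    swap
    · omega
    simp only [Expr.eval_cell, Expr.eval_reg, hx, a10, Expr.eval_add, State.set_reg, if_true,
      Expr.eval_ofNat, State.set_arr, a6, ← ht, Nat.reduceEqDiff, if_false]
    set s₁ : State := _
    change Exec W _ s₁ _ _
    have b13 : s₁.arr = s'.arr := by simp [s₁]
    have b14 : s₁.reg 14 = s.arr 6 t := by simp [s₁]
    have b15 : s₁.reg 15 = s.arr 6 (t + 1) := by simp [s₁]
    refine Exec.le (Exec.forUp (fun e s' => ∃ cnt, s'.reg 18 = cnt ∧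
      IsPartialNumbering n M k cnt LB (s.arr 10) (s'.arr 11) (s'.arr 12) (s'.arr 14) (s'.arr 13) ∧
      (∀ m < k, ∀ w ∈ LB (s.arr 10 m), s'.arr 11 w ≠ 0) ∧
      ∀ w ∈ (LB t).take e, s'.arr 11 w ≠ 0) (s.arr 6 t) (LB t).length (M * 27 + 30)
      ?_ ?_ ?_ (by decide) rfl rfl (by omega) (by omega) ?_ ?_ ?_) ?_
    · simp [b14]; omega
    · simp [b14]
    · rw [b15, hsucc]
    · exact ⟨cnt, by simpa [s₁] using h18, by simpa [b13] using hs, by simpa [b13] using hseen,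
        by simp⟩
    · rintro e s₂ he hx₂ hk₂ ⟨cnt₂, i18, is, iseen, itake⟩
      have c6 : s₂.arr 6 = s.arr 6 := (hk₂.arr 6).trans (by rw [b13, a6])
      have c7 : s₂.arr 7 = s.arr 7 := (hk₂.arr 7).trans (by rw [b13, a7])
      refine (exec_progEnter (s := s₂) (n := n) (k := k) (t := t) (e := e) (cnt := cnt₂)
        (Q := s.arr 10) (LB := LB) (N := N) (M := M) (by omega) htN (by rwa [c6, c7])
        (by rwa [c6]) hlt hlenM hn hM hM' ((hk₂.reg 6).trans (by simp [s₁, r6]))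
        ((hk₂.reg 14).trans (by rw [b14, c6])) ((hk₂.reg 15).trans (by rw [b15, c6]))
        (by rw [hx₂, c6]) he i18 rfl is iseen).mono le_rfl ?_
      rintro s₃ ⟨cnt₃, j18, js, jv, jw⟩
      refine ⟨cnt₃, by simpa using j18, by simpa using js, ?_, ?_⟩
      · exact fun m hm w hw => jw w (iseen m hm w hw)
      · intro w hw
        rcases (mem_take_succ he).1 hw with hw | rfl
        · exact jw w (itake w hw)
        · exact jv
    · rintro s₂ hx₂ hk₂ ⟨cnt₂, i18, is, iseen, itake⟩
      refine ⟨cnt₂, by simpa using i18, by simpa using is.succ, ?_⟩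
      intro m hm w hw
      rcases Nat.lt_succ_iff_lt_or_eq.1 hm with hm | rfl
      · exact iseen m hm w hw
      · exact itake w (by rwa [List.take_length])
    · have := Nat.mul_le_mul_right (M * 27 + 38) (hlenM t)
      simp [Expr.cost, add_assoc]
      omega
  · rintro s' hx hk ⟨cnt, h18, hs, hseen⟩
    exact hs.exists_numbering hlenM hTD hadj hLT hLB hQ hinj hpar hseen

end Exec

/-! ### Colourings coded as numbers in base three -/

/-- The colouring with code `x`: the digits of `x` in base `3`, beginning with the last one, are
the colours of the members of `L`. -/
def colorsOf (L : List ℕ) (x u : ℕ) : ℕ := x / 3 ^ L.idxOf u % 3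

/-- The code of the colouring `c` of the members of `L`. -/
def codeOf (c : ℕ → ℕ) : List ℕ → ℕ
  | [] => 0
  | u :: L => c u + 3 * codeOf c L

theorem colorsOf_lt (L : List ℕ) (x u : ℕ) : colorsOf L x u < 3 := Nat.mod_lt _ (by omega)

theorem codeOf_lt {c : ℕ → ℕ} {L : List ℕ} (hc : ∀ u ∈ L, c u < 3) : codeOf c L < 3 ^ L.length := by
  induction L with
  | nil => simp [codeOf]
  | cons u L ih =>
    have h1 := ih fun w hw => hc w (List.mem_cons_of_mem _ hw)
    have h2 := hc u List.mem_cons_self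
    rw [codeOf, List.length_cons, pow_succ]
    omega

theorem codeOf_append (c : ℕ → ℕ) (L : List ℕ) (u : ℕ) :
    codeOf c (L ++ [u]) = codeOf c L + c u * 3 ^ L.length := by
  induction L with
  | nil => simp [codeOf]
  | cons w L ih => rw [List.cons_append, codeOf, ih, codeOf, List.length_cons, pow_succ]; ring

theorem colorsOf_codeOf {c : ℕ → ℕ} {L : List ℕ} (hc : ∀ u ∈ L, c u < 3) {u : ℕ} (hu : u ∈ L) :
    colorsOf L (codeOf c L) u = c u := by
  induction L with
  | nil => cases hu
  | cons w L ih =>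
    have hw := hc w List.mem_cons_self
    unfold colorsOf at ih ⊢
    by_cases huw : u = w
    · subst huw
      rw [List.idxOf_cons_self, codeOf, pow_zero, Nat.div_one]
      omega
    · have huL : u ∈ L := (List.mem_cons.1 hu).resolve_left huw
      rw [List.idxOf_cons_ne _ (Ne.symm huw), codeOf, Nat.pow_succ', ← Nat.div_div_eq_div_mul,
        show (c w + 3 * codeOf c L) / 3 = codeOf c L by omega]
      exact ih (fun w hw => hc w (List.mem_cons_of_mem _ hw)) huL

/-- Sets the colours (in array `16`) of the members of row `i` (register `22`) according to the code
in register `23`. -/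
def progDecode : Program :=
  .assign 24 (.cell 14 (.reg 22)) ⨟ .assign 25 (.reg 23) ⨟
    .forUp 26 0 24
      (.store 16 (.cell 13 (.reg 22 * .reg 6 + .reg 26)) (.reg 25 % 3) ⨟
        .assign 25 (.reg 25 / 3))

/-- Computes in register `25` the code of the colours of the members of row `i`
(register `33`). -/
def progEncode : Program :=
  .assign 24 (.cell 14 (.reg 33)) ⨟ .assign 25 0 ⨟ .assign 27 1 ⨟
    .forUp 26 0 24
      (.assign 25 (.reg 25 + .cell 16 (.cell 13 (.reg 33 * .reg 6 + .reg 26)) * .reg 27) ⨟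
        .assign 27 (.reg 27 * 3))

section Exec

variable {W M : ℕ} {L : List ℕ} {i : ℕ}

theorem exec_progDecode {s : State} {x : ℕ} (hW : 3 < W) (hL : HasRow M (s.arr 14) (s.arr 13) i L)
    (hnd : L.Nodup) (hlen : L.length ≤ M) (hlt : ∀ u ∈ L, u < W) (hM : i * M + M < W) (hi : i < W)
    (hx : x < W) (h6 : s.reg 6 = M) (h22 : s.reg 22 = i) (h23 : s.reg 23 = x) :
    Exec W progDecode s (M * 22 + 11) fun s' => ∀ u ∈ L, s'.arr 16 u = colorsOf L x u := by
  obtain ⟨hl, hc⟩ := hL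
  refine Exec.le (Exec.seq (Exec.of_vc ⟨by simp [h22, hl]; omega, Exec.seq (Exec.of_vc
    ⟨by simp [h23, hx], ?_⟩)⟩)) (?_ : 3 + (2 + (L.length * 22 + 6)) ≤ _)
  swap
  · omega
  simp only [Expr.eval_cell, Expr.eval_reg, h22, hl, State.set_reg, h23, Nat.reduceEqDiff, if_false]
  refine Exec.le (Exec.forUp (fun j s' => s'.reg 25 = x / 3 ^ j ∧
    ∀ k (hk : k < L.length), k < j → s'.arr 16 L[k] = x / 3 ^ k % 3) 0 L.length 14 (by simp; omega)
    rfl (by simp) (by decide) rfl rfl (by omega) (by omega) ?_ ?_ ?_) (by simp [Expr.cost]; omega)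
  · exact ⟨by simp, by simp⟩
  · rintro j s' hj hx' hk ⟨h25, hcol⟩
    have h13 : s'.arr 13 = s.arr 13 := (hk.arr 13).trans rfl
    have h6' : s'.reg 6 = M := (hk.reg 6).trans (by simp [h6])
    have h22' : s'.reg 22 = i := (hk.reg 22).trans (by simp [h22])
    rw [zero_add] at hx'
    have hu := hlt _ (List.getElem_mem hj)
    have hcell := hc j hj
    have hdiv : x / 3 ^ j < W := (Nat.div_le_self _ _).trans_lt hx
    have hdiv' : x / 3 ^ j / 3 < W := (Nat.div_le_self _ _).trans_lt hdiv
    have hmod : x / 3 ^ j % 3 < 3 := Nat.mod_lt _ (by omega)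
    refine Exec.of_vc ?_
    simp [Program.vc, hx', h13, h6', h22', hcell, h25, pow_succ, Nat.div_div_eq_div_mul] at hdiv' ⊢
    refine ⟨by omega, by omega, by omega, fun k hk' hkj => ?_⟩
    rcases Nat.lt_or_eq_of_le hkj with hkj | rfl
    · rw [Function.update_of_ne]
      · exact hcol k hk' hkj
      · intro he
        have := (hnd.getElem_inj_iff (hi := hk') (hj := hj)).1 he
        omega
    · simp
  · rintro s' - - ⟨-, hcol⟩ u hu
    have hk := List.idxOf_lt_length_of_mem hu
    have := hcol _ hk hk
    rwa [List.getElem_idxOf] at this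

theorem exec_progEncode {s : State} {c : ℕ → ℕ} (hW : 3 < W)
    (hL : HasRow M (s.arr 14) (s.arr 13) i L)
    (hlen : L.length ≤ M) (hlt : ∀ u ∈ L, u < W) (hM : i * M + M < W) (hi : i < W)
    (hP : 3 ^ M < W) (hc : ∀ u ∈ L, s.arr 16 u = c u) (hc3 : ∀ u ∈ L, c u < 3)
    (h6 : s.reg 6 = M) (h33 : s.reg 33 = i) :
    Exec W progEncode s (M * 24 + 13) fun s' => s'.reg 25 = codeOf c L := by
  obtain ⟨hl, hcell⟩ := hL
  refine Exec.le (Exec.seq (Exec.of_vc ⟨by simp [h33, hl]; omega, Exec.seq (Exec.of_vc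
    ⟨by simp; omega, Exec.seq (Exec.of_vc ⟨by simp; omega, ?_⟩)⟩)⟩))
    (?_ : 3 + (2 + (2 + (L.length * 24 + 6))) ≤ _)
  swap
  · omega
  simp only [Expr.eval_cell, Expr.eval_reg, h33, hl]
  refine Exec.le (Exec.forUp (fun j s' => s'.reg 25 = codeOf c (L.take j) ∧ s'.reg 27 = 3 ^ j)
    0 L.length 16 (by simp; omega)
    rfl (by simp) (by decide) rfl rfl (by omega) (by omega) ?_ ?_ ?_) (by simp [Expr.cost]; omega)
  · exact ⟨by simp [codeOf], by simp⟩
  · rintro j s' hj hx' hk ⟨h25, h27⟩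
    have h13 : s'.arr 13 = s.arr 13 := (hk.arr 13).trans rfl
    have h16 : s'.arr 16 = s.arr 16 := (hk.arr 16).trans rfl
    have h6' : s'.reg 6 = M := (hk.reg 6).trans (by simp [h6])
    have h33' : s'.reg 33 = i := (hk.reg 33).trans (by simp [h33])
    rw [zero_add] at hx'
    have hmem := List.getElem_mem hj
    have hu := hlt _ hmem
    have hce := hcell j hj
    have hcu := hc _ hmem
    have hcu3 := hc3 _ hmem
    have hlen1 : (L.take j).length = j := by simp; omega
    have hstep : codeOf c (L.take (j + 1)) = codeOf c (L.take j) + c L[j] * 3 ^ j := by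
      rw [← List.take_append_getElem hj, codeOf_append, hlen1]
    have hle1 : codeOf c (L.take (j + 1)) < 3 ^ M := by
      refine (codeOf_lt fun u hu => hc3 u (List.mem_of_mem_take hu)).trans_le ?_
      exact Nat.pow_le_pow_right (by omega) ((List.length_take_le' _ _).trans hlen)
    have hpow : 3 ^ j * 3 ≤ 3 ^ M := by
      rw [← pow_succ]; exact Nat.pow_le_pow_right (by omega) (by omega)
    refine Exec.of_vc ?_
    rw [hstep] at hle1
    simp only [hstep]
    simp [Program.vc, hx', h13, h16, h6', h33', hce, h25, h27, hcu, pow_succ]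
    omega
  · rintro s' - - ⟨h25, -⟩
    rwa [List.take_length] at h25

end Exec

/-! ### The vertex that receives the costs of an eliminated vertex -/

/-- The largest member of the list that is smaller than `i`, or `0` if there is none. -/
def parentOf (i : ℕ) (L : List ℕ) : ℕ :=
  L.foldl (fun p w => if w < i ∧ p < w then w else p) 0

theorem parentOf_append (i : ℕ) (L : List ℕ) (w : ℕ) :
    parentOf i (L ++ [w]) = if w < i ∧ parentOf i L < w then w else parentOf i L := by
  unfold parentOf
  rw [List.foldl_append]
  rfl

theorem parentOf_spec (i : ℕ) (L : List ℕ) :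
    (parentOf i L = 0 ∨ parentOf i L ∈ L ∧ parentOf i L < i) ∧
      ∀ u ∈ L, u < i → u ≤ parentOf i L := by
  induction L using List.reverseRecOn with
  | nil => simp [parentOf]
  | append_singleton L w ih =>
    obtain ⟨h1, h2⟩ := ih
    rw [parentOf_append]
    split
    · rename_i hw
      refine ⟨Or.inr ⟨by simp, hw.1⟩, fun u hu hui => ?_⟩
      rcases List.mem_append.1 hu with hu | hu
      · exact (h2 u hu hui).trans hw.2.le
      · exact (List.mem_singleton.1 hu).le
    · rename_i hw
      refine ⟨h1.imp_right fun h => ⟨List.mem_append_left _ h.1, h.2⟩, fun u hu hui => ?_⟩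
      rcases List.mem_append.1 hu with hu | hu
      · exact h2 u hu hui
      · rw [List.mem_singleton.1 hu] at hui ⊢
        by_contra hlt
        exact hw ⟨hui, by omega⟩

theorem parentOf_lt {i : ℕ} (h1 : 1 ≤ i) (L : List ℕ) : parentOf i L < i := by
  rcases (parentOf_spec i L).1 with h0 | h0
  · omega
  · exact h0.2

section Parent

variable {n M : ℕ} {adj : ℕ → List ℕ} {num vert : ℕ → ℕ} {B : ℕ → List ℕ}

theorem Numbering.mem_parentOf (h : Numbering n M adj num vert B) {i : ℕ} (hi : i ≤ n) {u : ℕ}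
    (hu : u ∈ B i) (hui : u ≠ i) : u ∈ B (parentOf i (B i)) := by
  have hr := h.mem_range i u hu
  have hlt : u < i := by omega
  obtain ⟨h1, h2⟩ := parentOf_spec i (B i)
  have hle := h2 u hu hlt
  rcases h1 with h0 | ⟨hmem, hpi⟩
  · omega
  · rcases hle.lt_or_eq with hlt' | heq
    · exact h.mem_of_mem i u hu _ hmem hlt' hpi
    · rw [← heq]
      exact h.mem_self u hr.1 (by omega)

end Parent

/-- Computes in register `22` the vertex that receives the costs of the vertex in
register `33`. -/
def progParent : Program :=
  .assign 22 0 ⨟ .assign 24 (.cell 14 (.reg 33)) ⨟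
    .forUp 26 0 24
      (.assign 43 (.cell 13 (.reg 33 * .reg 6 + .reg 26)) ⨟
        .branch (.lt (.reg 43) (.reg 33) * .lt (.reg 22) (.reg 43)) (.assign 22 (.reg 43)) .skip)

theorem exec_progParent {W M i : ℕ} {L : List ℕ} {s : State} (hW : 3 < W)
    (hL : HasRow M (s.arr 14) (s.arr 13) i L)
    (hlen : L.length ≤ M) (hlt : ∀ u ∈ L, u < W) (hM : i * M + M < W) (hi : i < W)
    (h6 : s.reg 6 = M) (h33 : s.reg 33 = i) :
    Exec W progParent s (M * 26 + 11) fun s' => s'.reg 22 = parentOf i L := by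
  obtain ⟨hl, hcell⟩ := hL
  refine Exec.le (Exec.seq (Exec.of_vc ⟨by simp; omega, Exec.seq (Exec.of_vc
    ⟨by simp [h33, hl]; omega, ?_⟩)⟩)) (?_ : 2 + (3 + (L.length * 26 + 6)) ≤ _)
  swap
  · omega
  simp only [Expr.eval_cell, Expr.eval_reg, h33, hl, State.set_reg, Nat.reduceEqDiff, if_false,
    State.set_arr]
  refine Exec.le (Exec.forUp (fun j s' => s'.reg 22 = parentOf i (L.take j))
    0 L.length 18 (by simp; omega)
    rfl (by simp) (by decide) rfl rfl (by omega) (by omega) ?_ ?_ ?_) (by simp [Expr.cost]; omega)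
  · simp [parentOf]
  · rintro j s' hj hx' hk h22
    have h13 : s'.arr 13 = s.arr 13 := (hk.arr 13).trans rfl
    have h6' : s'.reg 6 = M := (hk.reg 6).trans (by simp [h6])
    have h33' : s'.reg 33 = i := (hk.reg 33).trans (by simp [h33])
    rw [zero_add] at hx'
    have hu := hlt _ (List.getElem_mem hj)
    have hce := hcell j hj
    have hpW : parentOf i (L.take j) < W := by
      rcases (parentOf_spec i (L.take j)).1 with h0 | h0 <;> omega
    have hstep : parentOf i (L.take (j + 1)) =
        if L[j] < i ∧ parentOf i (L.take j) < L[j] then L[j] else parentOf i (L.take j) := by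
      rw [← List.take_append_getElem hj, parentOf_append]
    refine Exec.le (Exec.of_vc ?_) (by decide)
    simp only [hstep]
    have h1 := ite_one_zero_lt (W := W) (by omega) (L[j] < i)
    have h2 := ite_one_zero_lt (W := W) (by omega) (parentOf i (L.take j) < L[j])
    have h3 : (if L[j] < i then 1 else 0) * (if parentOf i (L.take j) < L[j] then 1 else 0) < W := by
      split <;> split <;> omega
    by_cases c1 : L[j] < i <;> by_cases c2 : parentOf i (L.take j) < L[j] <;>
    simp [Program.vc, hx', h13, h6', h33', hce, h22, c1, c2] at h3 ⊢ <;> omega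
  · rintro s' - - h22
    rwa [List.take_length] at h22

/-! ### The initial tables -/

/-- The word limit `W` exceeds all numbers that occur in the computation with tables. -/
structure Limits (W n M ℓ : ℕ) : Prop where
  four : 4 < W
  row : n * M + M < W
  table : (n + 1) * 3 ^ M * (ℓ + 1) < W
  cost : (n + 1) * ((n + 1) * (n + 3)) < W
  budget : 3 * (ℓ + 1) < W

theorem Limits.pow_lt {W n M ℓ : ℕ} (h : Limits W n M ℓ) : 3 ^ M < W := by
  refine lt_of_le_of_lt ?_ h.table
  calc 3 ^ M = 1 * 3 ^ M * 1 := by ring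
    _ ≤ (n + 1) * 3 ^ M * (ℓ + 1) := Nat.mul_le_mul (Nat.mul_le_mul_right _ (by omega)) (by omega)

theorem Limits.n_lt {W n M ℓ : ℕ} (h : Limits W n M ℓ) : n + 3 < W := by
  refine lt_of_le_of_lt ?_ h.cost
  calc n + 3 = 1 * (1 * (n + 3)) := by ring
    _ ≤ (n + 1) * ((n + 1) * (n + 3)) :=
      Nat.mul_le_mul (by omega) (Nat.mul_le_mul_right _ (by omega))

/-- Cell `a` of the row for the vertex `i` and the code `x` of the table. -/
theorem Limits.row_lt {W n M ℓ i x a : ℕ} (h : Limits W n M ℓ) (hi : i ≤ n) (hx : x < 3 ^ M)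
    (ha : a < ℓ + 1) : (i * 3 ^ M + x) * (ℓ + 1) + a < W := by
  refine lt_trans ?_ h.table
  have h1 : i * 3 ^ M + x + 1 ≤ (n + 1) * 3 ^ M := by
    have := Nat.mul_le_mul_right (3 ^ M) hi
    rw [Nat.add_mul]
    omega
  have h2 := Nat.mul_le_mul_right (ℓ + 1) h1
  rw [Nat.add_mul (i * 3 ^ M + x)] at h2
  omega

theorem Limits.row_le {W n M ℓ i x : ℕ} (h : Limits W n M ℓ) (hi : i ≤ n) (hx : x < 3 ^ M) :
    i * 3 ^ M < W ∧ i * 3 ^ M + x < W ∧ (i * 3 ^ M + x) * (ℓ + 1) < W := by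
  have h1 := h.row_lt hi hx (a := 0) (by omega)
  have h2 : i * 3 ^ M + x ≤ (i * 3 ^ M + x) * (ℓ + 1) := Nat.le_mul_of_pos_right _ (by omega)
  omega

/-- The contents of the registers with the parameters, and of the arrays with the lists `B i`. -/
structure HasParams (n M ℓ : ℕ) (B : ℕ → List ℕ) (s : State) : Prop where
  r1 : s.reg 1 = n
  r3 : s.reg 3 = ℓ
  r4 : s.reg 4 = ℓ + 1
  r6 : s.reg 6 = M
  r7 : s.reg 7 = 3 ^ M
  rows : ∀ i ≤ n, HasRow M (s.arr 14) (s.arr 13) i (B i)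

section HasParams

variable {n M ℓ : ℕ} {B : ℕ → List ℕ} {s s' : State}

theorem HasParams.congr (h : HasParams n M ℓ B s)
    (hr : ∀ x ∈ [1, 3, 4, 6, 7], s'.reg x = s.reg x)
    (ha : ∀ a ∈ [13, 14], s'.arr a = s.arr a) : HasParams n M ℓ B s' := by
  refine ⟨?_, ?_, ?_, ?_, ?_, fun i hi => ?_⟩
  · rw [hr 1 (by simp), h.r1]
  · rw [hr 3 (by simp), h.r3]
  · rw [hr 4 (by simp), h.r4]
  · rw [hr 6 (by simp), h.r6]
  · rw [hr 7 (by simp), h.r7]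
  · rw [ha 13 (by simp), ha 14 (by simp)]
    exact h.rows i hi

theorem HasParams.keeps (h : HasParams n M ℓ B s) {p : Program} (hk : Keeps p s s')
    (hr : ∀ x ∈ [1, 3, 4, 6, 7], p.writesReg x = false := by decide)
    (ha : ∀ a ∈ [13, 14], p.writesArr a = false := by decide) : HasParams n M ℓ B s' :=
  h.congr (fun x hx => hk.reg' x (hr x hx)) fun a hx => hk.arr' a (ha a hx)

end HasParams

/-- The rows of the table for the vertices `0, …, n` and all codes. Row `r` belongs to the vertex
`r / P` and to the code `r % P`, where `P = 3 ^ M`. -/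
def tableRow (B : ℕ → List ℕ) (P : ℕ) (H : Costs) (r a : ℕ) : ℕ :=
  H (r / P) (colorsOf (B (r / P)) (r % P)) a

theorem tableRow_eq {B : ℕ → List ℕ} {P : ℕ} {H : Costs} {i x a : ℕ} (hx : x < P) :
    tableRow B P H (i * P + x) a = H i (colorsOf (B i) x) a := by
  have h1 : (i * P + x) / P = i := by
    rw [add_comm, Nat.add_mul_div_right _ _ (by omega), Nat.div_eq_of_lt hx, zero_add]
  have h2 : (i * P + x) % P = x := by
    rw [add_comm, Nat.add_mul_mod_self_right, Nat.mod_eq_of_lt hx]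
  rw [tableRow, h1, h2]

/-- Cells of different rows are different. -/
theorem row_disjoint {r r' a w : ℕ} (hr : r ≠ r') (ha : a < w) :
    r * w + a < r' * w ∨ r' * w + w ≤ r * w + a := by
  rcases hr.lt_or_gt with h | h
  · left
    have := Nat.mul_le_mul_right w (Nat.succ_le_of_lt h)
    rw [Nat.succ_mul] at this
    omega
  · right
    have := Nat.mul_le_mul_right w (Nat.succ_le_of_lt h)
    rw [Nat.succ_mul] at this
    omega

/-- Adds a penalty to register `28` for each edge between the colours `1` and `2` from the vertex
with the number in register `22` to a vertex with a smaller number. -/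
def progPenalties : Program :=
  .forUp 29 (.reg 14) 15
    (.assign 30 (.cell 11 (.cell 3 (.reg 29))) ⨟
      .branch (.lt (.reg 30) (.reg 22))
        (.branch (.eq (.cell 16 (.reg 30) * .cell 16 (.reg 22)) 2)
          (.assign 28 (.reg 28 + (.reg 1 + 1))) .skip) .skip)

/-- Writes the costs in register `28`, plus the penalty for the missing budget, to the row of the
table that starts at the position in register `31`. -/
def progFillRow : Program :=
  .forUp 32 0 4
    (.store 15 (.reg 31 + .reg 32)
      (.reg 28 + (.reg 1 + 1) * .eq (.reg 32 + .cell 16 (.reg 22)) 0))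

/-- Writes the initial row of the table for the vertex in register `22` and the code in
register `23`. -/
def progInitRow : Program :=
  progDecode ⨟
    .assign 28 (.eq (.cell 16 (.reg 22)) 2 +
      (.reg 1 + 1) * (.cell 8 (.reg 17) * .eq (.cell 16 (.reg 22)) 1)) ⨟
    progPenalties ⨟
    .assign 31 ((.reg 22 * .reg 7 + .reg 23) * .reg 4) ⨟
    progFillRow

/-- Writes the initial table for all vertices `1, …, n`. -/
def progInit : Program :=
  .assign 8 (.reg 1 + 1) ⨟
    .forUp 22 1 8
      (.assign 17 (.cell 12 (.reg 22)) ⨟ .assign 14 (.cell 2 (.reg 17)) ⨟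
        .assign 15 (.cell 2 (.reg 17 + 1)) ⨟ .forUp 23 0 7 progInitRow)

section Exec

variable {W n M ℓ : ℕ} {adj : ℕ → List ℕ} {num vert dfl : ℕ → ℕ} {B : ℕ → List ℕ}

theorem exec_progPenalties {s : State} {i K : ℕ} {c : ℕ → ℕ}
    (hW : 4 < W) (hK : K + (adj (vert i)).length * (n + 1) < W) (hn : n + 1 < W)
    (hst : Stored (s.arr 2) (s.arr 3) adj n) (hoff : ∀ v ≤ n, s.arr 2 v < W)
    (hadj : ∀ v < n, ∀ w ∈ adj v, w < n) (hnum : ∀ v < n, s.arr 11 v < W)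
    (hvi : vert i < n) (hiW : i < W) (hci : s.arr 16 i = c i)
    (hc : ∀ w ∈ adj (vert i), s.arr 11 w < i → s.arr 16 (s.arr 11 w) = c (s.arr 11 w))
    (hc3 : ∀ u, c u < 3) (h1 : s.reg 1 = n) (h14 : s.reg 14 = s.arr 2 (vert i))
    (h15 : s.reg 15 = s.arr 2 (vert i + 1)) (h22 : s.reg 22 = i) (h28 : s.reg 28 = K) :
    Exec W progPenalties s ((adj (vert i)).length * 32 + 6) fun s' =>
      s'.reg 28 = K + ((adj (vert i)).map (edgePenalty n (s.arr 11) c i)).sum := by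
  have hsucc := hst.off_succ _ hvi
  have hoff1 := hoff (vert i + 1) (by omega)
  have hoff0 := hoff (vert i) (by omega)
  have hle : ∀ L : List ℕ, (L.map (edgePenalty n (s.arr 11) c i)).sum ≤ L.length * (n + 1) := by
    intro L
    refine (List.sum_le_card_nsmul _ (n + 1) ?_).trans (by simp)
    intro y hy
    obtain ⟨w, -, rfl⟩ := List.mem_map.1 hy
    unfold edgePenalty
    split <;> omega
  set L := adj (vert i) with hL
  refine Exec.le (Exec.forUp (fun e s' => s'.reg 28 = K +
    ((L.take e).map (edgePenalty n (s.arr 11) c i)).sum) (s.arr 2 (vert i)) L.length 24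
    (by simp [h14]; omega) (by simp [h14]) (by rw [h15, hsucc]) (by decide) rfl rfl (by omega)
    (by omega) (by simp [h28]) ?_ ?_) (by simp [Expr.cost]; omega)
  · intro e s' he hx hk hI
    have a3 : s'.arr 3 = s.arr 3 := (hk.arr 3).trans rfl
    have a11 : s'.arr 11 = s.arr 11 := (hk.arr 11).trans rfl
    have a16 : s'.arr 16 = s.arr 16 := (hk.arr 16).trans rfl
    have r22 : s'.reg 22 = i := (hk.reg 22).trans h22
    have r1 : s'.reg 1 = n := (hk.reg 1).trans h1
    have hmem : L[e] ∈ L := List.getElem_mem he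
    have hcell := hst.flat_eq _ hvi e he
    have hwn := hadj _ hvi _ hmem
    have hnw := hnum _ hwn
    have hstep : ((L.take (e + 1)).map (edgePenalty n (s.arr 11) c i)).sum =
        ((L.take e).map (edgePenalty n (s.arr 11) c i)).sum +
          edgePenalty n (s.arr 11) c i L[e] := by
      rw [← List.take_append_getElem he, List.map_append, List.sum_append]
      simp
    have hle1 := hle (L.take (e + 1))
    have hle2 : (L.take (e + 1)).length * (n + 1) ≤ L.length * (n + 1) :=
      Nat.mul_le_mul_right _ (List.length_take_le' _ _)
    rw [hstep] at hle1
    simp only [hstep]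
    change s.arr 3 (s.arr 2 (vert i) + e) = L[e] at hcell
    set w := L[e] with hw
    refine Exec.le (Exec.of_vc ?_) (by decide)
    have hi1 := hc3 i
    by_cases hlt : s.arr 11 w < i
    · have hcw := hc w hmem hlt
      have hw1 := hc3 (s.arr 11 w)
      have hpr : c (s.arr 11 w) * c i < 5 := by
        calc c (s.arr 11 w) * c i ≤ 2 * 2 := Nat.mul_le_mul (by omega) (by omega)
          _ < 5 := by omega
      have hprW : c (s.arr 11 w) * c i < W := by omega
      by_cases h2 : c (s.arr 11 w) * c i = 2
      · rw [edgePenalty, if_pos ⟨hlt, h2⟩] at hle1 ⊢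
        simp [-List.map_take, Program.vc, hx, a3, hcell, a11, a16, r22, hlt, hcw, hci, h2, hI, r1]
        omega
      · rw [edgePenalty, if_neg (fun h => h2 h.2)] at hle1 ⊢
        simp [-List.map_take, Program.vc, hx, a3, hcell, a11, a16, r22, hlt, hcw, hci, h2, hI]
        omega
    · rw [edgePenalty, if_neg (fun h => hlt h.1)] at hle1 ⊢
      simp [-List.map_take, Program.vc, hx, a3, hcell, a11, r22, hlt, hI]
      omega
  · intro s' _ _ hI
    rwa [List.take_length] at hI

theorem exec_progFillRow {s : State} {i R K ci : ℕ} (hK : K + (n + 1) < W) (hR : R + ℓ < W)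
    (hℓ : ℓ + 4 < W) (hiW : i < W) (hci : ci < 3) (h1 : s.reg 1 = n) (h4 : s.reg 4 = ℓ + 1)
    (h22 : s.reg 22 = i) (h28 : s.reg 28 = K) (h31 : s.reg 31 = R) (h16 : s.arr 16 i = ci) :
    Exec W progFillRow s ((ℓ + 1) * 24 + 6) fun s' =>
      (∀ a < ℓ + 1, s'.arr 15 (R + a) = K + (n + 1) * (if a + ci = 0 then 1 else 0)) ∧
      ∀ y, y < R ∨ R + (ℓ + 1) ≤ y → s'.arr 15 y = s.arr 15 y := by
  refine Exec.le (Exec.forUp (fun a s' => (∀ b < a, s'.arr 15 (R + b) =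
      K + (n + 1) * (if b + ci = 0 then 1 else 0)) ∧ ∀ y, y < R ∨ R + (ℓ + 1) ≤ y →
        s'.arr 15 y = s.arr 15 y) 0 (ℓ + 1) 16 (by simp; omega) rfl (by simp [h4]) (by decide)
        rfl rfl (by omega) (by omega) ?_ ?_ ?_) (by simp [Expr.cost]; omega)
  · exact ⟨fun b hb => by omega, fun y _ => by simp⟩
  · rintro a s' ha hx' hk ⟨hI1, hI2⟩
    have m28 : s'.reg 28 = K := (hk.reg 28).trans h28
    have m31 : s'.reg 31 = R := (hk.reg 31).trans h31
    have m22 : s'.reg 22 = i := (hk.reg 22).trans h22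
    have m1 : s'.reg 1 = n := (hk.reg 1).trans h1
    have mci : s'.arr 16 i = ci := by rw [hk.arr 16]; exact h16
    rw [zero_add] at hx'
    have e6 : (if a + ci = 0 then 1 else 0) ≤ 1 := by split <;> omega
    have e7 : (n + 1) * (if a + ci = 0 then 1 else 0) ≤ n + 1 := by nlinarith
    refine Exec.of_vc ⟨?_, ?_, ?_⟩
    · simp [m31, hx']
      omega
    · simp only [Expr.fits_add, Expr.fits_mul, Expr.fits_eq, Expr.fits_reg, Expr.fits_ofNat,
        Expr.fits_cell, Expr.eval_reg, Expr.eval_ofNat, Expr.eval_eq, Expr.eval_add, Expr.eval_mul,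
        Expr.eval_cell, m28, m1, m22, mci, hx']
      omega
    · simp only [Expr.eval_reg, Expr.eval_ofNat, Expr.eval_eq, Expr.eval_add, Expr.eval_mul,
        Expr.eval_cell, m28, m1, m22, mci, hx', m31, State.set_arr, State.put_arr, if_true]
      refine ⟨fun b hb => ?_, fun y hy => ?_⟩
      · rcases Nat.lt_succ_iff_lt_or_eq.1 hb with hb | rfl
        · rw [Function.update_of_ne (by omega)]
          exact hI1 b hb
        · rw [Function.update_self]
      · rw [Function.update_of_ne (by omega)]
        exact hI2 y hy
  · rintro s' - - h
    exact h

theorem exec_progInitRow {s : State} {i x : ℕ} (hW : Limits W n M ℓ)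
    (hnb : Numbering n M adj num vert B) (hpar : HasParams n M ℓ B s)
    (hst : Stored (s.arr 2) (s.arr 3) adj n) (hoff : ∀ v ≤ n, s.arr 2 v < W)
    (hadj : ∀ v < n, ∀ w ∈ adj v, w < n) (hlen : ∀ v < n, (adj v).length ≤ n)
    (h8 : s.arr 8 = dfl) (h11 : s.arr 11 = num) (hdfl : ∀ v < n, dfl v ≤ 1)
    (h1 : 1 ≤ i) (hi : i ≤ n) (hx : x < 3 ^ M)
    (h14 : s.reg 14 = s.arr 2 (vert i)) (h15 : s.reg 15 = s.arr 2 (vert i + 1))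
    (h17 : s.reg 17 = vert i) (h22 : s.reg 22 = i) (h23 : s.reg 23 = x) :
    Exec W progInitRow s (M * 22 + (adj (vert i)).length * 32 + (ℓ + 1) * 24 + 48) fun s' =>
      (∀ a < ℓ + 1, s'.arr 15 ((i * 3 ^ M + x) * (ℓ + 1) + a) =
        initCosts n adj num vert dfl i (colorsOf (B i) x) a) ∧
      ∀ y, y < (i * 3 ^ M + x) * (ℓ + 1) ∨ (i * 3 ^ M + x) * (ℓ + 1) + (ℓ + 1) ≤ y →
        s'.arr 15 y = s.arr 15 y := by
  have hWn := hW.n_lt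
  have hW4 := hW.four
  have hW3 : 3 < W := by omega
  have hWP := hW.pow_lt
  have hiM : i * M + M < W := lt_of_le_of_lt (by have := Nat.mul_le_mul_right M hi; omega) hW.row
  have hvi := hnb.vert_lt i h1 hi
  have hBlt : ∀ u ∈ B i, u < W := fun u hu => by have := hnb.mem_range i u hu; omega
  have hself := hnb.mem_self i h1 hi
  set c := colorsOf (B i) x with hc
  have hc3 : ∀ u, c u < 3 := colorsOf_lt _ _
  have hci3 := hc3 i
  have hdv := hdfl _ hvi
  have hleni := hlen _ hvi
  have hcost : (n + 1) * (n + 3) < W := by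
    refine lt_of_le_of_lt ?_ hW.cost
    exact Nat.le_mul_of_pos_left _ (by omega)
  have hrow := hW.row_le hi hx
  refine Exec.le (Exec.seq ((Exec.frame (exec_progDecode hW3 (hpar.rows i hi) (hnb.nodup i)
    (hnb.length_le i) hBlt hiM (by omega) (by omega) hpar.r6 h22 h23)).mono le_rfl ?_))
    (?_ : (M * 22 + 11) + (17 + (((adj (vert i)).length * 32 + 6) +
      (8 + ((ℓ + 1) * 24 + 6)))) ≤ _)
  swap
  · omega
  rintro s₁ ⟨hk₁, hcol⟩
  have hci : s₁.arr 16 i = c i := hcol i hself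
  have q1 : s₁.reg 1 = n := (hk₁.reg 1).trans hpar.r1
  have q17 : s₁.reg 17 = vert i := (hk₁.reg 17).trans h17
  have q22 : s₁.reg 22 = i := (hk₁.reg 22).trans h22
  have q8 : s₁.arr 8 = dfl := (hk₁.arr 8).trans h8
  have e1 := ite_one_zero_lt (W := W) (by omega) (c i = 2)
  have e2 := ite_one_zero_lt (W := W) (by omega) (c i = 1)
  have e3 : dfl (vert i) * (if c i = 1 then 1 else 0) ≤ 1 := by split <;> omega
  have e4 : (n + 1) * (dfl (vert i) * (if c i = 1 then 1 else 0)) ≤ n + 1 := by nlinarith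
  have e5 : (if c i = 2 then 1 else 0) ≤ 1 := by split <;> omega
  set K := (if c i = 2 then 1 else 0) + (n + 1) * (dfl (vert i) * (if c i = 1 then 1 else 0)) with hK
  have hlm := Nat.mul_le_mul_right (n + 1) hleni
  have hKle : K ≤ n + 2 := by omega
  have hcost' : (n + 1) * (n + 3) = n * (n + 1) + (n + 1) + (n + 1) + (n + 1) := by ring
  refine Exec.seq (Exec.of_vc ⟨?_, ?_⟩)
  · simp only [Expr.fits_add, Expr.fits_mul, Expr.fits_eq, Expr.fits_reg, Expr.fits_ofNat,
      Expr.fits_cell, Expr.eval_reg, Expr.eval_ofNat, Expr.eval_eq, Expr.eval_add, Expr.eval_mul,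
      Expr.eval_cell, q22, hci, q1, q17, q8]
    omega
  simp only [Expr.eval_add, Expr.eval_mul, Expr.eval_eq, Expr.eval_cell, Expr.eval_reg, q22, hci,
    Expr.eval_ofNat, q1, q17, q8, ← hK]
  refine Exec.seq ((Exec.frame (exec_progPenalties (n := n) (adj := adj) (vert := vert) (c := c)
    (K := K) (i := i) hW4 (by omega) (by omega) (by
      have : (s₁.set 28 K).arr 2 = s.arr 2 := hk₁.arr 2
      have h3 : (s₁.set 28 K).arr 3 = s.arr 3 := hk₁.arr 3
      rwa [this, h3]) (by
      have : (s₁.set 28 K).arr 2 = s.arr 2 := hk₁.arr 2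
      rwa [this]) hadj ?_ hvi (by omega) (by simpa using hci) ?_ hc3 (by simp [q1]) ?_ ?_
      (by simp [q22]) (by simp))).mono le_rfl ?_)
  · intro v hv
    have : (s₁.set 28 K).arr 11 = num := (hk₁.arr 11).trans h11
    rw [this]
    have := hnb.num_mem v hv
    omega
  · intro w hw
    have : (s₁.set 28 K).arr 11 = num := (hk₁.arr 11).trans h11
    rw [this]
    intro hlt
    refine hcol _ ?_
    have := hnb.adj_mem _ hvi w hw
    rw [hnb.num_vert i h1 hi] at this
    exact this hlt
  · simp only [State.set_reg, Nat.reduceEqDiff, if_false, State.set_arr]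
    rw [hk₁.reg 14, h14, hk₁.arr 2]
  · simp only [State.set_reg, Nat.reduceEqDiff, if_false, State.set_arr]
    rw [hk₁.reg 15, h15, hk₁.arr 2]
  rintro s₂ ⟨hk₂, h28⟩
  have n11 : (s₁.set 28 K).arr 11 = num := (hk₁.arr 11).trans h11
  rw [n11] at h28
  set S := ((adj (vert i)).map (edgePenalty n num c i)).sum with hS
  have hSle : S ≤ (adj (vert i)).length * (n + 1) := by
    refine (List.sum_le_card_nsmul _ (n + 1) ?_).trans (by simp)
    intro y hy
    obtain ⟨w, -, rfl⟩ := List.mem_map.1 hy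
    unfold edgePenalty
    split <;> omega
  have p1 : s₂.reg 1 = n := (hk₂.reg 1).trans (by simp [q1])
  have p4 : s₂.reg 4 = ℓ + 1 := (hk₂.reg 4).trans (by simpa using (hk₁.reg 4).trans hpar.r4)
  have p7 : s₂.reg 7 = 3 ^ M := (hk₂.reg 7).trans (by simpa using (hk₁.reg 7).trans hpar.r7)
  have p22 : s₂.reg 22 = i := (hk₂.reg 22).trans (by simp [q22])
  have p23 : s₂.reg 23 = x := (hk₂.reg 23).trans (by simpa using (hk₁.reg 23).trans h23)
  have p15 : s₂.arr 15 = s.arr 15 := (hk₂.arr 15).trans (hk₁.arr 15)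
  have pci : s₂.arr 16 i = c i := by rw [hk₂.arr 16]; exact hci
  have hb := hW.budget
  refine Exec.seq (Exec.of_vc ⟨?_, ?_⟩)
  · simp [p22, p7, p23, p4]
    omega
  simp only [Expr.eval_add, Expr.eval_mul, Expr.eval_reg, p22, p7, p23, p4]
  set R := (i * 3 ^ M + x) * (ℓ + 1) with hR
  have hRa := hW.row_lt hi hx (a := ℓ) (by omega)
  refine (exec_progFillRow (n := n) (ℓ := ℓ) (R := R) (K := K + S) (i := i) (ci := c i) (by omega)
    (by omega) (by omega) (by omega) (by omega) (by simp [p1]) (by simp [p4]) (by simp [p22])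
    (by simpa using h28) (by simp) (by simpa using pci)).mono le_rfl ?_
  rintro s₃ ⟨h3, h4⟩
  refine ⟨fun a ha => ?_, fun y hy => ?_⟩
  · rw [h3 a ha, initCosts, if_neg (show ¬ (i = 0 ∨ n < i) by omega)]
  · rw [h4 y hy, State.set_arr, p15]

end Exec

section Exec

variable {W n M ℓ : ℕ} {adj : ℕ → List ℕ} {num vert dfl : ℕ → ℕ} {B : ℕ → List ℕ}

theorem exec_progInit {s : State} (hW : Limits W n M ℓ)
    (hnb : Numbering n M adj num vert B) (hpar : HasParams n M ℓ B s)
    (hst : Stored (s.arr 2) (s.arr 3) adj n) (hoff : ∀ v ≤ n, s.arr 2 v < W)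
    (hadj : ∀ v < n, ∀ w ∈ adj v, w < n) (hlen : ∀ v < n, (adj v).length ≤ n)
    (h8 : s.arr 8 = dfl) (h11 : s.arr 11 = num) (h12 : s.arr 12 = vert)
    (hdfl : ∀ v < n, dfl v ≤ 1) (h15 : ∀ y, s.arr 15 y = 0) :
    Exec W progInit s (∑ j ∈ Finset.range n, (3 ^ M * (M * 22 +
      (adj (vert (j + 1))).length * 32 + (ℓ + 1) * 24 + 56) + 25) + 10) fun s' =>
      ∀ r < (n + 1) * 3 ^ M, ∀ a < ℓ + 1, s'.arr 15 (r * (ℓ + 1) + a) =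
        tableRow B (3 ^ M) (initCosts n adj num vert dfl) r a := by
  have hWn := hW.n_lt
  have hW4 := hW.four
  have hPpos : 0 < 3 ^ M := by positivity
  refine Exec.le (Exec.seq (Exec.of_vc ⟨?_, ?_⟩)) (?_ : 4 + (∑ j ∈ Finset.range n, (3 ^ M * (M * 22 +
      (adj (vert (j + 1))).length * 32 + (ℓ + 1) * 24 + 56) + 25) + 6) ≤ _)
  · simp [hpar.r1]; omega
  swap
  · omega
  simp only [Expr.eval_add, Expr.eval_reg, hpar.r1, Expr.eval_ofNat]
  refine Exec.le (Exec.forUp_sum (fun j s' => ∀ r a, a < ℓ + 1 → s'.arr 15 (r * (ℓ + 1) + a) =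
    if r < (j + 1) * 3 ^ M then tableRow B (3 ^ M) (initCosts n adj num vert dfl) r a else 0)
    1 n (fun j => 3 ^ M * (M * 22 + (adj (vert (j + 1))).length * 32 + (ℓ + 1) * 24 + 56) + 17)
    (by simp; omega) rfl (by simp; omega) (by decide) rfl rfl (by omega) (by omega) ?_ ?_ ?_)
    (by simp [Expr.cost, add_assoc]; omega)
  · intro r a ha
    simp only [State.set_arr, h15]
    split
    · rename_i hr
      rw [tableRow, Nat.div_eq_of_lt (by omega), initCosts, if_pos (Or.inl rfl)]
    · rfl
  · intro j s' hj hx hk hI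
    rw [add_comm] at hx
    have hp' := hpar.congr (s' := s') (fun x hx => by
      simp only [List.mem_cons, List.not_mem_nil, or_false] at hx
      rcases hx with rfl | rfl | rfl | rfl | rfl <;> exact (hk.reg _).trans (by simp)) (fun a ha => by
      simp only [List.mem_cons, List.not_mem_nil, or_false] at ha
      rcases ha with rfl | rfl <;> exact (hk.arr _).trans (by simp))
    have a2 : s'.arr 2 = s.arr 2 := (hk.arr 2).trans rfl
    have a3 : s'.arr 3 = s.arr 3 := (hk.arr 3).trans rfl
    have a8 : s'.arr 8 = dfl := (hk.arr 8).trans h8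
    have a11 : s'.arr 11 = num := (hk.arr 11).trans h11
    have a12 : s'.arr 12 = vert := (hk.arr 12).trans h12
    have hvi := hnb.vert_lt (j + 1) (by omega) (by omega)
    have o1 := hoff (vert (j + 1) + 1) (by omega)
    have o0 := hoff (vert (j + 1)) (by omega)
    refine Exec.le (Exec.seq (Exec.of_vc ⟨by simp [hx, a12]; omega, Exec.seq (Exec.of_vc
      ⟨by simp [hx, a12, a2]; omega, Exec.seq (Exec.of_vc ⟨by simp [hx, a12, a2]; omega, ?_⟩)⟩)⟩))
      (?_ : 3 + (3 + (5 + (3 ^ M * (M * 22 + (adj (vert (j + 1))).length * 32 + (ℓ + 1) * 24 + 56)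
        + 6))) ≤ _)
    swap
    · omega
    simp only [Expr.eval_cell, Expr.eval_reg, hx, a12, Expr.eval_add, State.set_reg, if_true,
      Expr.eval_ofNat, State.set_arr, a2, Nat.reduceEqDiff, if_false]
    set s₁ : State := _
    change Exec W _ s₁ _ _
    have b15 : s₁.arr = s'.arr := rfl
    have hp₁ : HasParams n M ℓ B s₁ := hp'.congr (by simp [s₁]) (by simp [s₁])
    refine Exec.le (Exec.forUp (fun x s' => ∀ r a, a < ℓ + 1 → s'.arr 15 (r * (ℓ + 1) + a) =
      if r < (j + 1) * 3 ^ M + x then tableRow B (3 ^ M) (initCosts n adj num vert dfl) r a else 0)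
      0 (3 ^ M) (M * 22 + (adj (vert (j + 1))).length * 32 + (ℓ + 1) * 24 + 48) (by simp; omega)
      rfl (by simp [hp₁.r7]) (by decide) rfl rfl (by have := hW.pow_lt; omega) (by omega) ?_ ?_ ?_)
      (by simp [Expr.cost, add_assoc]; omega)
    · intro r a ha
      simpa [b15] using hI r a ha
    · intro x s₂ hxP hx₂ hk₂ hI₂
      rw [zero_add] at hx₂
      have hp₂ := hp₁.keeps hk₂
      have c2 : s₂.arr 2 = s.arr 2 := (hk₂.arr 2).trans a2
      have c3 : s₂.arr 3 = s.arr 3 := (hk₂.arr 3).trans a3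
      refine (exec_progInitRow (s := s₂) (i := j + 1) (x := x) hW hnb hp₂ (by rwa [c2, c3])
        (by rwa [c2]) hadj hlen ((hk₂.arr 8).trans a8) ((hk₂.arr 11).trans a11) hdfl (by omega)
        (by omega) hxP ((hk₂.reg 14).trans (by simp [s₁, c2]))
        ((hk₂.reg 15).trans (by simp [s₁, c2])) ((hk₂.reg 17).trans (by simp [s₁]))
        ((hk₂.reg 22).trans (by simp [s₁, hx])) hx₂).mono le_rfl ?_
      rintro s₃ ⟨h3, h4⟩ r a ha
      rw [State.set_arr]
      rcases eq_or_ne r ((j + 1) * 3 ^ M + x) with rfl | hne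
      · rw [h3 a ha, if_pos (by omega), tableRow_eq hxP]
      · rw [h4 _ (row_disjoint hne ha), hI₂ r a ha]
        have : r < (j + 1) * 3 ^ M + x ↔ r < (j + 1) * 3 ^ M + (x + 1) := by omega
        simp only [this]
    · intro s₂ _ _ hI₂ r a ha
      rw [hI₂ r a ha]
      have : (j + 1) * 3 ^ M + 3 ^ M = (j + 1 + 1) * 3 ^ M := by ring
      rw [this]
  · intro s' _ _ hI r hr a ha
    rw [hI r a ha, if_pos hr]

end Exec

/-! ### Eliminating a vertex from the tables -/

/-- Replaces cell `a` (register `37`) of the row at the position in register `31`, by the minimum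
over all ways to split the budget `a` and to colour the eliminated vertex; the corresponding rows of
the latter start at the positions in array `17`. -/
def progCell : Program :=
  .assign 38 (.cell 15 (.reg 31) + .cell 15 (.cell 17 0 + .reg 37)) ⨟
    .assign 39 (3 * (.reg 37 + 1)) ⨟
    .forUp 40 0 39
      (.assign 41 (.cell 15 (.reg 31 + .reg 40 / 3) +
          .cell 15 (.cell 17 (.reg 40 % 3) + (.reg 37 - .reg 40 / 3))) ⨟
        .branch (.lt (.reg 41) (.reg 38)) (.assign 38 (.reg 41)) .skip) ⨟
    .store 15 (.reg 31 + .reg 37) (.reg 38)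

/-- Combines a row with the rows of the eliminated vertex for its three colours. The cells are
overwritten in decreasing order, since the new value of a cell depends on the old values of
this cell and the cells before it. -/
def progCombine : Program :=
  .forUp 36 0 4 (.assign 37 (.reg 3 - .reg 36) ⨟ progCell)

/-- Finds, for each of the three colours of the eliminated vertex, the row of its table for the
current colouring. -/
def progRowBases : Program :=
  .forUp 34 0 35
    (.store 16 (.reg 33) (.reg 34) ⨟ progEncode ⨟
      .store 17 (.reg 34) ((.reg 33 * .reg 7 + .reg 25) * .reg 4))

/-- Updates the row for the vertex in register `22` and the code in register `23` when the vertex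
in register `33` is eliminated. -/
def progElimRow : Program :=
  progDecode ⨟ progRowBases ⨟ .assign 31 ((.reg 22 * .reg 7 + .reg 23) * .reg 4) ⨟ progCombine

/-- Eliminates the vertices `n, …, 1`, in this order. -/
def progEliminate : Program :=
  .assign 35 3 ⨟
    .forUp 42 0 1
      (.assign 33 (.reg 1 - .reg 42) ⨟ progParent ⨟ .forUp 23 0 7 progElimRow)

section Exec

variable {W ℓ : ℕ}

theorem exec_progCell {s : State} {a R : ℕ} {base g : ℕ → ℕ} {g' : ℕ → ℕ → ℕ}
    (hW : 3 < W) (ha : a < ℓ + 1) (hℓ : 3 * (ℓ + 1) < W)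
    (hK : ∀ b b' z, g b + g' z b' < W)
    (hR : R + ℓ < W) (hbase : ∀ z < 3, base z + ℓ < W)
    (hg : ∀ b ≤ a, s.arr 15 (R + b) = g b)
    (hg' : ∀ z < 3, ∀ b ≤ a, s.arr 15 (base z + b) = g' z b)
    (h17 : ∀ z < 3, s.arr 17 z = base z) (h31 : s.reg 31 = R) (h37 : s.reg 37 = a) :
    Exec W progCell s ((a + 1) * 114 + 30) fun s' =>
      s'.arr 15 = Function.update (s.arr 15) (R + a)
        (runMin (fun q => g (q / 3) + g' (q % 3) (a - q / 3)) (3 * (a + 1))) := by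
  set f : ℕ → ℕ := fun q => g (q / 3) + g' (q % 3) (a - q / 3) with hf
  have hfW : ∀ q, f q < W := fun q => hK _ _ _
  have hb0 := hbase 0 (by omega)
  have hf0 : g 0 + g' 0 a = f 0 := by simp [hf]
  have hg0 := hg 0 (by omega)
  rw [add_zero] at hg0
  have hrW : ∀ q, runMin f q < W := fun q => (runMin_le_zero f q).trans_lt (hfW 0)
  have hgW : ∀ b, g b < W := fun b => by have := hK b 0 0; omega
  have hgW' : ∀ z b, g' z b < W := fun z b => by have := hK 0 b z; omega
  have h17' := h17 0 (by omega)
  have hg0' := hg' 0 (by omega) a le_rfl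
  refine Exec.le (Exec.seq (Exec.of_vc ⟨?_, Exec.seq (Exec.of_vc ⟨?_, ?_⟩)⟩))
    (?_ : 9 + (6 + ((3 * (a + 1) * 38 + 6) + 5)) ≤ _)
  · simp [h31, hg0, h17', h37, hg0', hf0]
    have := hgW 0; have := hgW' 0 a; have := hfW 0
    omega
  · simp [h37]; omega
  swap
  · omega
  simp only [Expr.eval_cell, Expr.eval_reg, Expr.eval_add, State.set_reg, Nat.reduceEqDiff,
    Expr.eval_ofNat, if_false, h31, hg0, h17', h37, hg0', hf0, Expr.eval_mul]
  refine Exec.seq (Exec.le (Exec.forUp (fun q s' => s'.reg 38 = runMin f q) 0 (3 * (a + 1)) 30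
    (by simp; omega) rfl (by simp) (by decide) rfl rfl (by omega) (by omega) (by simp [runMin])
    ?_ ?_) (by simp [Expr.cost]; omega))
  · intro q s' hq hx hk hI
    have a15 : s'.arr 15 = s.arr 15 := (hk.arr 15).trans rfl
    have a17 : s'.arr 17 = s.arr 17 := (hk.arr 17).trans rfl
    have r31 : s'.reg 31 = R := (hk.reg 31).trans (by simp [h31])
    have r37 : s'.reg 37 = a := (hk.reg 37).trans (by simp [h37])
    rw [zero_add] at hx
    have hqa : q / 3 ≤ a := by omega
    have hq3 : q % 3 < 3 := Nat.mod_lt _ (by omega)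
    have v1 := hg (q / 3) hqa
    have v2 := h17 (q % 3) hq3
    have v3 := hg' (q % 3) hq3 (a - q / 3) (by omega)
    have hbz := hbase (q % 3) hq3
    have hfq : g (q / 3) + g' (q % 3) (a - q / 3) = f q := rfl
    have w1 := hgW (q / 3)
    have w2 := hgW' (q % 3) (a - q / 3)
    have w3 := hfW q
    have w4 := hrW q
    refine Exec.le (Exec.of_vc ?_) (by decide)
    simp only [Program.vc, Expr.fits_add, Expr.fits_sub, Expr.fits_div, Expr.fits_mod,
      Expr.fits_cell, Expr.fits_reg, Expr.fits_ofNat, Expr.eval_add, Expr.eval_sub, Expr.eval_div,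
      Expr.eval_mod, Expr.eval_cell, Expr.eval_reg, Expr.eval_ofNat, hx, r31, r37, a15, a17, v1, v2,
      v3, hfq, Expr.fits_lt, Expr.eval_lt, State.set_reg, Nat.reduceEqDiff, if_true, if_false, hI]
    have hite := ite_one_zero_lt (W := W) (by omega) (f q < runMin f q)
    refine ⟨by omega, by omega, fun h => ⟨by omega, ?_⟩, fun h => ?_⟩
    · rw [runMin, min_eq_right]
      by_contra hlt
      exact h (if_neg (by omega))
    · rw [runMin, min_eq_left]
      by_contra hlt
      rw [if_pos (by omega)] at h
      omega
  · intro s' _ hk hI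
    have a15 : s'.arr 15 = s.arr 15 := (hk.arr 15).trans rfl
    have r31 : s'.reg 31 = R := (hk.reg 31).trans (by simp [h31])
    have r37 : s'.reg 37 = a := (hk.reg 37).trans (by simp [h37])
    have := hrW (3 * (a + 1))
    refine Exec.of_vc ⟨?_, ?_, ?_⟩
    · simp [r31, r37]; omega
    · simp [hI, this]
    · simp [r31, r37, a15, hI]

theorem exec_progCombine {s : State} {R : ℕ} {base g : ℕ → ℕ} {g' : ℕ → ℕ → ℕ}
    (hW : 3 < W) (hℓ : 3 * (ℓ + 1) < W)
    (hK : ∀ b b' z, g b + g' z b' < W)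
    (hR : R + ℓ < W) (hbase : ∀ z < 3, base z + ℓ < W)
    (hdis : ∀ z < 3, ∀ b < ℓ + 1, base z + b < R ∨ R + (ℓ + 1) ≤ base z + b)
    (hg : ∀ b < ℓ + 1, s.arr 15 (R + b) = g b)
    (hg' : ∀ z < 3, ∀ b < ℓ + 1, s.arr 15 (base z + b) = g' z b)
    (h17 : ∀ z < 3, s.arr 17 z = base z) (h31 : s.reg 31 = R) (h3 : s.reg 3 = ℓ)
    (h4 : s.reg 4 = ℓ + 1) :
    Exec W progCombine s ((ℓ + 1) * ((ℓ + 1) * 114 + 42) + 6) fun s' =>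
      (∀ a < ℓ + 1, s'.arr 15 (R + a) =
        runMin (fun q => g (q / 3) + g' (q % 3) (a - q / 3)) (3 * (a + 1))) ∧
      ∀ y, y < R ∨ R + (ℓ + 1) ≤ y → s'.arr 15 y = s.arr 15 y := by
  refine Exec.le (Exec.forUp (fun j s' =>
      (∀ a < ℓ + 1, s'.arr 15 (R + a) = if a + j < ℓ + 1 then g a else
        runMin (fun q => g (q / 3) + g' (q % 3) (a - q / 3)) (3 * (a + 1))) ∧
      ∀ y, y < R ∨ R + (ℓ + 1) ≤ y → s'.arr 15 y = s.arr 15 y) 0 (ℓ + 1)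
    ((ℓ + 1) * 114 + 34) (by simp; omega) rfl (by simp [h4]) (by decide) rfl rfl (by omega)
    (by omega) ?_ ?_ ?_) (by simp [Expr.cost, add_assoc]; omega)
  · refine ⟨fun a ha => ?_, fun y _ => rfl⟩
    rw [if_pos (by omega)]
    exact hg a ha
  · rintro j s' hj hx hk ⟨hI1, hI2⟩
    have a17 : s'.arr 17 = s.arr 17 := (hk.arr 17).trans rfl
    have r31 : s'.reg 31 = R := (hk.reg 31).trans h31
    have r3 : s'.reg 3 = ℓ := (hk.reg 3).trans h3
    rw [zero_add] at hx
    refine Exec.le (Exec.seq (Exec.of_vc ⟨by simp [r3, hx]; omega, ?_⟩))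
      (?_ : 4 + ((ℓ - j + 1) * 114 + 30) ≤ _)
    swap
    · omega
    simp only [Expr.eval_sub, Expr.eval_reg, r3, hx]
    refine (exec_progCell (s := s'.set 37 (ℓ - j)) (ℓ := ℓ) (g := g) (g' := g') (R := R)
      (base := base) hW (by omega) hℓ hK hR hbase ?_ ?_ ?_ (by simp [r31]) (by simp)).mono le_rfl ?_
    · intro b hb
      rw [State.set_arr, hI1 b (by omega), if_pos (by omega)]
    · intro z hz b hb
      rw [State.set_arr, hI2 _ (hdis z hz b (by omega)), hg' z hz b (by omega)]
    · intro z hz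
      rw [State.set_arr, a17, h17 z hz]
    · intro s'' h15
      rw [State.set_arr] at h15 ⊢
      rw [h15]
      refine ⟨fun a ha => ?_, fun y hy => ?_⟩
      · rcases eq_or_ne a (ℓ - j) with rfl | hne
        · rw [Function.update_self, if_neg (by omega)]
        · rw [Function.update_of_ne (by omega), hI1 a ha]
          have : a + j < ℓ + 1 ↔ a + (j + 1) < ℓ + 1 := by omega
          simp only [this]
      · rw [Function.update_of_ne (by omega)]
        exact hI2 y hy
  · rintro s' - - ⟨hI1, hI2⟩
    refine ⟨fun a ha => ?_, hI2⟩
    rw [hI1 a ha, if_neg (by omega)]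

end Exec

section Exec

variable {W n M ℓ : ℕ} {adj : ℕ → List ℕ} {num vert : ℕ → ℕ} {B : ℕ → List ℕ}

theorem Numbering.lt_of_mem {i u : ℕ} (hnb : Numbering n M adj num vert B)
    (hW : Limits W n M ℓ) (hi : i ≤ n) (hu : u ∈ B i) : u < W := by
  have h1 := hnb.mem_range i u hu
  have h2 := hW.n_lt
  omega

theorem Limits.row_i {i : ℕ} (hW : Limits W n M ℓ) (hi : i ≤ n) : i * M + M < W :=
  lt_of_le_of_lt (by have := Nat.mul_le_mul_right M hi; omega) hW.row

theorem exec_progRowBases {s : State} {i : ℕ} {c : ℕ → ℕ} (hW : Limits W n M ℓ)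
    (hnb : Numbering n M adj num vert B) (hpar : HasParams n M ℓ B s) (hi : i ≤ n)
    (hc : ∀ u ∈ B i, u ≠ i → s.arr 16 u = c u) (hc3 : ∀ u, c u < 3)
    (h33 : s.reg 33 = i) (h35 : s.reg 35 = 3) :
    Exec W progRowBases s (3 * (M * 24 + 33) + 6) fun s' => ∀ z < 3,
      s'.arr 17 z = (i * 3 ^ M + codeOf (Function.update c i z) (B i)) * (ℓ + 1) := by
  have hWn := hW.n_lt
  have hW4 := hW.four
  refine Exec.le (Exec.forUp (fun j s' => (∀ u ∈ B i, u ≠ i → s'.arr 16 u = c u) ∧ ∀ z < j,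
      s'.arr 17 z = (i * 3 ^ M + codeOf (Function.update c i z) (B i)) * (ℓ + 1)) 0 3
    (M * 24 + 25) (by simp; omega) rfl (by simp [h35]) (by decide) rfl rfl (by omega) (by omega)
    ?_ ?_ ?_) (by simp [Expr.cost]; omega)
  · exact ⟨hc, fun z hz => by omega⟩
  · rintro z s' hz hx hk ⟨hI1, hI2⟩
    have hp' := hpar.keeps hk
    have r33 : s'.reg 33 = i := (hk.reg 33).trans h33
    rw [zero_add] at hx
    refine Exec.le (Exec.seq (Exec.of_vc ⟨by simp [r33]; omega, by simp [hx]; omega, ?_⟩))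
      (?_ : 3 + ((M * 24 + 13) + 9) ≤ _)
    swap
    · omega
    simp only [Expr.eval_reg, r33, hx]
    have hz3 : ∀ u ∈ B i, Function.update c i z u < 3 := fun u _ => by
      rw [Function.update_apply]
      split
      · exact hz
      · exact hc3 u
    refine Exec.seq ((Exec.frame (exec_progEncode (s := s'.put 16 i z) (i := i) (L := B i)
      (c := Function.update c i z) (by omega) (hp'.rows i hi) (hnb.length_le i)
      (fun u hu => hnb.lt_of_mem hW hi hu) (hW.row_i hi) (by omega) hW.pow_lt ?_ hz3
      (by simp [hp'.r6]) (by simp [r33]))).mono le_rfl ?_)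
    · intro u hu
      rw [State.put_arr, if_pos rfl, Function.update_apply, Function.update_apply]
      split
      · rfl
      · rename_i hne
        exact hI1 u hu hne
    · rintro s₁ ⟨hk₁, h25⟩
      have hp₁ := hp'.congr (s' := s₁) (fun x hx => by
        simp only [List.mem_cons, List.not_mem_nil, or_false] at hx
        rcases hx with rfl | rfl | rfl | rfl | rfl <;> exact (hk₁.reg _).trans (by simp))
        (fun a ha => by
        simp only [List.mem_cons, List.not_mem_nil, or_false] at ha
        rcases ha with rfl | rfl <;> exact (hk₁.arr _).trans (by simp))
      have q33 : s₁.reg 33 = i := (hk₁.reg 33).trans (by simp [r33])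
      have q34 : s₁.reg 34 = z := (hk₁.reg 34).trans (by simp [hx])
      have q16 : s₁.arr 16 = _ := hk₁.arr 16
      have q17 : s₁.arr 17 = s'.arr 17 := (hk₁.arr 17).trans (by simp)
      have hcode : codeOf (Function.update c i z) (B i) < 3 ^ M :=
        (codeOf_lt hz3).trans_le (Nat.pow_le_pow_right (by omega) (hnb.length_le i))
      have hrow := hW.row_le hi hcode
      have hb := hW.budget
      have hpw := hW.pow_lt
      refine Exec.of_vc ⟨by simp [q34]; omega, ?_, ?_⟩
      · simp [q33, hp₁.r7, h25, hp₁.r4]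
        omega
      · simp only [Expr.eval_reg, Expr.eval_add, Expr.eval_mul, q33, hp₁.r7, h25, hp₁.r4, q34]
        refine ⟨fun u hu hui => ?_, fun y hy => ?_⟩
        · simp only [State.set_arr, State.put_arr, Nat.reduceEqDiff, if_false, q16, if_true]
          rw [Function.update_of_ne hui]
          exact hI1 u hu hui
        · simp only [State.set_arr, State.put_arr, if_true]
          rw [Function.update_apply]
          split
          · rename_i hyz
            rw [hyz]
          · rw [q17]
            exact hI2 y (by omega)
  · rintro s' - - ⟨-, h⟩
    exact h

/-- The number of steps of `progElimRow`, at most. -/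
def elimRowCost (M ℓ : ℕ) : ℕ :=
  (M * 22 + 11) + ((3 * (M * 24 + 33) + 6) + (8 + ((ℓ + 1) * ((ℓ + 1) * 114 + 42) + 6)))

theorem exec_progElimRow {s : State} {i p x K : ℕ} {H : Costs} (hW : Limits W n M ℓ)
    (hnb : Numbering n M adj num vert B) (hpar : HasParams n M ℓ B s) (hi : i ≤ n)
    (hp : p < i) (hx : x < 3 ^ M) (hsub : ∀ u ∈ B i, u ≠ i → u ∈ B p)
    (hH : Local B H) (hbd : BoundedBy H (i + 1) K) (hK : K < W)
    (htp : ∀ a < ℓ + 1, s.arr 15 ((p * 3 ^ M + x) * (ℓ + 1) + a) = H p (colorsOf (B p) x) a)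
    (hti : ∀ y < 3 ^ M, ∀ a < ℓ + 1,
      s.arr 15 ((i * 3 ^ M + y) * (ℓ + 1) + a) = H i (colorsOf (B i) y) a)
    (h22 : s.reg 22 = p) (h23 : s.reg 23 = x) (h33 : s.reg 33 = i) (h35 : s.reg 35 = 3) :
    Exec W progElimRow s (elimRowCost M ℓ) fun s' =>
      (∀ a < ℓ + 1, s'.arr 15 ((p * 3 ^ M + x) * (ℓ + 1) + a) =
        elimStep H i p p (colorsOf (B p) x) a) ∧
      ∀ y, y < (p * 3 ^ M + x) * (ℓ + 1) ∨ (p * 3 ^ M + x) * (ℓ + 1) + (ℓ + 1) ≤ y →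
        s'.arr 15 y = s.arr 15 y := by
  have hWn := hW.n_lt
  have hW4 := hW.four
  have hpw := hW.pow_lt
  have hb := hW.budget
  have hrow := hW.row_le (i := p) (by omega) hx
  set c := colorsOf (B p) x with hc
  have hc3 : ∀ u, c u < 3 := colorsOf_lt _ _
  refine Exec.seq ((Exec.frame (exec_progDecode (by omega) (hpar.rows p (by omega))
    (hnb.nodup p) (hnb.length_le p) (fun u hu => hnb.lt_of_mem hW (by omega) hu)
    (hW.row_i (by omega)) (by omega) (by omega) hpar.r6 h22 h23)).mono le_rfl ?_)
  rintro s₁ ⟨hk₁, hcol⟩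
  have hp₁ := hpar.keeps hk₁
  refine Exec.seq ((Exec.frame (exec_progRowBases (i := i) (c := c) hW hnb hp₁ hi
    (fun u hu hui => hcol u (hsub u hu hui)) hc3 ((hk₁.reg 33).trans h33)
    ((hk₁.reg 35).trans h35))).mono le_rfl ?_)
  rintro s₂ ⟨hk₂, h17⟩
  have hp₂ := hp₁.keeps hk₂
  have q22 : s₂.reg 22 = p := (hk₂.reg 22).trans ((hk₁.reg 22).trans h22)
  have q23 : s₂.reg 23 = x := (hk₂.reg 23).trans ((hk₁.reg 23).trans h23)
  have q15 : s₂.arr 15 = s.arr 15 := (hk₂.arr 15).trans (hk₁.arr 15)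
  refine Exec.seq (Exec.of_vc ⟨?_, ?_⟩)
  · simp [q22, hp₂.r7, q23, hp₂.r4]
    omega
  simp only [Expr.eval_reg, Expr.eval_add, Expr.eval_mul, q22, hp₂.r7, q23, hp₂.r4]
  set R := (p * 3 ^ M + x) * (ℓ + 1) with hR
  have hz3 : ∀ z < 3, ∀ u ∈ B i, Function.update c i z u < 3 := fun z hz u _ => by
    rw [Function.update_apply]
    split
    · exact hz
    · exact hc3 u
  have hcode : ∀ z < 3, codeOf (Function.update c i z) (B i) < 3 ^ M := fun z hz =>
    (codeOf_lt (hz3 z hz)).trans_le (Nat.pow_le_pow_right (by omega) (hnb.length_le i))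
  have hne : ∀ y, i * 3 ^ M + y ≠ p * 3 ^ M + x := fun y h => by
    have := Nat.mul_le_mul_right (3 ^ M) (Nat.succ_le_of_lt hp)
    rw [Nat.succ_mul] at this
    omega
  refine (exec_progCombine (s := s₂.set 31 R) (ℓ := ℓ) (R := R)
    (base := fun z => (i * 3 ^ M + codeOf (Function.update c i z) (B i)) * (ℓ + 1))
    (g := H p c) (g' := fun z => H i (Function.update c i z)) (by omega) hb
    (fun b b' z => (hbd.add_le hp c _ b b').trans_lt hK)
    (hW.row_lt (by omega) hx (by omega))
    (fun z hz => hW.row_lt hi (hcode z hz) (by omega))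
    (fun z hz b hb => row_disjoint (hne _) hb) ?_ ?_ (by simpa using h17) (by simp)
    (by simp [hp₂.r3]) (by simp [hp₂.r4])).mono le_rfl ?_
  · intro b hb
    rw [State.set_arr, q15]
    exact htp b hb
  · intro z hz b hb
    rw [State.set_arr, q15, hti _ (hcode z hz) b hb]
    exact congrFun (hH i _ _ fun u hu => colorsOf_codeOf (hz3 z hz) hu) b
  · rintro s' ⟨h1, h2⟩
    refine ⟨fun a ha => ?_, fun y hy => ?_⟩
    · rw [h1 a ha, elimStep, Function.update_self]
    · rw [h2 y hy, State.set_arr, q15]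

theorem tableRow_elimStep_of_ne {P r a i p : ℕ} {H : Costs} (h : r / P ≠ p) :
    tableRow B P (elimStep H i p) r a = tableRow B P H r a := by
  rw [tableRow, tableRow, elimStep, Function.update_of_ne h]

theorem exec_progEliminate {s : State} {K : ℕ} {H : Costs} (hW : Limits W n M ℓ)
    (hnb : Numbering n M adj num vert B) (hpar : HasParams n M ℓ B s)
    (hH : Local B H) (hbd : BoundedBy H (n + 1) K) (hK : K < W)
    (ht : ∀ r < (n + 1) * 3 ^ M, ∀ a < ℓ + 1,
      s.arr 15 (r * (ℓ + 1) + a) = tableRow B (3 ^ M) H r a) :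
    Exec W progEliminate s (n * (3 ^ M * (elimRowCost M ℓ + 8) + M * 26 + 29) + 8) fun s' =>
      ∀ r < (n + 1) * 3 ^ M, ∀ a < ℓ + 1, s'.arr 15 (r * (ℓ + 1) + a) =
        tableRow B (3 ^ M) (eliminated H (fun i => parentOf i (B i)) n n) r a := by
  have hWn := hW.n_lt
  have hW4 := hW.four
  have hpw := hW.pow_lt
  have hsubs : ∀ i, 1 ≤ i → i ≤ n → ∀ u ∈ B i, u ≠ i → u ∈ B (parentOf i (B i)) :=
    fun i _ hi u hu hui => hnb.mem_parentOf hi hu hui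
  have hlts : ∀ i, 1 ≤ i → i ≤ n → parentOf i (B i) < i := fun i h1 _ => parentOf_lt h1 _
  refine Exec.le (Exec.seq (Exec.of_vc ⟨by simp; omega, ?_⟩))
    (?_ : 2 + (n * (3 ^ M * (elimRowCost M ℓ + 8) + M * 26 + 29) + 6) ≤ _)
  swap
  · omega
  refine Exec.le (Exec.forUp (fun d s' => ∀ r < (n + 1) * 3 ^ M, ∀ a < ℓ + 1,
      s'.arr 15 (r * (ℓ + 1) + a) =
        tableRow B (3 ^ M) (eliminated H (fun i => parentOf i (B i)) n d) r a) 0 n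
    (3 ^ M * (elimRowCost M ℓ + 8) + M * 26 + 21)
    (by simp; omega) rfl (by simp [hpar.r1]) (by decide) rfl rfl (by omega) (by omega) ?_ ?_ ?_)
    (by simp [Expr.cost, add_assoc]; omega)
  · exact ht
  · intro d s' hd hx hk hI
    rw [zero_add] at hx
    set i := n - d with hid
    have hin : i ≤ n := by omega
    have hi1 : 1 ≤ i := by omega
    set G := eliminated H (fun i => parentOf i (B i)) n d with hG
    set p := parentOf i (B i) with hpd
    have hpi : p < i := hlts i hi1 hin
    have hGl : Local B G := hH.eliminated hsubs hd.le
    have hGb : BoundedBy G (i + 1) K := by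
      have := hbd.eliminated hlts hd.le
      rwa [show n + 1 - d = i + 1 by omega] at this
    have hp' := hpar.congr (s' := s') (fun x hx => by
      simp only [List.mem_cons, List.not_mem_nil, or_false] at hx
      rcases hx with rfl | rfl | rfl | rfl | rfl <;> exact (hk.reg _).trans (by simp)) (fun a ha => by
      simp only [List.mem_cons, List.not_mem_nil, or_false] at ha
      rcases ha with rfl | rfl <;> exact (hk.arr _).trans (by simp))
    have r35 : s'.reg 35 = 3 := (hk.reg 35).trans (by simp)
    refine Exec.le (Exec.seq (Exec.of_vc ⟨by simp [hp'.r1, hx]; omega, ?_⟩))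
      (?_ : 4 + ((M * 26 + 11) + (3 ^ M * (elimRowCost M ℓ + 8) + 6)) ≤ _)
    swap
    · omega
    simp only [Expr.eval_sub, Expr.eval_reg, hp'.r1, hx, ← hid]
    refine Exec.seq ((Exec.frame (exec_progParent (s := s'.set 33 i) (i := i) (L := B i) (M := M)
      (by omega) (hp'.rows i hin) (hnb.length_le i) (fun u hu => hnb.lt_of_mem hW hin hu)
      (hW.row_i hin) (by omega) (by simp [hp'.r6]) (by simp))).mono le_rfl ?_)
    rintro s₁ ⟨hk₁, h22⟩
    have hp₁ := (hp'.congr (s' := s'.set 33 i) (by simp) (by simp)).keeps hk₁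
    have q35 : s₁.reg 35 = 3 := (hk₁.reg 35).trans (by simp [r35])
    have q33 : s₁.reg 33 = i := (hk₁.reg 33).trans (by simp)
    have q15 : s₁.arr 15 = s'.arr 15 := (hk₁.arr 15).trans (by simp)
    refine Exec.le (Exec.forUp (fun x s₂ => ∀ r < (n + 1) * 3 ^ M, ∀ a < ℓ + 1,
        s₂.arr 15 (r * (ℓ + 1) + a) = if r < p * 3 ^ M + x then
          tableRow B (3 ^ M) (elimStep G i p) r a else tableRow B (3 ^ M) G r a) 0 (3 ^ M)
      (elimRowCost M ℓ) (by simp; omega) rfl (by simp [hp₁.r7]) (by decide) rfl rfl (by omega)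
      (by omega) ?_ ?_ ?_) (by simp [Expr.cost]; omega)
    · intro r hr a ha
      rw [State.set_arr, q15, hI r hr a ha]
      split
      · rw [tableRow_elimStep_of_ne]
        have : r / 3 ^ M < p := by
          rw [Nat.div_lt_iff_lt_mul (by positivity)]
          omega
        omega
      · rfl
    · intro x s₂ hxP hx₂ hk₂ hI₂
      rw [zero_add] at hx₂
      have hrlt : ∀ j y, j ≤ n → y < 3 ^ M → j * 3 ^ M + y < (n + 1) * 3 ^ M := fun j y hj hy => by
        have := Nat.mul_le_mul_right (3 ^ M) hj
        rw [Nat.add_mul]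
        omega
      have hip := Nat.mul_le_mul_right (3 ^ M) (Nat.succ_le_of_lt hpi)
      rw [Nat.succ_mul] at hip
      refine (exec_progElimRow (s := s₂) (i := i) (p := p) (x := x) (H := G) hW hnb
        (hp₁.keeps hk₂) hin hpi hxP (hsubs i hi1 hin) hGl hGb hK ?_ ?_ ((hk₂.reg 22).trans h22) hx₂
        ((hk₂.reg 33).trans q33) ((hk₂.reg 35).trans q35)).mono le_rfl ?_
      · intro a ha
        rw [hI₂ _ (hrlt p x (by omega) hxP) a ha, if_neg (by omega), tableRow_eq hxP]
      · intro y hy a ha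
        rw [hI₂ _ (hrlt i y hin hy) a ha, if_neg (by omega), tableRow_eq hy]
      · rintro s₃ ⟨h3, h4⟩ r hr a ha
        rw [State.set_arr]
        rcases eq_or_ne r (p * 3 ^ M + x) with rfl | hne
        · rw [h3 a ha, if_pos (by omega), tableRow_eq hxP]
        · rw [h4 _ (row_disjoint hne ha), hI₂ r hr a ha]
          have : r < p * 3 ^ M + x ↔ r < p * 3 ^ M + (x + 1) := by omega
          simp only [this]
    · intro s₂ _ _ hI₂ r hr a ha
      change s₂.arr 15 _ = tableRow B (3 ^ M) (elimStep G i p) r a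
      rw [hI₂ r hr a ha]
      split
      · rfl
      · rename_i hge
        rw [tableRow_elimStep_of_ne]
        have : p + 1 ≤ r / 3 ^ M := by
          rw [Nat.le_div_iff_mul_le (by positivity), Nat.add_mul]
          omega
        omega
  · intro s' _ _ hI
    exact hI

end Exec

/-! ### The whole program -/

/-- Writes the answer to register `0`: whether the table of the vertex `0` allows `ℓ` attacks with
at most `n - α` survivors. -/
def progAnswer : Program :=
  .assign 0 (1 - .lt (.reg 1) (.cell 15 (.reg 3) + .reg 5))

/-- The algorithm for `α ≤ n`, after the parameters are loaded. -/
def progSolve : Program :=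
  progDefense ⨟ progBagSize ⨟ progPow ⨟ progSearch ⨟ progNumber ⨟ progInit ⨟ progEliminate ⨟
    progAnswer

/-- The algorithm. If `α` exceeds the number of vertices, the answer is negative. -/
def progMain : Program :=
  progLoad ⨟ .branch (.lt (.reg 1) (.reg 5)) (.assign 0 0) progSolve

theorem Lists.length_le {n : ℕ} {L : List ℕ} {S : Set (Fin n)} (h : Lists L S) :
    L.length ≤ n := by
  rw [← List.toFinset_card_of_nodup h.1, ← Finset.card_range n]
  exact Finset.card_le_card fun x hx => Finset.mem_range.2 (h.lt (List.mem_toFinset.1 hx))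

section Solve

variable {W n N M ℓ α : ℕ}

/-- The input is given in the arrays `1` to `7` of the state, the parameters are in registers, and
the arrays that the algorithm works with are zero. -/
structure IsInput (n N ℓ α : ℕ) (L : List ℕ) (adj LT LB : ℕ → List ℕ) (s : State) : Prop where
  r1 : s.reg 1 = n
  r2 : s.reg 2 = N
  r3 : s.reg 3 = ℓ
  r4 : s.reg 4 = ℓ + 1
  r5 : s.reg 5 = α
  r8 : s.reg 8 = L.length
  defense : ∀ j (hj : j < L.length), s.arr 1 j = L[j]
  graph : Stored (s.arr 2) (s.arr 3) adj n
  tree : Stored (s.arr 4) (s.arr 5) LT N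
  bags : Stored (s.arr 6) (s.arr 7) LB N
  zero : ∀ a, 8 ≤ a → ∀ i, s.arr a i = 0

/-- The running time of `progSolve`, summed over its parts. -/
def solveCost (n N M ℓ : ℕ) : ℕ :=
  (n * 12 + 6) + ((N * 26 + 8) + ((M * 12 + 8) + ((N * 80 + 16) +
    ((N * (M * (M * 27 + 38) + 25) + 8) +
      ((n * (3 ^ M * (M * 86 + (ℓ + 1) * 24 + 56) + 25) + 10) +
        ((n * (3 ^ M * (elimRowCost M ℓ + 8) + M * 26 + 29) + 8) + 9))))))

theorem exec_progSolve {s : State} {G : SimpleGraph (Fin n)} {D : Finset (Fin n)}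
    {T : SimpleGraph (Fin N)} {bag : Fin N → Finset (Fin n)} {L : List ℕ}
    {adj LT LB : ℕ → List ℕ} (hTD : IsTreeDecomposition G T bag)
    (hL : Lists L (D : Set (Fin n)))
    (hadj : ∀ v : Fin n, Lists (adj v) (G.neighborSet v))
    (hLT : ∀ t : Fin N, Lists (LT t) (T.neighborSet t))
    (hLB : ∀ t : Fin N, Lists (LB t) (bag t : Set (Fin n)))
    (hlenM : ∀ t, (LB t).length ≤ M)
    (hMeq : ((Finset.range N).sup fun t => (LB t).length) = M)
    (hin : IsInput n N ℓ α L adj LT LB s) (hW : Limits W n M ℓ) (hN : N + 1 < W) (hM : M + 1 < W)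
    (hoffG : ∀ v ≤ n, s.arr 2 v < W) (hoffT : ∀ t ≤ N, s.arr 4 t < W)
    (hoffB : ∀ t ≤ N, s.arr 6 t < W) (hα : (n + 1) * ((n + 1) * (n + 3)) + α < W) (hαn : α ≤ n) :
    Exec W progSolve s (solveCost n N M ℓ) fun s' =>
      (FixedDefensePureAttack G D ℓ α → s'.reg 0 = 1) ∧
        (¬ FixedDefensePureAttack G D ℓ α → s'.reg 0 = 0) := by
  have hW4 := hW.four
  have hWn := hW.n_lt
  have hLlt : ∀ x ∈ L, x < n := fun x hx => hL.lt hx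
  have hLlen : L.length ≤ n := hL.length_le
  have hadjlt : ∀ v < n, ∀ w ∈ adj v, w < n := fun v hv w hw => (hadj ⟨v, hv⟩).lt hw
  have hadjlen : ∀ v < n, (adj v).length ≤ n := fun v hv => (hadj ⟨v, hv⟩).length_le
  refine Exec.seq (((exec_progDefense (by omega) hin.defense hin.r8
    (fun x hx => by have := hLlt x hx; omega) (by omega)).le (by omega)).frame.mono le_rfl ?_)
  rintro s1 ⟨k1, h1⟩
  refine Exec.seq ((exec_progBagSize (LB := LB) (N := N) (by omega) (by
    rw [k1.arr 6, k1.arr 7]; exact hin.bags) (by rw [k1.reg 2, hin.r2]) hN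
    (by rw [k1.arr 6]; exact hoffB)).frame.mono le_rfl ?_)
  rintro s2 ⟨k2, h2⟩
  rw [hMeq] at h2
  refine Exec.seq ((exec_progPow h2 (by omega) hW.pow_lt (by omega)).frame.mono le_rfl ?_)
  rintro s3 ⟨k3, h3⟩
  refine Exec.seq ((exec_progSearch (LT := LT) hTD.isTree hLT hN
    (by rw [k3.arr 4, k3.arr 5, k2.arr 4, k2.arr 5, k1.arr 4, k1.arr 5]; exact hin.tree)
    (by rw [k3.arr 4, k2.arr 4, k1.arr 4]; exact hoffT)
    (by rw [k3.reg 2, k2.reg 2, k1.reg 2, hin.r2])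
    (by rw [k3.arr 9, k2.arr 9, k1.arr 9]; exact hin.zero 9 (by omega))).frame.mono le_rfl ?_)
  rintro s4 ⟨k4, hQ, hinj, hpar⟩
  refine Exec.seq ((exec_progNumber (M := M) (LB := LB) (LT := LT) hTD hadj hLT hLB hlenM
    (by rw [k4.arr 6, k4.arr 7, k3.arr 6, k3.arr 7, k2.arr 6, k2.arr 7, k1.arr 6, k1.arr 7]
        exact hin.bags)
    (by rw [k4.arr 6, k3.arr 6, k2.arr 6, k1.arr 6]; exact hoffB) hN (by omega) hW.row hM
    (by rw [k4.reg 2, k3.reg 2, k2.reg 2, k1.reg 2, hin.r2])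
    (by rw [k4.reg 6, k3.reg 6, h2]) hQ hinj hpar
    (by rw [k4.arr 11, k3.arr 11, k2.arr 11, k1.arr 11]; exact hin.zero 11 (by omega))
    (by rw [k4.arr 14, k3.arr 14, k2.arr 14, k1.arr 14]
        exact hin.zero 14 (by omega) 0)).frame.mono le_rfl ?_)
  rintro s5 ⟨k5, B, hnb, hrows⟩
  have hP5 : HasParams n M ℓ B s5 :=
    ⟨by rw [k5.reg 1, k4.reg 1, k3.reg 1, k2.reg 1, k1.reg 1, hin.r1],
      by rw [k5.reg 3, k4.reg 3, k3.reg 3, k2.reg 3, k1.reg 3, hin.r3],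
      by rw [k5.reg 4, k4.reg 4, k3.reg 4, k2.reg 4, k1.reg 4, hin.r4],
      by rw [k5.reg 6, k4.reg 6, k3.reg 6, h2], by rw [k5.reg 7, k4.reg 7, h3], hrows⟩
  have hdfl : ∀ v, s5.arr 8 v = if v ∈ L then 1 else 0 := fun v => by
    rw [k5.arr 8, k4.arr 8, k3.arr 8, k2.arr 8, h1 v, hin.zero 8 le_rfl]
  have hdfl1 : ∀ v < n, s5.arr 8 v ≤ 1 := fun v _ => by rw [hdfl v]; split <;> omega
  have hsum : ∑ j ∈ Finset.range n, (adj (s5.arr 12 (j + 1))).length ≤ 2 * M * n := by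
    refine le_trans (le_of_eq ?_) (hnb.sum_length_le hadj)
    have h := hnb.sum_range fun j => if j = 0 then 0 else (adj (s5.arr 12 j)).length
    rw [Finset.sum_range_succ', if_pos rfl, add_zero, zero_add] at h
    simp only [Nat.add_eq_zero_iff, one_ne_zero, and_false, if_false] at h
    rw [h]
    refine Finset.sum_congr rfl fun v _ => ?_
    rw [if_neg (by have := hnb.num_mem v v.2; omega), hnb.vert_num v v.2]
  have hcost : ∑ j ∈ Finset.range n, (3 ^ M * (M * 22 + (adj (s5.arr 12 (j + 1))).length * 32 +
      (ℓ + 1) * 24 + 56) + 25) + 10 ≤ n * (3 ^ M * (M * 86 + (ℓ + 1) * 24 + 56) + 25) + 10 := by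
    have h : ∀ j, 3 ^ M * (M * 22 + (adj (s5.arr 12 (j + 1))).length * 32 +
        (ℓ + 1) * 24 + 56) + 25 = 3 ^ M * 32 * (adj (s5.arr 12 (j + 1))).length +
        (3 ^ M * (M * 22 + (ℓ + 1) * 24 + 56) + 25) := fun j => by ring
    rw [Finset.sum_congr rfl fun j _ => h j, Finset.sum_add_distrib, ← Finset.mul_sum,
      Finset.sum_const, Finset.card_range, smul_eq_mul]
    have := Nat.mul_le_mul_left (3 ^ M * 32) hsum
    linarith
  refine Exec.seq (((exec_progInit (adj := adj) hW hnb hP5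
    (by rw [k5.arr 2, k5.arr 3, k4.arr 2, k4.arr 3, k3.arr 2, k3.arr 3, k2.arr 2, k2.arr 3,
          k1.arr 2, k1.arr 3]
        exact hin.graph)
    (by rw [k5.arr 2, k4.arr 2, k3.arr 2, k2.arr 2, k1.arr 2]; exact hoffG)
    hadjlt hadjlen rfl rfl rfl hdfl1
    (by rw [k5.arr 15, k4.arr 15, k3.arr 15, k2.arr 15, k1.arr 15]
        exact hin.zero 15 (by omega))).le hcost).frame.mono le_rfl ?_)
  rintro s6 ⟨k6, h6⟩
  have hbd := boundedBy_initCosts (num := s5.arr 11) hdfl1 hnb.vert_lt hadjlen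
  refine Exec.seq ((exec_progEliminate hW hnb (hP5.keeps k6) hnb.local_initCosts hbd hW.cost
    h6).frame.mono le_rfl ?_)
  rintro s7 ⟨k7, h7⟩
  have hlts : ∀ i, 1 ≤ i → i ≤ n → parentOf i (B i) < i := fun i hi _ => parentOf_lt hi _
  have hcell := h7 0 (by positivity) ℓ (by omega)
  rw [zero_mul, zero_add, tableRow, Nat.zero_div] at hcell
  have hle := (hbd.eliminated hlts le_rfl).le (p := 0) (by omega)
    (colorsOf (B 0) (0 % 3 ^ M)) ℓ
  have hiff := (hnb.fixedDefensePureAttack_iff hadj (D := D) (ℓ := ℓ) (α := α)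
    (dfl := s5.arr 8) (fun v => by
      rw [hdfl]
      refine if_congr ?_ rfl rfl
      rw [hL.2]
      constructor
      · rintro ⟨w, hw, hwv⟩
        rwa [← Fin.ext hwv]
      · exact fun hv => ⟨v, hv, rfl⟩) hαn).trans
    (eliminated_le_iff hnb.local_initCosts
      (fun i _ hi u hu hui => hnb.mem_parentOf hi hu hui) hlts
      (fun i u hu => (hnb.mem_range i u hu).2) hnb.eq_nil_zero
      (colorsOf (B 0) (0 % 3 ^ M)) ℓ (n - α)).symm
  rw [← hcell] at hle hiff
  have r1 : s7.reg 1 = n := by rw [k7.reg 1, k6.reg 1, hP5.r1]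
  have r3 : s7.reg 3 = ℓ := by rw [k7.reg 3, k6.reg 3, hP5.r3]
  have r5 : s7.reg 5 = α := by
    rw [k7.reg 5, k6.reg 5, k5.reg 5, k4.reg 5, k3.reg 5, k2.reg 5, k1.reg 5, hin.r5]
  have hb := hW.budget
  refine Exec.le (Exec.of_vc ?_) (by decide)
  have hite := ite_one_zero_lt (W := W) (by omega) (n < s7.arr 15 ℓ + α)
  refine ⟨?_, fun h => ?_, fun h => ?_⟩
  · simp only [Expr.fits_sub, Expr.fits_ofNat, Expr.fits_lt, Expr.fits_add, Expr.fits_cell,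
      Expr.fits_reg, Expr.eval_ofNat, Expr.eval_lt, Expr.eval_add, Expr.eval_cell, Expr.eval_reg,
      r1, r3, r5]
    omega
  · have := hiff.1 h
    have hn : ¬ n < s7.arr 15 ℓ + α := by omega
    simp [r1, r3, r5, hn]
  · have := mt hiff.2 h
    have hn : n < s7.arr 15 ℓ + α := by omega
    simp [r1, r3, r5, hn]

end Solve

/-! ### The input, the word limit and the running time -/

theorem getD_offsets {L : List (List ℕ)} {t : ℕ} (ht : t ≤ L.length) :
    (offsets L).getD t 0 = (L.take t).flatten.length := by
  rw [offsets, List.getD_eq_getElem _ _ (by simp; omega), List.getElem_scanl, ← List.map_take,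
    List.length_flatten, List.sum_eq_foldl]

theorem stored_offsets (L : List (List ℕ)) :
    Stored (fun i => (offsets L).getD i 0) (fun i => L.flatten.getD i 0) (fun t => L.getD t [])
      L.length := by
  refine ⟨fun t ht => ?_, fun t ht j hj => ?_⟩
  · rw [getD_offsets ht.le, getD_offsets ht, List.getD_eq_getElem _ _ ht,
      ← List.take_append_getElem ht, List.flatten_append, List.length_append,
      List.flatten_singleton]
  · have hsplit : L.flatten = (L.take t).flatten ++ (L.getD t [] ++ (L.drop (t + 1)).flatten) := by
      rw [List.getD_eq_getElem _ _ ht, ← List.flatten_cons, List.cons_getElem_drop_succ,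
        ← List.flatten_append, List.take_append_drop]
    simp only [getD_offsets ht.le]
    rw [hsplit, List.getD_append_right _ _ _ _ (by omega), Nat.add_sub_cancel_left,
      List.getD_append _ _ _ _ hj, List.getD_eq_getElem _ _ hj]

theorem getD_offsets_le {L : List (List ℕ)} {b t : ℕ} (h : ∀ l ∈ L, l.length ≤ b)
    (ht : t ≤ L.length) : (offsets L).getD t 0 ≤ L.length * b := by
  rw [getD_offsets ht, List.length_flatten]
  refine (List.sum_le_card_nsmul _ b ?_).trans ?_
  · intro x hx
    obtain ⟨l, hl, rfl⟩ := List.mem_map.1 hx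
    exact h l (List.mem_of_mem_take hl)
  · rw [List.length_map, List.length_take, smul_eq_mul, min_eq_left ht]
    exact Nat.mul_le_mul_right _ ht

theorem ListsFamily.length_le {m n : ℕ} {L : List (List ℕ)} {F : Fin m → Set (Fin n)}
    (h : ListsFamily L F) : ∀ l ∈ L, l.length ≤ n := by
  intro l hl
  obtain ⟨i, hi, rfl⟩ := List.getElem_of_mem hl
  have := h.2 ⟨i, h.1 ▸ hi⟩
  rw [List.getD_eq_getElem _ _ hi] at this
  exact this.length_le

/-- The factors `tw + 1`, `3 ^ (tw + 1)` and `ℓ + 1` of the running time are at most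
`2 * max tw 1`, `3 * 9 ^ tw` and `2 * ℓ`. The summand `23` is for loading the parameters and
comparing `α` with `n`. -/
theorem solveCost_le {n N ℓ tw : ℕ} (hℓ : 0 < ℓ) (hN : 0 < N) :
    23 + solveCost n N (tw + 1) ℓ ≤ 5000 * timeBound tw ℓ n N := by
  rw [timeBound, solveCost]
  have hM : tw + 1 ≤ 2 * max tw 1 := by omega
  have hm : 1 ≤ max tw 1 := by omega
  generalize max tw 1 = m at *
  have h3 : 3 ^ (tw + 1) ≤ 3 * 9 ^ tw := by
    rw [pow_succ, mul_comm]
    exact Nat.mul_le_mul_left _ (Nat.pow_le_pow_left (by omega) _)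
  have hE : 1 ≤ 9 ^ tw := Nat.one_le_pow _ _ (by omega)
  generalize 3 ^ (tw + 1) = P at *
  generalize 9 ^ tw = E at *
  generalize tw + 1 = M at *
  have hmm : m ≤ m ^ 2 := Nat.le_self_pow (by omega) m
  have hll : ℓ ≤ ℓ ^ 2 := Nat.le_self_pow (by omega) ℓ
  have hMM : M * M ≤ 4 * m ^ 2 := by nlinarith
  have hl2 : (ℓ + 1) * (ℓ + 1) ≤ 4 * ℓ ^ 2 := by nlinarith
  have h1 : m ^ 2 ≤ m ^ 2 * ℓ ^ 2 := Nat.le_mul_of_pos_right _ (by positivity)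
  have h2 : ℓ ^ 2 ≤ m ^ 2 * ℓ ^ 2 := Nat.le_mul_of_pos_left _ (by positivity)
  have hU : E * m ^ 2 * ℓ ^ 2 * n = n * (E * (m ^ 2 * ℓ ^ 2)) := by ring
  rw [hU]
  generalize hUdef : m ^ 2 * ℓ ^ 2 = U at *
  have hrow : elimRowCost M ℓ ≤ 1000 * U := by
    have : (ℓ + 1) * ((ℓ + 1) * 114 + 42) = 114 * ((ℓ + 1) * (ℓ + 1)) + 42 * (ℓ + 1) := by ring
    rw [elimRowCost, this]
    omega
  have hUE : U ≤ E * U := Nat.le_mul_of_pos_left _ hE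
  have hinit : P * (M * 86 + (ℓ + 1) * 24 + 56) ≤ 900 * (E * U) :=
    (Nat.mul_le_mul h3 (by omega : _ ≤ 300 * U)).trans (le_of_eq (by ring))
  have helim : P * (elimRowCost M ℓ + 8) ≤ 3024 * (E * U) :=
    (Nat.mul_le_mul h3 (by omega : _ ≤ 1008 * U)).trans (le_of_eq (by ring))
  have hn1 := Nat.mul_le_mul_left n (by omega :
    P * (M * 86 + (ℓ + 1) * 24 + 56) + 25 ≤ 925 * (E * U))
  have hn2 := Nat.mul_le_mul_left n (by omega :
    P * (elimRowCost M ℓ + 8) + M * 26 + 29 ≤ 3105 * (E * U))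
  have hn3 : n ≤ n * (E * U) := Nat.le_mul_of_pos_right _ (by omega)
  have hN1 : N * (M * (M * 27 + 38) + 25) ≤ N * (209 * m ^ 2) := by
    refine Nat.mul_le_mul_left _ ?_
    have : M * (M * 27 + 38) = 27 * (M * M) + 38 * M := by ring
    omega
  have hN2 : N ≤ m ^ 2 * N := Nat.le_mul_of_pos_left _ (by omega)
  have hN3 : m ^ 2 ≤ m ^ 2 * N := Nat.le_mul_of_pos_right _ hN
  have e1 : n * (925 * (E * U)) = 925 * (n * (E * U)) := by ring
  have e2 : n * (3105 * (E * U)) = 3105 * (n * (E * U)) := by ring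
  have e3 : N * (209 * m ^ 2) = 209 * (m ^ 2 * N) := by ring
  rw [e1] at hn1
  rw [e2] at hn2
  rw [e3] at hN1
  omega

/-- All numbers in the computation are polynomial in the input parameters and the time bound, which is
at least `n` and, for `n > 0`, at least `9 ^ tw`. -/
theorem limits_of_timeBound {n N ℓ α tw : ℕ} (hℓ : 0 < ℓ) (hα : 0 < α) (hn : 0 < n) :
    Limits ((timeBound tw ℓ n N + ℓ + α + 2) ^ 5) n (tw + 1) ℓ ∧
      tw + 1 ≤ timeBound tw ℓ n N + ℓ + α + 2 ∧ n + 3 ≤ timeBound tw ℓ n N + ℓ + α + 2 := by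
  have hE : 9 ^ tw ≤ timeBound tw ℓ n N := by
    refine le_trans ?_ (Nat.le_add_right _ _)
    rw [mul_assoc, mul_assoc]
    exact Nat.le_mul_of_pos_right _ (by positivity)
  have hnX : n ≤ timeBound tw ℓ n N := by
    refine le_trans ?_ (Nat.le_add_right _ _)
    exact Nat.le_mul_of_pos_left _ (by positivity)
  have hM : tw + 1 ≤ 9 ^ tw := Nat.lt_pow_self (by omega)
  have h3 : 3 ^ (tw + 1) ≤ 3 * 9 ^ tw := by
    rw [pow_succ, mul_comm]
    exact Nat.mul_le_mul_left _ (Nat.pow_le_pow_left (by omega) _)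
  generalize timeBound tw ℓ n N = t at *
  obtain ⟨X, hX⟩ : ∃ X, X = t + ℓ + α + 2 := ⟨_, rfl⟩
  rw [← hX]
  have hX2 : 3 * X ≤ X ^ 2 := by rw [sq]; exact Nat.mul_le_mul_right _ (by omega)
  have hpow : ∀ {i j : ℕ}, i < j → X ^ i < X ^ j := fun h => Nat.pow_lt_pow_right (by omega) h
  have h1 : X < X ^ 5 := by simpa using hpow (i := 1) (j := 5) (by omega)
  have h12 : X ^ 2 < X ^ 5 := hpow (by omega)
  refine ⟨⟨by omega, ?_, ?_, ?_, by omega⟩, by omega, by omega⟩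
  · refine lt_of_le_of_lt ?_ h12
    rw [← Nat.succ_mul, sq]
    exact Nat.mul_le_mul (by omega) (by omega)
  · refine lt_of_le_of_lt ?_ (hpow (i := 4) (by omega))
    calc (n + 1) * 3 ^ (tw + 1) * (ℓ + 1) ≤ X * X ^ 2 * X :=
          Nat.mul_le_mul (Nat.mul_le_mul (by omega) (by omega)) (by omega)
      _ = X ^ 4 := by ring
  · refine lt_of_le_of_lt ?_ (hpow (i := 3) (by omega))
    calc (n + 1) * ((n + 1) * (n + 3)) ≤ X * (X * X) :=
          Nat.mul_le_mul (by omega) (Nat.mul_le_mul (by omega) (by omega))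
      _ = X ^ 3 := by ring

/-- For a graph with a vertex, some bag is not empty, so that the subtraction in `width` is not
truncated. -/
theorem width_add_one {n N : ℕ} {G : SimpleGraph (Fin n)} {T : SimpleGraph (Fin N)}
    {bag : Fin N → Finset (Fin n)} {bags : List (List ℕ)} (hTD : IsTreeDecomposition G T bag)
    (hbags : ListsFamily bags fun t => (bag t : Set (Fin n))) (hn : 0 < n) :
    ((Finset.range N).sup fun t => (bags.getD t []).length) = width bag + 1 := by
  have h1 : ((Finset.range N).sup fun t => (bags.getD t []).length) =
      Finset.univ.sup fun t => (bag t).card := by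
    refine le_antisymm (Finset.sup_le fun t ht => ?_) (Finset.sup_le fun t _ => ?_)
    · rw [show bags.getD t [] = bags.getD (⟨t, Finset.mem_range.1 ht⟩ : Fin N) [] from rfl,
        (hbags.2 _).length_eq]
      exact Finset.le_sup (f := fun t => (bag t).card) (Finset.mem_univ _)
    · rw [← (hbags.2 t).length_eq]
      exact Finset.le_sup (f := fun t => (bags.getD t []).length) (Finset.mem_range.2 t.2)
  rw [h1, width]
  obtain ⟨t, ht⟩ := hTD.vertex_mem ⟨0, hn⟩
  have h2 := Finset.le_sup (f := fun t => (bag t).card) (Finset.mem_univ t)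
  have h3 := Finset.card_pos.2 ⟨_, ht⟩
  omega

theorem exec_progMain {n N ℓ α : ℕ} {G : SimpleGraph (Fin n)} {D : Finset (Fin n)}
    {T : SimpleGraph (Fin N)} {bag : Fin N → Finset (Fin n)} {defense : List ℕ}
    {adjG adjT bags : List (List ℕ)} (hℓ : 0 < ℓ) (hα : 0 < α) (hTD : IsTreeDecomposition G T bag)
    (hD : Lists defense (D : Set (Fin n))) (hG : ListsFamily adjG G.neighborSet)
    (hT : ListsFamily adjT T.neighborSet)
    (hB : ListsFamily bags fun t => (bag t : Set (Fin n))) :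
    Exec ((timeBound (width bag) ℓ n N + ℓ + α + 2) ^ 5) progMain
      (State.init (inputArrays n N ℓ α defense adjG adjT bags))
      (5000 * timeBound (width bag) ℓ n N) fun s =>
        (FixedDefensePureAttack G D ℓ α → s.reg 0 = 1) ∧
          (¬ FixedDefensePureAttack G D ℓ α → s.reg 0 = 0) := by
  set s := State.init (inputArrays n N ℓ α defense adjG adjT bags) with hs
  have hN : 0 < N := by
    obtain ⟨t⟩ := hTD.isTree.connected.nonempty
    exact t.pos
  have hcost := solveCost_le (n := n) (tw := width bag) hℓ hN
  have hNX : N ≤ timeBound (width bag) ℓ n N := by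
    refine le_trans ?_ (Nat.le_add_left _ _)
    exact Nat.le_mul_of_pos_left _ (by positivity)
  have hnX : n ≤ timeBound (width bag) ℓ n N := by
    refine le_trans ?_ (Nat.le_add_right _ _)
    exact Nat.le_mul_of_pos_left _ (by positivity)
  have hlim : 0 < n → _ := fun h => limits_of_timeBound (N := N) (tw := width bag) hℓ hα h
  generalize timeBound (width bag) ℓ n N = t at *
  obtain ⟨X, hX⟩ : ∃ X, X = t + ℓ + α + 2 := ⟨_, rfl⟩
  rw [← hX] at hlim ⊢
  have hXW : 5 * X ≤ X ^ 2 := by rw [sq]; exact Nat.mul_le_mul_right _ (by omega)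
  have hX2W : X ^ 2 * 5 ≤ X ^ 5 := by
    calc X ^ 2 * 5 ≤ X ^ 2 * X ^ 3 := Nat.mul_le_mul_left _ (by
          calc 5 ≤ X := by omega
            _ ≤ X ^ 3 := Nat.le_self_pow (by omega) X)
      _ = X ^ 5 := by ring
  have harr : ∀ i, s.arr 0 i < X ^ 5 := fun i => by
    have hd := hD.length_le
    rcases i with _ | _ | _ | _ | _ | i <;>
      simp [hs, State.init, inputArrays] <;> omega
  refine Exec.le (Exec.seq ((exec_progLoad (by omega) harr (by
    simp [hs, State.init, inputArrays]; omega)).frame.mono le_rfl ?_)) (le_trans (?_ :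
      19 + (4 + solveCost n N (width bag + 1) ℓ) ≤ _) hcost)
  swap
  · omega
  rintro s1 ⟨k1, r1, r2, r3, r4, r5, r8⟩
  replace r1 : s1.reg 1 = n := r1
  replace r2 : s1.reg 2 = N := r2
  replace r3 : s1.reg 3 = ℓ := r3
  replace r4 : s1.reg 4 = ℓ + 1 := r4
  replace r5 : s1.reg 5 = α := r5
  replace r8 : s1.reg 8 = defense.length := r8
  refine Exec.branch ?_ (fun h => ?_) (fun h => ?_)
  · have := ite_one_zero_lt (W := X ^ 5) (by omega) (n < α)
    simp only [Expr.fits_lt, Expr.fits_reg, Expr.eval_reg, r1, r5]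
    omega
  · have hnα : n < α := by
      by_contra hc
      simp [r1, r5, hc] at h
    have hno : ¬ FixedDefensePureAttack G D ℓ α := by
      rintro ⟨A, -, hA⟩
      have : attackerPayoff G D A ≤ n := (Finset.card_le_univ _).trans (by simp)
      omega
    refine Exec.le (Exec.of_vc ⟨by simp; omega, ?_⟩) (?_ : 2 ≤ _)
    · exact ⟨fun hyes => absurd hyes hno, fun _ => by simp⟩
    · rw [solveCost]; omega
  · have hαn : α ≤ n := by
      by_contra hc
      simp [r1, r5, not_le.1 hc] at h
    obtain ⟨hL, hMX, hn3⟩ := hlim (by omega)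
    have hMeq := width_add_one hTD hB (by omega)
    refine exec_progSolve (N := N) (M := width bag + 1) (L := defense)
      (adj := fun v => adjG.getD v []) (LT := fun t => adjT.getD t [])
      (LB := fun t => bags.getD t []) hTD hD hG.2 hT.2 hB.2 (fun t => ?_) hMeq
      ⟨r1, r2, r3, r4, r5, r8, fun j hj => ?_, ?_, ?_, ?_, fun a ha i => ?_⟩ hL (by omega) (by omega)
      (fun v hv => ?_) (fun v hv => ?_) (fun v hv => ?_) ?_ hαn
    · by_cases ht : t < N
      · rw [← hMeq]
        exact Finset.le_sup (f := fun t => (bags.getD t []).length) (Finset.mem_range.2 ht)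
      · rw [List.getD_eq_default _ _ (by rw [hB.1]; omega)]
        simp
    · rw [k1.arr 1]
      exact List.getD_eq_getElem _ _ hj
    · rw [k1.arr 2, k1.arr 3, ← hG.1]
      exact stored_offsets adjG
    · rw [k1.arr 4, k1.arr 5, ← hT.1]
      exact stored_offsets adjT
    · rw [k1.arr 6, k1.arr 7, ← hB.1]
      exact stored_offsets bags
    · rw [k1.arr' a rfl]
      obtain ⟨a, rfl⟩ := Nat.exists_eq_add_of_le' ha
      rfl
    · rw [k1.arr 2]
      refine lt_of_le_of_lt (getD_offsets_le hG.length_le (by rw [hG.1]; exact hv)) ?_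
      have : adjG.length * n ≤ X * X := by rw [hG.1]; exact Nat.mul_le_mul (by omega) (by omega)
      rw [← sq] at this
      omega
    · rw [k1.arr 4]
      refine lt_of_le_of_lt (getD_offsets_le hT.length_le (by rw [hT.1]; exact hv)) ?_
      have : adjT.length * N ≤ X * X := by rw [hT.1]; exact Nat.mul_le_mul (by omega) (by omega)
      rw [← sq] at this
      omega
    · rw [k1.arr 6]
      refine lt_of_le_of_lt (getD_offsets_le hB.length_le (by rw [hB.1]; exact hv)) ?_
      have : bags.length * n ≤ X * X := by rw [hB.1]; exact Nat.mul_le_mul (by omega) (by omega)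
      rw [← sq] at this
      omega
    · have h3 : (n + 1) * ((n + 1) * (n + 3)) ≤ X * (X * X) :=
        Nat.mul_le_mul (by omega) (Nat.mul_le_mul (by omega) (by omega))
      have h4 : X * (X * X) * 2 ≤ X ^ 5 := by
        calc X * (X * X) * 2 ≤ X * (X * X) * X ^ 2 := Nat.mul_le_mul_left _ (by omega)
          _ = X ^ 5 := by ring
      have h5 : X ≤ X * (X * X) := Nat.le_mul_of_pos_right _ (by have : 0 < X := by omega
                                                                 positivity)
      omega

end ControllerGame

theorem theorem5p3 :
    ∃ (p : ControllerGame.Program) (C c : ℕ),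
      ∀ (n N ℓ α : ℕ) (G : SimpleGraph (Fin n)) (D : Finset (Fin n))
        (T : SimpleGraph (Fin N)) (bag : Fin N → Finset (Fin n))
        (defense : List ℕ) (adjG adjT bags : List (List ℕ)),
        0 < ℓ → 0 < α →
        ControllerGame.IsTreeDecomposition G T bag →
        ControllerGame.Lists defense (D : Set (Fin n)) →
        ControllerGame.ListsFamily adjG G.neighborSet →
        ControllerGame.ListsFamily adjT T.neighborSet →
        ControllerGame.ListsFamily bags (fun t => (bag t : Set (Fin n))) →
        ∃ (s : ControllerGame.State) (k : ℕ),
          ControllerGame.Run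
            ((ControllerGame.timeBound (ControllerGame.width bag) ℓ n N + ℓ + α + 2) ^ c) p
            (ControllerGame.State.init
              (ControllerGame.inputArrays n N ℓ α defense adjG adjT bags)) s k ∧
          k ≤ C * ControllerGame.timeBound (ControllerGame.width bag) ℓ n N ∧
          (ControllerGame.FixedDefensePureAttack G D ℓ α → s.reg 0 = 1) ∧
          (¬ ControllerGame.FixedDefensePureAttack G D ℓ α → s.reg 0 = 0) :=
  ⟨ControllerGame.progMain, 5000, 5, fun _ _ _ _ _ _ _ _ _ _ _ _ hℓ hα hTD hD hG hT hB =>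
    ControllerGame.exec_progMain hℓ hα hTD hD hG hT hB⟩
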